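/- **Setting.** Let $a,m>0$ and let $U:\mathbb R\to\mathbb R$ be a smooth function, bounded from below, with $U(\pm a)=U'(\pm a)=0$, $U''(\pm a)>0$, $U(\psi)>0$ for $\psi\in(-a,a)$, and $U(\psi)=\frac{m^2}{2}(\psi\mp a)^2+O(|\psi\mp a|^{14})$ as $\psi\to\pm a$ (condition **U1**). Put $F=-U'$, and let $s$ be a kink: $s''=U'(s)$ on $\mathbb R$, $s(\pm\infty)=\pm a$. For $|v|<1$ let $\gamma=1/\sqrt{1-v^2}$, $\psi_v(x)=s(\gamma x)$, $\pi_v=-v\psi_v'$, and for $b\in\mathbb R$ let $S(b,v)=(\psi_v(\cdot-b),\pi_v(\cdot-b))$. For $\alpha\in\mathbb R$ let $\|f\|_{L^2_\alpha}=\|(1+|x|)^\alpha f\|_{L^2(\mathbb R)}$, $\|f\|_{H^1_\alpha}=\|f\|_{L^2_\alpha}+\|f'\|_{L^2_\alpha}$, $E_\alpha=H^1_\alpha\oplus L^2_\alpha$ with $\|(\Psi,\Pi)\|_{E_\alpha}=\|\Psi\|_{H^1_\alpha}+\|\Pi\|_{L^2_\alpha}$, and let $\mathcal E=\{S(b,v):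 b\in\mathbb R,\ |v|<1\}+E_0$ with the metric $\|Y_1-Y_2\|_{E_0}$. Let $Y=(\psi,\pi)\in C(\mathbb R,\mathcal E)$ be a solution, in the sense of distributions, of $\dot\psi=\pi$, $\dot\pi=\psi''+F(\psi)$. Let $0<t_*\le\infty$, and let $b(t)\in\mathbb R$, $v(t)\in(-1,1)$ be differentiable functions on $[0,t_*)$. Define the perturbation $X(t)=(\Psi(t),\Pi(t))$, in the moving frame coordinate $y=x-b(t)$, by $$\psi(x,t)=\psi_{v(t)}(x-b(t))+\Psi(x-b(t),t),\qquad \pi(x,t)=\pi_{v(t)}(x-b(t))+\Pi(x-b(t),t),$$ and suppose that, for every $t\in[0,t_*)$, it satisfies the symplectic orthogonality conditions $\Omega(X(t),\tau_j(v(t)))=0$, $j=1,2$, where $\Omega((\psi_1,\pi_1),(\psi_2,\pi_2))=\int(\psi_1\pi_2-\pi_1\psi_2)\,dx$, $\tau_1(v)=(-\psi_v',-\pi_v')$, $\tau_2(v)=(\partial_v\psi_v,\partial_v\pi_v)$. For $\beta>5/2$ define the majorants $$m_1(t)=\sup_{0\le r\le t}(1+r)^{3/2}\|X(r)\|_{E_{-\beta}},\qquad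 m_2(t)=\sup_{0\le r\le t}(1+r)^{1/2}\|\Psi(r)\|_{L^\infty}.$$ **Proposition A.1 (virial type estimate).** Let $U$ satisfy **U1**, let $s$ be a kink, and let $\beta>5/2$, $\overline v<1$. There is an $\varepsilon>0$ such that for all $\nu>0$ and $d_0\ge0$ there is a constant $C=C(\overline v,d_0)$ (depending, besides $\overline v$ and $d_0$, only on $U,a,m,s,\beta,\nu$; in particular not on $t$, $t_*$, $b$, $v$ or the solution) with the following property. If $Y$, $t_*$, $b$, $v$, $X$ are as above, with $|v(0)|\le\overline v$, with $m_1(t)<\varepsilon$ and $m_2(t)<\varepsilon$ for all $t\in[0,t_*)$ (that is, up to the exit time), and if $X(0)\in E_{5/2+\nu}$ with $\|X(0)\|_{E_{5/2+\nu}}\le d_0$, then for all $0<t<t_*$ $$\Psi(t)\in L^2_{5/2+\nu}\quad\text{and}\quad\|\Psi(t)\|_{L^2_{5/2+\nu}}\le C(\overline v,d_0)\,(1+t)^{4+\nu}.$$ -/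

import Mathlib

open Filter Topology MeasureTheory Asymptotics Set
open scoped ContDiff ENNReal

noncomputable section

namespace KinkVirial

/-! ### Weighted Sobolev spaces on the line -/

/-- `g` is a weak (distributional) derivative of `f` on the real line. -/
def HasWeakDeriv (f g : ℝ → ℝ) : Prop :=
  LocallyIntegrable f volume ∧ LocallyIntegrable g volume ∧
    ∀ φ : ℝ → ℝ, ContDiff ℝ ∞ φ → HasCompactSupport φ →
      ∫ x, f x * deriv φ x = - ∫ x, g x * φ x

/-- The function `x ↦ (1 + |x|) ^ α * f x`. -/
def weighted (α : ℝ) (f : ℝ → ℝ) : ℝ → ℝ := fun x => (1 + |x|) ^ α * f x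

/-- Membership in Agmon's weighted space `L²_α`. -/
def MemL2 (α : ℝ) (f : ℝ → ℝ) : Prop := MemLp (weighted α f) 2 volume

/-- The norm of `L²_α`, as an extended number. -/
def normL2 (α : ℝ) (f : ℝ → ℝ) : ℝ≥0∞ := eLpNorm (weighted α f) 2 volume

/-- Membership in the weighted Sobolev space `H¹_α`. -/
def MemH1 (α : ℝ) (f : ℝ → ℝ) : Prop :=
  MemL2 α f ∧ ∃ g, HasWeakDeriv f g ∧ MemL2 α g

/-- The norm `‖f‖_{L²_α} + ‖f'‖_{L²_α}` of `H¹_α`. A weak derivative is unique up to null sets,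
so that the infimum is over one value only; it is `∞` if there is no weak derivative. -/
def normH1 (α : ℝ) (f : ℝ → ℝ) : ℝ≥0∞ :=
  normL2 α f + ⨅ (g : ℝ → ℝ) (_ : HasWeakDeriv f g), normL2 α g

/-- A state `(ψ, π)`: a field and its momentum. -/
abbrev State : Type := (ℝ → ℝ) × (ℝ → ℝ)

/-- Membership in `E_α = H¹_α ⊕ L²_α`. -/
def MemE (α : ℝ) (X : State) : Prop := MemH1 α X.1 ∧ MemL2 α X.2

/-- The norm of `E_α`. -/
def normE (α : ℝ) (X : State) : ℝ≥0∞ := normH1 α X.1 + normL2 α X.2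

/-! ### The potential, the kink and the solitary manifold -/

/-- The condition on the double well potential `U` with wells at `±a`. -/
structure ConditionU1 (U : ℝ → ℝ) (a m : ℝ) : Prop where
  a_pos : 0 < a
  m_pos : 0 < m
  smooth : ContDiff ℝ ∞ U
  zero_right : U a = 0
  zero_left : U (-a) = 0
  deriv_right : deriv U a = 0
  deriv_left : deriv U (-a) = 0
  deriv2_right : 0 < deriv (deriv U) a
  deriv2_left : 0 < deriv (deriv U) (-a)
  pos : ∀ ψ ∈ Ioo (-a) a, 0 < U ψ
  bddBelow : BddBelow (range U)
  flat_right : (fun ψ => U ψ - m ^ 2 / 2 * (ψ - a) ^ 2) =O[𝓝 a] fun ψ => |ψ - a| ^ 14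
  flat_left : (fun ψ => U ψ - m ^ 2 / 2 * (ψ + a) ^ 2) =O[𝓝 (-a)] fun ψ => |ψ + a| ^ 14

/-- `s` is a kink: `s'' = U'(s)`, with `s(±∞) = ±a`. -/
structure IsKink (U : ℝ → ℝ) (a : ℝ) (s : ℝ → ℝ) : Prop where
  differentiable : Differentiable ℝ s
  stationary : ∀ x, HasDerivAt (deriv s) (deriv U (s x)) x
  atTop : Tendsto s atTop (𝓝 a)
  atBot : Tendsto s atBot (𝓝 (-a))

/-- The Lorentz factor. -/
def lorentz (v : ℝ) : ℝ := 1 / √(1 - v ^ 2)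

/-- `ψ_v(x) = s(γ x)`. -/
def psiV (s : ℝ → ℝ) (v : ℝ) : ℝ → ℝ := fun x => s (lorentz v * x)

/-- `π_v(x) = - v ψ_v'(x)`. -/
def piV (s : ℝ → ℝ) (v : ℝ) : ℝ → ℝ := fun x => - v * deriv (psiV s v) x

/-- The soliton state `S(b, v) = (ψ_v(x - b), π_v(x - b))`. -/
def soliton (s : ℝ → ℝ) (b v : ℝ) : State :=
  (fun x => psiV s v (x - b), fun x => piV s v (x - b))

/-- Membership in the phase space `𝓔 = 𝓢 + E`, where `𝓢` is the solitary manifold and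
`E = E_0`. -/
def MemPhase (s : ℝ → ℝ) (Y : State) : Prop :=
  ∃ b v : ℝ, |v| < 1 ∧ MemE 0 (Y - soliton s b v)

/-! ### Solutions -/

/-- `Y ∈ C(ℝ, 𝓔)` is a solution of `ψ̇ = π`, `π̇ = ψ'' + F(ψ)`, where `F = -U'`. All derivatives
are in the sense of distributions: `Y` is differentiable as a map into the distributions on the
line (that is, after pairing with every test function), with derivative `(π, ψ'' + F(ψ))`. -/
structure IsSolution (U s : ℝ → ℝ) (Y : ℝ → State) : Prop where
  mem : ∀ t, MemPhase s (Y t)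
  continuous : ∀ t₀, Tendsto (fun t => normE 0 (Y t - Y t₀)) (𝓝 t₀) (𝓝 0)
  eq_fst : ∀ η : ℝ → ℝ, ContDiff ℝ ∞ η → HasCompactSupport η → ∀ t,
    HasDerivAt (fun r => ∫ x, (Y r).1 x * η x) (∫ x, (Y t).2 x * η x) t
  eq_snd : ∀ η : ℝ → ℝ, ContDiff ℝ ∞ η → HasCompactSupport η → ∀ t,
    HasDerivAt (fun r => ∫ x, (Y r).2 x * η x)
      (∫ x, ((Y t).1 x * deriv (deriv η) x + -deriv U ((Y t).1 x) * η x)) t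

/-! ### Symplectic decomposition along the solitary manifold -/

/-- The symplectic form `Ω(Y₁, Y₂) = ⟨ψ₁, π₂⟩ - ⟨π₁, ψ₂⟩`. -/
def symp (Y₁ Y₂ : State) : ℝ := (∫ x, Y₁.1 x * Y₂.2 x) - ∫ x, Y₁.2 x * Y₂.1 x

/-- The tangent vector `τ₁(v) = ∂_b S = (-ψ_v'(y), -π_v'(y))`, in the moving frame coordinate
`y = x - b`. -/
def tau₁ (s : ℝ → ℝ) (v : ℝ) : State :=
  (fun y => - deriv (psiV s v) y, fun y => - deriv (piV s v) y)

/-- The tangent vector `τ₂(v) = ∂_v S = (∂_v ψ_v(y), ∂_v π_v(y))`, in the moving frame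
coordinate. -/
def tau₂ (s : ℝ → ℝ) (v : ℝ) : State :=
  (fun y => deriv (fun w => psiV s w y) v, fun y => deriv (fun w => piV s w y) v)

/-- The perturbation `X = (Ψ, Π)` of the soliton `S(b, v)` in the state `Y = (ψ, π)`, in the moving
frame coordinate: `ψ(x) = ψ_v(x - b) + Ψ(x - b)`, `π(x) = π_v(x - b) + Π(x - b)`. -/
def perturbation (s : ℝ → ℝ) (b v : ℝ) (Y : State) : State :=
  (fun y => Y.1 (y + b) - psiV s v y, fun y => Y.2 (y + b) - piV s v y)

/-- The time interval `[0, T)`, where `T` may be infinite. -/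
def timeInterval (T : ℝ≥0∞) : Set ℝ := {t | 0 ≤ t ∧ ENNReal.ofReal t < T}

/-- `Y(t) = S(b(t), v(t)) + X(t)` on `[0, T)`, where the parameters are differentiable in time and
`X(t)` is symplectic orthogonal to the tangent space of the solitary manifold at `S(b(t), v(t))`. -/
structure IsSymplecticSplitting (s : ℝ → ℝ) (Y : ℝ → State) (T : ℝ≥0∞) (b v : ℝ → ℝ) : Prop where
  diff_b : DifferentiableOn ℝ b (timeInterval T)
  diff_v : DifferentiableOn ℝ v (timeInterval T)
  subluminal : ∀ t ∈ timeInterval T, |v t| < 1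
  orth₁ : ∀ t ∈ timeInterval T, symp (perturbation s (b t) (v t) (Y t)) (tau₁ s (v t)) = 0
  orth₂ : ∀ t ∈ timeInterval T, symp (perturbation s (b t) (v t) (Y t)) (tau₂ s (v t)) = 0

/-- The majorant `m₁(t) = sup_{0 ≤ r ≤ t} (1 + r)^{3/2} ‖X(r)‖_{E_{-β}}`. -/
def majorant₁ (β : ℝ) (X : ℝ → State) (t : ℝ) : ℝ≥0∞ :=
  ⨆ r ∈ Icc 0 t, ENNReal.ofReal ((1 + r) ^ (3 / 2 : ℝ)) * normE (-β) (X r)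

/-- The majorant `m₂(t) = sup_{0 ≤ r ≤ t} (1 + r)^{1/2} ‖Ψ(r)‖_{L^∞}`. -/
def majorant₂ (X : ℝ → State) (t : ℝ) : ℝ≥0∞ :=
  ⨆ r ∈ Icc 0 t, ENNReal.ofReal ((1 + r) ^ (1 / 2 : ℝ)) * eLpNorm (X r).1 ∞ volume

end KinkVirial

end

/-! The proof is a finite propagation argument with a weight. The bound on the second majorant keeps
`ψ` within `ε` of the moving kink, hence in a neighbourhood of `[-a, a]` on which `U ≥ 0`. The
energy density `e = π²/2 + ψ'²/2 + U(ψ)` is then nonnegative and dominates the energy flux. If a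
nonnegative weight `φ(t, x)` satisfies `|φ_x| ≤ -φ_t`, then `∫ φ e` does not increase. The weight
used grows like `(|x - b(0)| - t)_+^{2α}` with `α = 5/2 + ν`. Since the kink approaches the wells
exponentially, the weighted energy at time `0` is bounded in terms of `‖X(0)‖` in `E_α`
(`exists_initial_energy_bound`), so the same bound holds at time `t` (`IsSolution.cone_energy_le`).

Two consequences of this bound finish the proof. First, `|b(t) - b(0)| ≤ R + t`
(`abs_sub_centre_le`). At `b(t)` the field is near `s(0)`, away from both wells, and on the unit
interval on the outer side of `b(t)` it must pay a fixed amount of energy; at distance more than `R`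
outside the light cone the weight makes this too expensive. Second, on each side of `b(t)` the
function `Ψ²` is at most a multiple of `U(ψ)` plus the squared distance of the kink to the well,
which is exponentially small (`normL2_perturbation_sq_le`). Replacing the weight centred at `b(t)`
by the cone weight costs a factor `(1 + t)^{2α}` in the squared norm (`weight_le_growth`). The norm
thus grows at most like `(1 + t)^{5/2 + ν}`, which is below the claimed rate.

The solution is only a distributional one, so the energy inequality is proved for its mollification
in `x`. This solves a wave equation whose force differs from `F` of the mollified field by `O(√δ)`
on bounded sets, because `ψ` is Hölder continuous of exponent `1/2` there. A cutoff makes the weight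
compactly supported while `δ → 0`; it is removed afterwards, and both limits use Fatou's lemma. -/

noncomputable section

namespace KinkVirial

/-! ### Quadratic bounds for the potential near its wells -/

section Potential

variable {U : ℝ → ℝ} {a m : ℝ}

/-- Exchanges the two wells, so that estimates need only be proved at `a`. -/
lemma ConditionU1.reflect (hU : ConditionU1 U a m) : ConditionU1 (fun x => U (-x)) a m := by
  have hd : deriv (fun x => U (-x)) = fun x => -deriv U (-x) := by
    ext x; exact deriv_comp_neg U x
  have hd2 : ∀ x, deriv (deriv (fun x => U (-x))) x = deriv (deriv U) (-x) := by
    intro x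
    rw [hd]
    have := deriv_comp_neg (deriv U) x
    rw [deriv.fun_neg, this, neg_neg]
  refine ⟨hU.a_pos, hU.m_pos, hU.smooth.comp contDiff_neg, hU.zero_left, ?_, ?_, ?_, ?_, ?_,
    fun ψ hψ => hU.pos _ ⟨by linarith [hψ.2], by linarith [hψ.1]⟩, ?_, ?_, ?_⟩
  · simpa using hU.zero_right
  · rw [hd]; simpa using hU.deriv_left
  · rw [hd]; simpa using hU.deriv_right
  · rw [hd2]; exact hU.deriv2_left
  · rw [hd2]; simpa using hU.deriv2_right
  · exact hU.bddBelow.mono (by rintro _ ⟨x, rfl⟩; exact ⟨-x, rfl⟩)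
  · have ht : Tendsto (fun x : ℝ => -x) (𝓝 a) (𝓝 (-a)) := continuous_neg.tendsto a
    refine ((hU.flat_left.comp_tendsto ht).congr_left fun x => ?_).congr_right fun x => ?_
    · simp only [Function.comp]; ring
    · simp only [Function.comp]; rw [← abs_neg]; ring_nf
  · have ht : Tendsto (fun x : ℝ => -x) (𝓝 (-a)) (𝓝 a) := by
      simpa using continuous_neg.tendsto (-a)
    refine ((hU.flat_right.comp_tendsto ht).congr_left fun x => ?_).congr_right fun x => ?_
    · simp only [Function.comp]; ring
    · simp only [Function.comp]; rw [← abs_neg]; ring_nf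

/-- The remainder is `C |ψ - a|^12` times the square, and the first factor tends to zero; a
remainder of any order above two would serve. -/
lemma ConditionU1.exists_quadratic_right (hU : ConditionU1 U a m) :
    ∃ ε > 0, ∀ ψ, |ψ - a| ≤ ε →
      m ^ 2 / 4 * (ψ - a) ^ 2 ≤ U ψ ∧ U ψ ≤ m ^ 2 * (ψ - a) ^ 2 := by
  obtain ⟨C, hC⟩ := hU.flat_right.bound
  have hm : 0 < m ^ 2 := by have := hU.m_pos; positivity
  have hlim : Tendsto (fun ψ : ℝ => C * |ψ - a| ^ 12) (𝓝 a) (𝓝 0) := by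
    have : Continuous (fun ψ : ℝ => C * |ψ - a| ^ 12) := by fun_prop
    simpa using this.tendsto a
  have hsmall : ∀ᶠ ψ in 𝓝 a, C * |ψ - a| ^ 12 < m ^ 2 / 4 :=
    hlim.eventually (gt_mem_nhds (by positivity))
  obtain ⟨ε, hε, h⟩ := Metric.eventually_nhds_iff.1 (hC.and hsmall)
  refine ⟨ε / 2, by positivity, fun ψ hψ => ?_⟩
  obtain ⟨h1, h2⟩ := h (y := ψ) (by rw [Real.dist_eq]; linarith)
  rw [Real.norm_eq_abs, Real.norm_eq_abs, abs_pow, abs_abs] at h1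
  have h3 : C * |ψ - a| ^ 14 ≤ m ^ 2 / 4 * (ψ - a) ^ 2 := by
    have : C * |ψ - a| ^ 14 = (C * |ψ - a| ^ 12) * (ψ - a) ^ 2 := by
      rw [← sq_abs (ψ - a)]; ring
    rw [this]
    exact mul_le_mul_of_nonneg_right h2.le (sq_nonneg _)
  have h4 := abs_le.1 (h1.trans h3)
  have := mul_nonneg hm.le (sq_nonneg (ψ - a))
  constructor <;> linarith [h4.1, h4.2]

/-- Near each well the potential is comparable to the square of the distance to the well. -/
lemma ConditionU1.exists_quadratic (hU : ConditionU1 U a m) :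
    ∃ ε > 0, ε ≤ 1 ∧ (∀ ψ, |ψ - a| ≤ ε →
      m ^ 2 / 4 * (ψ - a) ^ 2 ≤ U ψ ∧ U ψ ≤ m ^ 2 * (ψ - a) ^ 2) ∧
      (∀ ψ, |ψ + a| ≤ ε →
      m ^ 2 / 4 * (ψ + a) ^ 2 ≤ U ψ ∧ U ψ ≤ m ^ 2 * (ψ + a) ^ 2) := by
  obtain ⟨ε₁, h₁, H₁⟩ := hU.exists_quadratic_right
  obtain ⟨ε₂, h₂, H₂⟩ := hU.reflect.exists_quadratic_right
  refine ⟨min 1 (min ε₁ ε₂), by positivity, min_le_left _ _, fun ψ hψ => H₁ ψ ?_,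
    fun ψ hψ => ?_⟩
  · exact hψ.trans ((min_le_right _ _).trans (min_le_left _ _))
  · have := H₂ (-ψ) (by
      rw [← abs_neg]
      have := hψ.trans ((min_le_right _ _).trans (min_le_right _ _))
      simpa [add_comm] using this)
    have e : (-ψ - a) ^ 2 = (ψ + a) ^ 2 := by ring
    rw [e, neg_neg] at this
    exact this

/-- Away from a well the square is at least `ε²`, so boundedness of `U` on the compact interval is
enough. -/
lemma ConditionU1.exists_upper (hU : ConditionU1 U a m) (R : ℝ) :
    ∃ K > 0, ∀ ψ, |ψ| ≤ R → U ψ ≤ K * (ψ - a) ^ 2 ∧ U ψ ≤ K * (ψ + a) ^ 2 := by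
  obtain ⟨ε, hε, -, H₁, H₂⟩ := hU.exists_quadratic
  obtain ⟨B, hB⟩ := (isCompact_Icc (a := -R) (b := R)).exists_bound_of_continuousOn
    hU.smooth.continuous.continuousOn
  have hm := hU.m_pos
  have key : ∀ z : ℝ, ε < |z| → ∀ u, u ≤ B → u ≤ (m ^ 2 + |B| / ε ^ 2) * z ^ 2 := by
    intro z hz u hu
    have h1 : ε ^ 2 ≤ z ^ 2 := by rw [← sq_abs z]; gcongr
    calc u ≤ |B| := hu.trans (le_abs_self _)
      _ = |B| / ε ^ 2 * ε ^ 2 := by field_simp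
      _ ≤ |B| / ε ^ 2 * z ^ 2 := by gcongr
      _ ≤ _ := by gcongr; linarith [sq_nonneg m]
  have hb : ∀ ψ, |ψ| ≤ R → U ψ ≤ B := fun ψ hψ =>
    (le_abs_self _).trans (hB ψ (abs_le.1 hψ))
  have hle : m ^ 2 ≤ m ^ 2 + |B| / ε ^ 2 := le_add_of_nonneg_right (by positivity)
  refine ⟨m ^ 2 + |B| / ε ^ 2, by positivity, fun ψ hψ => ⟨?_, ?_⟩⟩
  · rcases le_or_gt |ψ - a| ε with h | h
    · exact (H₁ ψ h).2.trans (mul_le_mul_of_nonneg_right hle (sq_nonneg _))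
    · exact key _ h _ (hb ψ hψ)
  · rcases le_or_gt |ψ + a| ε with h | h
    · exact (H₂ ψ h).2.trans (mul_le_mul_of_nonneg_right hle (sq_nonneg _))
    · exact key _ h _ (hb ψ hψ)

/-- Between the wells `U` has a positive minimum on compact sets. The overshoot `ε` beyond `a` is
fixed before `η`: past the well the sign of `U` is known only nearby, whereas `η` will later depend
on the kink. -/
lemma ConditionU1.exists_lower_right (hU : ConditionU1 U a m) :
    ∃ ε > 0, ∀ η > 0, ∃ c > 0, ∀ ψ ∈ Icc (-a + η) (a + ε), c * (ψ - a) ^ 2 ≤ U ψ := by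
  obtain ⟨ε, hε, H⟩ := hU.exists_quadratic_right
  have hm := hU.m_pos
  have ha := hU.a_pos
  refine ⟨ε, hε, fun η hη => ?_⟩
  have hc : ∃ c > 0, ∀ ψ ∈ Icc (-a + η) (a - ε), c ≤ U ψ := by
    rcases (Icc (-a + η) (a - ε)).eq_empty_or_nonempty with h | h
    · exact ⟨1, one_pos, fun ψ hψ => by simp [h] at hψ⟩
    · obtain ⟨x, hx, hmin⟩ := isCompact_Icc.exists_isMinOn h hU.smooth.continuous.continuousOn
      exact ⟨U x, hU.pos x ⟨by linarith [hx.1], by linarith [hx.2]⟩, fun ψ hψ => hmin hψ⟩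
  obtain ⟨c, hc, hc'⟩ := hc
  refine ⟨min (m ^ 2 / 4) (c / (4 * a ^ 2)), by positivity, fun ψ hψ => ?_⟩
  rcases le_or_gt |ψ - a| ε with h | h
  · exact (mul_le_mul_of_nonneg_right (min_le_left _ _) (sq_nonneg _)).trans (H ψ h).1
  · have h1 : ψ ≤ a - ε := by
      rcases lt_abs.1 h with h | h <;> linarith [hψ.2]
    have h2 : (ψ - a) ^ 2 ≤ 4 * a ^ 2 := by nlinarith [hψ.1]
    calc _ ≤ c / (4 * a ^ 2) * (4 * a ^ 2) :=
          mul_le_mul (min_le_right _ _) h2 (sq_nonneg _) (by positivity)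
      _ = c := by field_simp
      _ ≤ U ψ := hc' ψ ⟨hψ.1, h1⟩

/-- The potential is nonnegative in a neighbourhood of `[-a, a]`, and away from either well it
dominates the square of the distance to the other well. -/
lemma ConditionU1.exists_lower (hU : ConditionU1 U a m) :
    ∃ ε > 0, (∀ ψ ∈ Icc (-a - ε) (a + ε), 0 ≤ U ψ) ∧ ∀ η > 0, ∃ c > 0,
      (∀ ψ ∈ Icc (-a + η) (a + ε), c * (ψ - a) ^ 2 ≤ U ψ) ∧
      (∀ ψ ∈ Icc (-a - ε) (a - η), c * (ψ + a) ^ 2 ≤ U ψ) := by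
  obtain ⟨ε₁, h₁, H₁⟩ := hU.exists_lower_right
  obtain ⟨ε₂, h₂, H₂⟩ := hU.reflect.exists_lower_right
  have key : ∀ η > 0, ∃ c > 0,
      (∀ ψ ∈ Icc (-a + η) (a + min ε₁ ε₂), c * (ψ - a) ^ 2 ≤ U ψ) ∧
      (∀ ψ ∈ Icc (-a - min ε₁ ε₂) (a - η), c * (ψ + a) ^ 2 ≤ U ψ) := by
    intro η hη
    obtain ⟨c₁, hc₁, H₁⟩ := H₁ η hη
    obtain ⟨c₂, hc₂, H₂⟩ := H₂ η hη
    refine ⟨min c₁ c₂, lt_min hc₁ hc₂, fun ψ hψ => ?_, fun ψ hψ => ?_⟩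
    · exact (mul_le_mul_of_nonneg_right (min_le_left _ _) (sq_nonneg _)).trans
        (H₁ ψ ⟨hψ.1, hψ.2.trans (by gcongr; exact min_le_left _ _)⟩)
    · have := H₂ (-ψ) ⟨by linarith [hψ.2], by linarith [hψ.1, min_le_right ε₁ ε₂]⟩
      have e : (-ψ - a) ^ 2 = (ψ + a) ^ 2 := by ring
      rw [e, neg_neg] at this
      exact (mul_le_mul_of_nonneg_right (min_le_right _ _) (sq_nonneg _)).trans this
  refine ⟨min ε₁ ε₂, lt_min h₁ h₂, fun ψ hψ => ?_, key⟩
  -- With `η = a` the two ranges meet at `0` and cover the whole interval.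
  obtain ⟨c, hc, h1, h2⟩ := key a hU.a_pos
  rcases le_total 0 ψ with h | h
  · exact (mul_nonneg hc.le (sq_nonneg _)).trans (h1 ψ ⟨by linarith, hψ.2⟩)
  · exact (mul_nonneg hc.le (sq_nonneg _)).trans (h2 ψ ⟨hψ.1, by linarith⟩)

end Potential

/-! ### The kink: first integral, monotonicity, exponential decay -/

section Kink

variable {U s : ℝ → ℝ} {a m : ℝ}

/-- Companion of `ConditionU1.reflect`: it exchanges the two ends of the line together with the
wells. -/
lemma IsKink.reflect (hs : IsKink U a s) : IsKink (fun x => U (-x)) a (fun x => -s (-x)) := by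
  have hd : deriv (fun x => -s (-x)) = fun x => deriv s (-x) := by
    ext x
    rw [deriv.fun_neg, deriv_comp_neg, neg_neg]
  refine ⟨(hs.differentiable.comp differentiable_neg).neg, fun x => ?_, ?_, ?_⟩
  · rw [hd, deriv_comp_neg, neg_neg]
    have := (hs.stationary (-x)).scomp x (hasDerivAt_neg x)
    simpa [Function.comp_def] using this
  · simpa using (hs.atBot.comp tendsto_neg_atTop_atBot).neg
  · exact (hs.atTop.comp tendsto_neg_atBot_atTop).neg

lemma IsKink.hasDerivAt (hs : IsKink U a s) (x : ℝ) : HasDerivAt s (deriv s x) x :=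
  (hs.differentiable x).hasDerivAt

lemma IsKink.continuous_deriv (hs : IsKink U a s) : Continuous (deriv s) :=
  continuous_iff_continuousAt.2 fun x => (hs.stationary x).continuousAt

/-- Conservation of energy for the stationary equation. Decay of `s'` is not assumed, so the
constant is evaluated along mean value points `ξ n`, where `s' (ξ n) = s (n + 1) - s n → 0`. -/
lemma IsKink.deriv_sq (hU : ConditionU1 U a m) (hs : IsKink U a s) (x : ℝ) :
    deriv s x ^ 2 = 2 * U (s x) := by
  have hd : ∀ x, HasDerivAt (fun x => deriv s x ^ 2 - 2 * U (s x)) 0 x := by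
    intro x
    have hU' : HasDerivAt U (deriv U (s x)) (s x) :=
      (hU.smooth.differentiable (by simp) _).hasDerivAt
    have h1 := ((hs.stationary x).pow 2).sub ((hU'.comp x (hs.hasDerivAt x)).const_mul 2)
    refine h1.congr_deriv ?_
    push_cast
    ring
  have hconst : ∀ y, deriv s y ^ 2 - 2 * U (s y) = deriv s x ^ 2 - 2 * U (s x) := fun y =>
    is_const_of_deriv_eq_zero (fun x => (hd x).differentiableAt) (fun x => (hd x).deriv) y x
  have hmvt : ∀ n : ℕ, ∃ ξ : ℝ, (n : ℝ) ≤ ξ ∧ deriv s ξ = s (n + 1) - s n := by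
    intro n
    obtain ⟨ξ, hξ, h⟩ := exists_deriv_eq_slope s (lt_add_one (n : ℝ))
      hs.differentiable.continuous.continuousOn hs.differentiable.differentiableOn
    exact ⟨ξ, hξ.1.le, by rw [h]; simp⟩
  choose ξ hξ hξ' using hmvt
  have hξt : Tendsto ξ Filter.atTop Filter.atTop := tendsto_atTop_mono hξ tendsto_natCast_atTop_atTop
  have hUc := hU.smooth.continuous
  have l1 : Tendsto (fun n => deriv s (ξ n) ^ 2 - 2 * U (s (ξ n))) Filter.atTop (𝓝 0) := by
    have h1 : Tendsto (fun n : ℕ => s ((n : ℝ) + 1)) Filter.atTop (𝓝 a) :=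
      hs.atTop.comp (tendsto_atTop_add_const_right _ _ tendsto_natCast_atTop_atTop)
    have h2 : Tendsto (fun n : ℕ => s (n : ℝ)) Filter.atTop (𝓝 a) :=
      hs.atTop.comp tendsto_natCast_atTop_atTop
    have h3 : Tendsto (fun n => U (s (ξ n))) Filter.atTop (𝓝 (U a)) :=
      (hUc.tendsto a).comp (hs.atTop.comp hξt)
    have := ((h1.sub h2).pow 2).sub (h3.const_mul 2)
    simp only [hξ']
    simpa [hU.zero_right] using this
  have l2 : Tendsto (fun n => deriv s (ξ n) ^ 2 - 2 * U (s (ξ n))) Filter.atTop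
      (𝓝 (deriv s x ^ 2 - 2 * U (s x))) := by
    simp only [hconst]; exact tendsto_const_nhds
  linarith [tendsto_nhds_unique l1 l2]

/-- Backward Grönwall argument: `|s'| ≤ √(2K) |s - a|` makes `(s - a)² exp (k x)` monotone, so
reaching `a` at `x₀` forces `s = a` on all of `(-∞, x₀]`, against the limit `-a`. -/
lemma IsKink.ne_right (hU : ConditionU1 U a m) (hs : IsKink U a s) (x₀ : ℝ) : s x₀ ≠ a := by
  intro h0
  have key : ∀ x ≤ x₀, s x = a := by
    intro x hx
    obtain ⟨R, hR⟩ := (isCompact_Icc (a := x) (b := x₀)).exists_bound_of_continuousOn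
      hs.differentiable.continuous.continuousOn
    obtain ⟨K, hK, hKU⟩ := hU.exists_upper R
    set k := 2 * √(2 * K)
    have hmono : MonotoneOn (fun y => (s y - a) ^ 2 * Real.exp (k * y)) (Icc x x₀) := by
      have hd : ∀ y, HasDerivAt (fun y => (s y - a) ^ 2 * Real.exp (k * y))
          ((2 * (s y - a) * deriv s y + k * (s y - a) ^ 2) * Real.exp (k * y)) y := by
        intro y
        have h1 := (((hs.hasDerivAt y).sub_const a).pow 2).mul
          (((hasDerivAt_id y).const_mul k).exp)
        refine h1.congr_deriv ?_
        simp only [id, Pi.pow_apply]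
        push_cast
        ring
      refine monotoneOn_of_deriv_nonneg (convex_Icc _ _)
        (fun y _ => (hd y).continuousAt.continuousWithinAt)
        (fun y _ => (hd y).differentiableAt.differentiableWithinAt) (fun y hy => ?_)
      rw [(hd y).deriv]
      refine mul_nonneg ?_ (Real.exp_pos _).le
      have hy' : y ∈ Icc x x₀ := interior_subset hy
      have h1 : deriv s y ^ 2 ≤ 2 * K * (s y - a) ^ 2 := by
        rw [hs.deriv_sq hU]
        linarith [(hKU (s y) (hR y hy')).1]
      have h2 : |deriv s y| ≤ √(2 * K) * |s y - a| := by
        rw [← Real.sqrt_sq_eq_abs, ← Real.sqrt_sq_eq_abs, ← Real.sqrt_mul (by positivity)]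
        exact Real.sqrt_le_sqrt h1
      have h3 : |2 * (s y - a) * deriv s y| ≤ k * (s y - a) ^ 2 := by
        rw [abs_mul, abs_mul, abs_two, ← sq_abs (s y - a)]
        calc 2 * |s y - a| * |deriv s y| ≤ 2 * |s y - a| * (√(2 * K) * |s y - a|) := by gcongr
          _ = _ := by simp only [k]; ring
      linarith [(abs_le.1 h3).1]
    have h := hmono (left_mem_Icc.2 hx) (right_mem_Icc.2 hx) hx
    simp only [h0, sub_self] at h
    have h' : (s x - a) ^ 2 ≤ 0 := by
      by_contra hc
      push Not at hc
      have := mul_pos hc (Real.exp_pos (k * x))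
      simp at h
      linarith
    have := pow_eq_zero_iff (two_ne_zero) |>.1 (le_antisymm h' (sq_nonneg _))
    linarith
  have : Tendsto s Filter.atBot (𝓝 a) :=
    tendsto_const_nhds.congr' ((eventually_le_atBot x₀).mono fun x hx => (key x hx).symm)
  have h := tendsto_nhds_unique this hs.atBot
  linarith [hU.a_pos]

lemma IsKink.lt_right (hU : ConditionU1 U a m) (hs : IsKink U a s) (x : ℝ) : s x < a := by
  by_contra h
  push Not at h
  have h1 : ∀ᶠ y in Filter.atBot, s y < a := hs.atBot.eventually (gt_mem_nhds (by linarith [hU.a_pos]))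
  obtain ⟨y, hy⟩ := h1.exists
  obtain ⟨z, hz⟩ := mem_range_of_exists_le_of_exists_ge hs.differentiable.continuous
    ⟨y, hy.le⟩ ⟨x, h⟩
  exact hs.ne_right hU z hz

lemma IsKink.lt_left (hU : ConditionU1 U a m) (hs : IsKink U a s) (x : ℝ) : -a < s x := by
  have := hs.reflect.lt_right hU.reflect (-x)
  simp only [neg_neg] at this
  linarith

/-- By the first integral `s'` never vanishes, so it has one sign; the limit at `-∞` excludes the
negative one. -/
lemma IsKink.deriv_pos (hU : ConditionU1 U a m) (hs : IsKink U a s) (x : ℝ) : 0 < deriv s x := by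
  have hne : ∀ x, deriv s x ≠ 0 := by
    intro x hx
    have h1 := hs.deriv_sq hU x
    have h2 := hU.pos (s x) ⟨hs.lt_left hU x, hs.lt_right hU x⟩
    rw [hx] at h1
    linarith
  by_contra h
  push Not at h
  have hx : deriv s x < 0 := lt_of_le_of_ne h (hne x)
  have hneg : ∀ y, deriv s y < 0 := by
    intro y
    by_contra hy
    push Not at hy
    obtain ⟨z, hz⟩ := mem_range_of_exists_le_of_exists_ge hs.continuous_deriv ⟨x, h⟩ ⟨y, hy⟩
    exact hne z hz
  have hanti := strictAnti_of_deriv_neg hneg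
  have h1 : s 0 ≤ -a := ge_of_tendsto hs.atBot
    ((eventually_le_atBot 0).mono fun y hy => hanti.antitone hy)
  linarith [hs.lt_left hU 0]

lemma IsKink.strictMono (hU : ConditionU1 U a m) (hs : IsKink U a s) : StrictMono s :=
  strictMono_of_deriv_pos (hs.deriv_pos hU)

/-- Once `s > 0`, beyond `x₀`, the first integral and `U ≥ c₁ (s - a)²` give `s' ≥ c (a - s)`, so
`(a - s) exp (c x)` decreases. Before `x₀` the trivial bound `2a` is enough. -/
lemma IsKink.exists_decay_right (hU : ConditionU1 U a m) (hs : IsKink U a s) :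
    ∃ C > 0, ∃ c > 0, ∀ x, a - s x ≤ C * Real.exp (-(c * x)) := by
  obtain ⟨ε, hε, -, H⟩ := hU.exists_lower
  obtain ⟨c₁, hc₁, H, -⟩ := H a hU.a_pos
  have ha := hU.a_pos
  obtain ⟨x₀, hx₀⟩ := eventually_atTop.1 (hs.atTop.eventually (lt_mem_nhds ha))
  set c := √(2 * c₁) with hc
  have hcpos : 0 < c := Real.sqrt_pos.2 (by positivity)
  refine ⟨2 * a * Real.exp (c * x₀), by positivity, c, hcpos, fun x => ?_⟩
  rw [mul_assoc, ← Real.exp_add]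
  have hx2 : a - s x ≤ 2 * a := by linarith [hs.lt_left hU x]
  rcases le_total x x₀ with h | h
  · have : 1 ≤ Real.exp (c * x₀ + -(c * x)) := by
      apply Real.one_le_exp
      nlinarith
    nlinarith
  have hanti : AntitoneOn (fun y => (a - s y) * Real.exp (c * y)) (Ici x₀) := by
    have hd : ∀ y, HasDerivAt (fun y => (a - s y) * Real.exp (c * y))
        ((-deriv s y + c * (a - s y)) * Real.exp (c * y)) y := by
      intro y
      have h1 := ((hs.hasDerivAt y).const_sub a).mul (((hasDerivAt_id y).const_mul c).exp)
      refine h1.congr_deriv ?_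
      simp only [id]
      ring
    refine antitoneOn_of_deriv_nonpos (convex_Ici _)
      (fun y _ => (hd y).continuousAt.continuousWithinAt)
      (fun y _ => (hd y).differentiableAt.differentiableWithinAt) (fun y hy => ?_)
    rw [(hd y).deriv]
    refine mul_nonpos_of_nonpos_of_nonneg ?_ (Real.exp_pos _).le
    have hy' : x₀ ≤ y := interior_subset hy
    have h1 := H (s y) ⟨by linarith [hx₀ y hy'], by linarith [hs.lt_right hU y]⟩
    have h2 := hs.deriv_sq hU y
    have h3 : (c * (a - s y)) ^ 2 ≤ deriv s y ^ 2 := by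
      rw [mul_pow, hc, Real.sq_sqrt (by positivity), h2]
      nlinarith
    have := abs_le_of_sq_le_sq h3 (hs.deriv_pos hU y).le
    linarith [le_abs_self (c * (a - s y))]
  have h1 := hanti (mem_Ici.2 le_rfl) (mem_Ici.2 h) h
  simp only at h1
  calc a - s x = (a - s x) * Real.exp (c * x) * Real.exp (-(c * x)) := by
        rw [mul_assoc, ← Real.exp_add]; simp
    _ ≤ (a - s x₀) * Real.exp (c * x₀) * Real.exp (-(c * x)) := by gcongr
    _ ≤ 2 * a * Real.exp (c * x₀) * Real.exp (-(c * x)) := by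
        gcongr; linarith [hs.lt_left hU x₀]
    _ = _ := by rw [mul_assoc, ← Real.exp_add]

/-- Exponential convergence of the kink to the wells, and exponential decay of its derivative. -/
lemma IsKink.exists_decay (hU : ConditionU1 U a m) (hs : IsKink U a s) :
    ∃ C > 0, ∃ c > 0, 2 * a ≤ C ∧ (∀ x, |s x - a| ≤ C * Real.exp (-(c * x))) ∧
      (∀ x, |s x + a| ≤ C * Real.exp (c * x)) ∧
      ∀ x, |deriv s x| ≤ C * Real.exp (-(c * |x|)) := by
  obtain ⟨C₁, hC₁, c₁, hc₁, h₁⟩ := hs.exists_decay_right hU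
  obtain ⟨C₂, hC₂, c₂, hc₂, h₂⟩ := hs.reflect.exists_decay_right hU.reflect
  obtain ⟨K, hK, hKU⟩ := hU.exists_upper a
  have ha := hU.a_pos
  set c := min c₁ c₂
  have hc : 0 < c := lt_min hc₁ hc₂
  -- The entry `2a` serves the half-line on which the exponential is at least one.
  set D := max (max C₁ C₂) (2 * a)
  have hD : 0 < D := by positivity
  have hD1 : C₁ ≤ D := (le_max_left _ _).trans (le_max_left _ _)
  have hD2 : C₂ ≤ D := (le_max_right _ _).trans (le_max_left _ _)
  have hD3 : 2 * a ≤ D := le_max_right _ _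
  have e1 : ∀ x, |s x - a| ≤ D * Real.exp (-(c * x)) := by
    intro x
    rw [abs_sub_comm, abs_of_pos (by linarith [hs.lt_right hU x])]
    rcases le_total 0 x with h | h
    · refine (h₁ x).trans ?_
      have : c * x ≤ c₁ * x := by gcongr; exact min_le_left _ _
      gcongr
    · have h1 : 1 ≤ Real.exp (-(c * x)) := Real.one_le_exp (by nlinarith)
      nlinarith [hs.lt_left hU x]
  have e2 : ∀ x, |s x + a| ≤ D * Real.exp (c * x) := by
    intro x
    rw [abs_of_pos (by linarith [hs.lt_left hU x])]
    rcases le_total x 0 with h | h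
    · have h3 := h₂ (-x)
      simp only [neg_neg] at h3
      have h4 : s x + a ≤ C₂ * Real.exp (c₂ * x) := by
        have e : -(c₂ * -x) = c₂ * x := by ring
        rw [e] at h3
        linarith
      refine h4.trans ?_
      have : c₂ * x ≤ c * x := mul_le_mul_of_nonpos_right (min_le_right _ _) h
      gcongr
    · have h1 : 1 ≤ Real.exp (c * x) := Real.one_le_exp (by positivity)
      nlinarith [hs.lt_right hU x]
  have e3 : ∀ x, |deriv s x| ≤ √(2 * K) * D * Real.exp (-(c * |x|)) := by
    intro x
    have hR : |s x| ≤ a := abs_le.2 ⟨(hs.lt_left hU x).le, (hs.lt_right hU x).le⟩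
    have key : ∀ z, U (s x) ≤ K * z ^ 2 → |z| ≤ D * Real.exp (-(c * |x|)) →
        |deriv s x| ≤ √(2 * K) * D * Real.exp (-(c * |x|)) := by
      intro z h1 h2
      have h3 : |deriv s x| ≤ √(2 * K) * |z| := by
        rw [← Real.sqrt_sq_eq_abs, ← Real.sqrt_sq_eq_abs, ← Real.sqrt_mul (by positivity)]
        refine Real.sqrt_le_sqrt ?_
        rw [hs.deriv_sq hU]
        linarith
      refine h3.trans ?_
      rw [mul_assoc]
      gcongr
    rcases le_total 0 x with h | h
    · exact key _ (hKU _ hR).1 (by rw [abs_of_nonneg h]; exact e1 x)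
    · refine key _ (hKU _ hR).2 ?_
      rw [abs_of_nonpos h]
      have e : -(c * -x) = c * x := by ring
      rw [e]
      exact e2 x
  have hpos : 0 ≤ √(2 * K) * D := by positivity
  refine ⟨D + √(2 * K) * D, by positivity, c, hc, by linarith, fun x => (e1 x).trans ?_,
    fun x => (e2 x).trans ?_, fun x => (e3 x).trans ?_⟩
  · gcongr; linarith
  · gcongr; linarith
  · gcongr; linarith

end Kink

/-! ### Mollification and its mapping properties -/

section Mollification

/-- A smooth probability density supported in `[-δ, δ]`. -/
structure IsMollifier (δ : ℝ) (ρ : ℝ → ℝ) : Prop where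
  smooth : ContDiff ℝ ∞ ρ
  compact : HasCompactSupport ρ
  nonneg : ∀ x, 0 ≤ ρ x
  integral : ∫ x, ρ x = 1
  eq_zero : ∀ x, δ < |x| → ρ x = 0

/-- The convolution of `f` with `η`. -/
def mollify (η f : ℝ → ℝ) (x : ℝ) : ℝ := ∫ y, f y * η (x - y)

/-- A bump function at the scale `1 / (n + 1)`. -/
def bump (n : ℕ) : ContDiffBump (0 : ℝ) where
  rIn := 1 / (n + 1) / 2
  rOut := 1 / (n + 1)
  rIn_pos := by positivity
  rIn_lt_rOut := half_lt_self (by positivity)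

/-- A sequence of mollifiers. -/
def kernel (n : ℕ) : ℝ → ℝ := (bump n).normed volume

lemma isMollifier_kernel (n : ℕ) : IsMollifier (1 / (n + 1)) (kernel n) where
  smooth := (bump n).contDiff_normed
  compact := (bump n).hasCompactSupport_normed
  nonneg := (bump n).nonneg_normed
  integral := (bump n).integral_normed
  eq_zero := fun x hx => by
    have h : x ∉ Function.support ((bump n).normed volume) := by
      rw [(bump n).support_normed_eq, Metric.mem_ball, dist_zero_right, Real.norm_eq_abs]
      exact not_lt.2 hx.le
    exact Function.notMem_support.1 h

variable {η f g : ℝ → ℝ} {δ : ℝ} {ρ : ℝ → ℝ}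

lemma mollify_eq_convolution (η f : ℝ → ℝ) :
    mollify η f = convolution f η (ContinuousLinearMap.mul ℝ ℝ) volume := by
  ext x
  simp [mollify, convolution]

lemma mollify_eq_swap (η f : ℝ → ℝ) (x : ℝ) : mollify η f x = ∫ y, f (x - y) * η y := by
  unfold mollify
  rw [← integral_sub_left_eq_self (fun y => f y * η (x - y)) volume x]
  simp

lemma ae_tendsto_mollify (hf : LocallyIntegrable f volume) :
    ∀ᵐ x, Tendsto (fun n => mollify (kernel n) f x) atTop (𝓝 (f x)) := by
  -- Lebesgue differentiation; `K = 2` is the ratio of the outer to the inner radius of `bump`.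
  have h := ContDiffBump.ae_convolution_tendsto_right_of_locallyIntegrable (φ := bump)
    (l := atTop) (K := 2) (μ := volume) tendsto_one_div_add_atTop_nhds_zero_nat
    (Eventually.of_forall fun n => by simp only [bump]; linarith) hf
  filter_upwards [h] with x hx
  refine hx.congr fun n => ?_
  rw [mollify_eq_swap]
  simp only [convolution, kernel, ContinuousLinearMap.lsmul_apply, smul_eq_mul, mul_comm]

lemma integrable_mul_test (hf : LocallyIntegrable f volume) (hη : Continuous η)
    (hc : HasCompactSupport η) : Integrable (fun x => f x * η x) := by
  have := hf.integrable_smul_left_of_hasCompactSupport hη hc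
  simpa [mul_comm] using this

lemma hasCompactSupport_comp_sub (hc : HasCompactSupport η) (x : ℝ) :
    HasCompactSupport (fun y => η (x - y)) :=
  hc.comp_homeomorph (Homeomorph.subLeft x)

lemma integrable_mul_comp_sub (hf : LocallyIntegrable f volume) (hη : Continuous η)
    (hc : HasCompactSupport η) (x : ℝ) : Integrable (fun y => f y * η (x - y)) :=
  integrable_mul_test hf (by fun_prop) (hasCompactSupport_comp_sub hc x)

lemma hasDerivAt_mollify (hf : LocallyIntegrable f volume) (hη : ContDiff ℝ ∞ η)
    (hc : HasCompactSupport η) (x : ℝ) :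
    HasDerivAt (mollify η f) (mollify (deriv η) f x) x := by
  rw [mollify_eq_convolution, mollify_eq_convolution]
  exact hc.hasDerivAt_convolution_right _ hf (hη.of_le (by simp)) x

lemma continuous_mollify (hf : LocallyIntegrable f volume) (hη : ContDiff ℝ ∞ η)
    (hc : HasCompactSupport η) : Continuous (mollify η f) :=
  continuous_iff_continuousAt.2 fun x => (hasDerivAt_mollify hf hη hc x).continuousAt

lemma contDiff_deriv (hη : ContDiff ℝ ∞ η) : ContDiff ℝ ∞ (deriv η) :=
  (contDiff_infty_iff_deriv.1 hη).2

lemma deriv_comp_sub_left (η : ℝ → ℝ) (x : ℝ) :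
    deriv (fun y => η (x - y)) = fun y => -deriv η (x - y) := by
  ext y
  exact deriv_comp_const_sub η x y

/-- The definition of the weak derivative, tested with `y ↦ η (x - y)`. -/
lemma HasWeakDeriv.mollify_deriv (h : HasWeakDeriv f g) (hη : ContDiff ℝ ∞ η)
    (hc : HasCompactSupport η) (x : ℝ) : mollify (deriv η) f x = mollify η g x := by
  have := h.2.2 (fun y => η (x - y)) (hη.comp (contDiff_const.sub contDiff_id))
    (hasCompactSupport_comp_sub hc x)
  rw [deriv_comp_sub_left] at this
  simp only [mul_neg, integral_neg, neg_inj] at this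
  exact this

lemma abs_mollify_le {A B M : ℝ} (hf : LocallyIntegrable f volume) (hη : ∀ x, |η x| ≤ M)
    (hηs : ∀ x, 1 < |x| → η x = 0) {x : ℝ} (hx : x ∈ Icc A B) :
    |mollify η f x| ≤ M * ∫ y in Icc (A - 1) (B + 1), |f y| := by
  have hi : IntegrableOn (fun y => |f y|) (Icc (A - 1) (B + 1)) volume :=
    (hf.integrableOn_isCompact isCompact_Icc).abs
  have h1 : mollify η f x = ∫ y in Icc (A - 1) (B + 1), f y * η (x - y) := by
    refine (setIntegral_eq_integral_of_forall_compl_eq_zero fun y hy => ?_).symm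
    rw [hηs _ (not_le.1 fun h => hy ?_), mul_zero]
    have := abs_le.1 h
    exact ⟨by linarith [hx.1], by linarith [hx.2]⟩
  rw [h1, ← Real.norm_eq_abs, ← integral_const_mul]
  refine norm_integral_le_of_norm_le (hi.const_mul M) (Eventually.of_forall fun y => ?_)
  rw [norm_mul, mul_comm, Real.norm_eq_abs, Real.norm_eq_abs]
  exact mul_le_mul_of_nonneg_right (hη _) (abs_nonneg _)

lemma IsMollifier.integral_sub (h : IsMollifier δ ρ) (x : ℝ) : ∫ y, ρ (x - y) = 1 := by
  rw [integral_sub_left_eq_self, h.integral]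

lemma IsMollifier.integrable (h : IsMollifier δ ρ) : Integrable ρ :=
  h.smooth.continuous.integrable_of_hasCompactSupport h.compact

lemma IsMollifier.integrable_sub (h : IsMollifier δ ρ) (x : ℝ) :
    Integrable (fun y => ρ (x - y)) := h.integrable.comp_sub_left x

/-- If `|f y - c| ≤ M` for almost every `y` within `δ` of `x`, then `|ρ * f (x) - c| ≤ M`. -/
lemma IsMollifier.abs_mollify_sub_le (h : IsMollifier δ ρ) (hf : LocallyIntegrable f volume)
    {x c M : ℝ} (hM : ∀ᵐ y, |x - y| ≤ δ → |f y - c| ≤ M) : |mollify ρ f x - c| ≤ M := by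
  have h1 : mollify ρ f x - c = ∫ y, (f y - c) * ρ (x - y) := by
    simp_rw [sub_mul]
    rw [MeasureTheory.integral_sub (integrable_mul_comp_sub hf h.smooth.continuous h.compact x)
      ((h.integrable_sub x).const_mul c), integral_const_mul, h.integral_sub, mul_one]
    rfl
  have h2 : M = ∫ y, M * ρ (x - y) := by rw [integral_const_mul, h.integral_sub, mul_one]
  rw [h1, h2, ← Real.norm_eq_abs]
  refine norm_integral_le_of_norm_le ((h.integrable_sub x).const_mul M) ?_
  filter_upwards [hM] with y hy
  rw [norm_mul, Real.norm_eq_abs, Real.norm_eq_abs, abs_of_nonneg (h.nonneg _)]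
  rcases le_or_gt |x - y| δ with hd | hd
  · exact mul_le_mul_of_nonneg_right (hy hd) (h.nonneg _)
  · simp [h.eq_zero _ hd]

lemma IsMollifier.lintegral_sub (h : IsMollifier δ ρ) (x : ℝ) :
    ∫⁻ y, ENNReal.ofReal (ρ (x - y)) = 1 := by
  rw [← ofReal_integral_eq_lintegral_ofReal (h.integrable_sub x)
    (Eventually.of_forall fun y => h.nonneg _), h.integral_sub, ENNReal.ofReal_one]

lemma IsMollifier.lintegral_sub' (h : IsMollifier δ ρ) (y : ℝ) :
    ∫⁻ x, ENNReal.ofReal (ρ (x - y)) = 1 := by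
  rw [lintegral_sub_right_eq_self (fun x => ENNReal.ofReal (ρ x)) y]
  rw [← ofReal_integral_eq_lintegral_ofReal h.integrable
    (Eventually.of_forall fun y => h.nonneg _), h.integral, ENNReal.ofReal_one]

/-- Jensen's inequality for the probability density `ρ`, obtained from Cauchy–Schwarz by splitting
`ρ = √ρ √ρ`. -/
lemma IsMollifier.sq_mollify_le (h : IsMollifier δ ρ) (hf : AEStronglyMeasurable f volume)
    (x : ℝ) : ENNReal.ofReal (mollify ρ f x ^ 2) ≤
      ∫⁻ y, ENNReal.ofReal (f y ^ 2) * ENNReal.ofReal (ρ (x - y)) := by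
  have hρ : Measurable fun y => ENNReal.ofReal (ρ (x - y)) := by
    have := h.smooth.continuous
    fun_prop
  have h1 : ‖mollify ρ f x‖ₑ ≤ ∫⁻ y, ‖f y‖ₑ * ENNReal.ofReal (ρ (x - y)) := by
    refine (enorm_integral_le_lintegral_enorm _).trans (le_of_eq ?_)
    refine lintegral_congr fun y => ?_
    rw [enorm_mul, Real.enorm_of_nonneg (h.nonneg _)]
  have h2 : ∫⁻ y, ‖f y‖ₑ * ENNReal.ofReal (ρ (x - y)) ≤
      (∫⁻ y, ENNReal.ofReal (f y ^ 2) * ENNReal.ofReal (ρ (x - y))) ^ (1 / 2 : ℝ) := by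
    have hold := ENNReal.lintegral_mul_le_Lp_mul_Lq volume Real.HolderConjugate.two_two
      (f := fun y => ‖f y‖ₑ * ENNReal.ofReal (ρ (x - y)) ^ (1 / 2 : ℝ))
      (g := fun y => ENNReal.ofReal (ρ (x - y)) ^ (1 / 2 : ℝ))
      (hf.enorm.mul (hρ.pow_const _).aemeasurable) (hρ.pow_const _).aemeasurable
    have hhalf : ∀ z : ℝ≥0∞, (z ^ (1 / 2 : ℝ)) ^ (2 : ℝ) = z := fun z => by
      rw [← ENNReal.rpow_mul]; norm_num
    have e1 : ∀ y, ((fun y => ‖f y‖ₑ * ENNReal.ofReal (ρ (x - y)) ^ (1 / 2 : ℝ)) *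
        (fun y => ENNReal.ofReal (ρ (x - y)) ^ (1 / 2 : ℝ))) y =
        ‖f y‖ₑ * ENNReal.ofReal (ρ (x - y)) := fun y => by
      simp only [Pi.mul_apply]
      rw [mul_assoc, ← ENNReal.rpow_add_of_nonneg _ _ (by norm_num) (by norm_num)]
      norm_num
    have e2 : ∀ y, (‖f y‖ₑ * ENNReal.ofReal (ρ (x - y)) ^ (1 / 2 : ℝ)) ^ (2 : ℝ) =
        ENNReal.ofReal (f y ^ 2) * ENNReal.ofReal (ρ (x - y)) := fun y => by
      rw [ENNReal.mul_rpow_of_nonneg _ _ (by norm_num), hhalf]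
      congr 1
      rw [← ofReal_norm, ENNReal.ofReal_rpow_of_nonneg (norm_nonneg _) (by norm_num)]
      norm_num
    simp_rw [e1, e2, hhalf, h.lintegral_sub, ENNReal.one_rpow, mul_one] at hold
    exact hold
  have h3 : ENNReal.ofReal (mollify ρ f x ^ 2) = ‖mollify ρ f x‖ₑ ^ (2 : ℝ) := by
    rw [← ofReal_norm, ENNReal.ofReal_rpow_of_nonneg (norm_nonneg _) (by norm_num)]
    norm_num
  rw [h3]
  refine (ENNReal.rpow_le_rpow (h1.trans h2) (by norm_num)).trans (le_of_eq ?_)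
  rw [← ENNReal.rpow_mul]; norm_num

/-- Mollification is bounded in weighted `L²` spaces. -/
lemma IsMollifier.lintegral_sq_mollify_le (h : IsMollifier δ ρ)
    (hf : AEStronglyMeasurable f volume) {W W' : ℝ → ℝ≥0∞} (hW : Measurable W)
    (hWW : ∀ x y, |x - y| ≤ δ → W x ≤ W' y) :
    ∫⁻ x, W x * ENNReal.ofReal (mollify ρ f x ^ 2) ≤
      ∫⁻ y, W' y * ENNReal.ofReal (f y ^ 2) := by
  have hρ := h.smooth.continuous
  have hf2 : AEMeasurable (fun y => ENNReal.ofReal (f y ^ 2)) volume :=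
    (hf.aemeasurable.pow_const 2).ennreal_ofReal
  calc _ ≤ ∫⁻ x, ∫⁻ y, W x * (ENNReal.ofReal (f y ^ 2) * ENNReal.ofReal (ρ (x - y))) := by
        refine lintegral_mono fun x => ?_
        refine (mul_le_mul_right (h.sq_mollify_le hf x) _).trans (lintegral_const_mul_le _ _)
    _ = ∫⁻ y, ∫⁻ x, W x * (ENNReal.ofReal (f y ^ 2) * ENNReal.ofReal (ρ (x - y))) := by
        refine lintegral_lintegral_swap ?_
        refine AEMeasurable.mul (hW.comp measurable_fst).aemeasurable ?_
        refine AEMeasurable.mul hf2.comp_snd ?_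
        exact Measurable.aemeasurable (by fun_prop)
    _ ≤ ∫⁻ y, ∫⁻ x, (W' y * ENNReal.ofReal (f y ^ 2)) * ENNReal.ofReal (ρ (x - y)) := by
        refine lintegral_mono fun y => lintegral_mono fun x => ?_
        rw [← mul_assoc]
        rcases le_or_gt |x - y| δ with hd | hd
        · have := hWW x y hd
          gcongr
        · simp [h.eq_zero _ hd]
    _ = _ := by
        refine lintegral_congr fun y => ?_
        rw [lintegral_const_mul _ (by fun_prop), h.lintegral_sub', mul_one]

end Mollification

/-! ### Weak derivatives and primitives -/

section WeakDerivative

variable {f f' g g' : ℝ → ℝ}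

lemma HasWeakDeriv.add (h : HasWeakDeriv f g) (h' : HasWeakDeriv f' g') :
    HasWeakDeriv (fun x => f x + f' x) (fun x => g x + g' x) := by
  refine ⟨h.1.add h'.1, h.2.1.add h'.2.1, fun φ hφ hc => ?_⟩
  have hd := (contDiff_deriv hφ).continuous
  simp_rw [add_mul]
  rw [integral_add (integrable_mul_test h.1 hd hc.deriv)
    (integrable_mul_test h'.1 hd hc.deriv),
    integral_add (integrable_mul_test h.2.1 hφ.continuous hc)
    (integrable_mul_test h'.2.1 hφ.continuous hc), h.2.2 φ hφ hc, h'.2.2 φ hφ hc]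
  ring

lemma HasWeakDeriv.neg (h : HasWeakDeriv f g) :
    HasWeakDeriv (fun x => -f x) (fun x => -g x) := by
  refine ⟨h.1.neg, h.2.1.neg, fun φ hφ hc => ?_⟩
  simp_rw [neg_mul, integral_neg, h.2.2 φ hφ hc]

lemma locallyIntegrable_comp_add (h : LocallyIntegrable f volume) (b : ℝ) :
    LocallyIntegrable (fun x => f (x + b)) volume := by
  have hm : MeasurePreserving (fun x : ℝ => x + b) volume volume := measurePreserving_add_right _ b
  have h' : LocallyIntegrable f (Measure.map (Homeomorph.addRight b) volume) := by
    have : Measure.map (Homeomorph.addRight b) (volume : Measure ℝ) = volume := hm.map_eq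
    rwa [this]
  exact (locallyIntegrable_map_homeomorph (Homeomorph.addRight b)).1 h'

lemma HasWeakDeriv.comp_add (h : HasWeakDeriv f g) (b : ℝ) :
    HasWeakDeriv (fun x => f (x + b)) (fun x => g (x + b)) := by
  refine ⟨locallyIntegrable_comp_add h.1 b, locallyIntegrable_comp_add h.2.1 b,
    fun φ hφ hc => ?_⟩
  have := h.2.2 (fun x => φ (x - b)) (hφ.comp (contDiff_id.sub contDiff_const))
    (hc.comp_homeomorph (Homeomorph.subRight b))
  have hd : deriv (fun x => φ (x - b)) = fun x => deriv φ (x - b) := by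
    ext x; exact deriv_comp_sub_const φ b x
  rw [hd] at this
  rw [← integral_add_right_eq_self (fun x => f x * deriv φ (x - b)) b,
    ← integral_add_right_eq_self (fun x => g x * φ (x - b)) b] at this
  simpa using this

/-- The primitive is only absolutely continuous, so the integration by parts is the one for such
functions, on an interval outside which `φ` vanishes. -/
lemma hasWeakDeriv_primitive (hg : LocallyIntegrable g volume) :
    HasWeakDeriv (fun x => ∫ y in (0 : ℝ)..x, g y) g := by
  have hi : ∀ a b, IntervalIntegrable g volume a b := fun a b =>
    (hg.integrableOn_isCompact isCompact_uIcc).intervalIntegrable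
  have hcont : Continuous (fun x => ∫ y in (0 : ℝ)..x, g y) :=
    intervalIntegral.continuous_primitive hi 0
  refine ⟨hcont.locallyIntegrable, hg, fun φ hφ hc => ?_⟩
  obtain ⟨R, hR⟩ := hc.isCompact.isBounded.subset_closedBall (0 : ℝ)
  obtain ⟨r, hr, hRr⟩ : ∃ r > 0, R < r := ⟨max R 0 + 1, by positivity, by
    linarith [le_max_left R 0]⟩
  have hz : ∀ x, r ≤ |x| → φ x = 0 := fun x hx => image_eq_zero_of_notMem_tsupport fun h => by
    have := hR h
    simp at this
    linarith
  have hz' : ∀ x, r ≤ |x| → deriv φ x = 0 := fun x hx =>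
    image_eq_zero_of_notMem_tsupport fun h => by
      have := hR (tsupport_deriv_subset h)
      simp at this
      linarith
  have hmem : ∀ x, x ∉ Ioc (-r) r → r ≤ |x| := fun x hx => by
    by_contra h
    push Not at h
    exact hx ⟨(abs_lt.1 h).1, (abs_lt.1 h).2.le⟩
  have e1 : ∫ x, (∫ y in (0 : ℝ)..x, g y) * deriv φ x =
      ∫ x in (-r)..r, (∫ y in (0 : ℝ)..x, g y) * deriv φ x := by
    rw [intervalIntegral.integral_of_le (by linarith)]
    refine (setIntegral_eq_integral_of_forall_compl_eq_zero fun x hx => ?_).symm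
    rw [hz' x (hmem x hx), mul_zero]
  have e2 : ∫ x, g x * φ x = ∫ x in (-r)..r, g x * φ x := by
    rw [intervalIntegral.integral_of_le (by linarith)]
    refine (setIntegral_eq_integral_of_forall_compl_eq_zero fun x hx => ?_).symm
    rw [hz x (hmem x hx), mul_zero]
  have hG : AbsolutelyContinuousOnInterval (fun x => ∫ y in (0 : ℝ)..x, g y) (-r) r :=
    (hi (-r) r).absolutelyContinuousOnInterval_intervalIntegral
      (by rw [uIcc_of_le (by linarith)]; exact ⟨by linarith, by linarith⟩)
  have hφ' : AbsolutelyContinuousOnInterval φ (-r) r :=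
    (hφ.of_le (by simp)).contDiffOn.absolutelyContinuousOnInterval
  rw [e1, e2, hG.integral_mul_deriv_eq_deriv_mul hφ', hz r (le_abs_self r),
    hz (-r) (by rw [abs_neg]; exact le_abs_self r)]
  simp only [mul_zero, sub_zero, zero_sub, neg_inj]
  refine intervalIntegral.integral_congr_ae ?_
  filter_upwards [(hi (-r) r).ae_hasDerivAt_integral] with x hx hx'
  rw [(hx (uIoc_subset_uIcc hx') 0
    (by rw [uIcc_of_le (by linarith)]; exact ⟨by linarith, by linarith⟩)).deriv]

/-- A function with a weak derivative agrees almost everywhere with a primitive of it. -/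
lemma HasWeakDeriv.exists_ae_eq_primitive (h : HasWeakDeriv f g) :
    ∃ c, f =ᵐ[volume] fun x => c + ∫ y in (0 : ℝ)..x, g y := by
  have hG := hasWeakDeriv_primitive h.2.1
  have hw : HasWeakDeriv (fun x => f x + -∫ y in (0 : ℝ)..x, g y) (fun x => g x + -g x) :=
    h.add hG.neg
  set w := fun x => f x + -∫ y in (0 : ℝ)..x, g y
  -- The difference `w` has weak derivative zero, so its mollifications are constant, and so is
  -- their almost everywhere limit.
  have hconst : ∀ n x, mollify (kernel n) w x = mollify (kernel n) w 0 := by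
    intro n x
    have hk := isMollifier_kernel n
    have hd : ∀ x, HasDerivAt (mollify (kernel n) w) 0 x := fun x => by
      have h1 := hasDerivAt_mollify hw.1 hk.smooth hk.compact x
      rw [hw.mollify_deriv hk.smooth hk.compact] at h1
      simpa [mollify] using h1
    exact is_const_of_deriv_eq_zero (fun x => (hd x).differentiableAt) (fun x => (hd x).deriv) x 0
  have hae := ae_tendsto_mollify hw.1
  obtain ⟨x₀, hx₀⟩ := hae.exists
  refine ⟨w x₀, ?_⟩
  filter_upwards [hae] with x hx
  have : w x = w x₀ := by
    refine tendsto_nhds_unique hx (hx₀.congr fun n => ?_)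
    rw [hconst n x, hconst n x₀]
  simp only [w] at this ⊢
  linarith

end WeakDerivative

/-! ### Energy inequality for smooth forced waves with a causal weight -/

section EnergyInequality

/-- The energy density of a state with field value `q`, field derivative `r` and momentum `p`. -/
def energyDensity (U : ℝ → ℝ) (q r p : ℝ) : ℝ := p ^ 2 / 2 + r ^ 2 / 2 + U q

/-- A smooth solution of a forced wave equation `q̈ = q'' + f` on a strip. -/
structure IsRegularWave (τ α β M : ℝ) (q r p r' p' f : ℝ → ℝ → ℝ) : Prop where
  hasDerivAt_q : ∀ t x, HasDerivAt (fun t => q t x) (p t x) t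
  hasDerivAt_r : ∀ t x, HasDerivAt (fun t => r t x) (p' t x) t
  hasDerivAt_p : ∀ t x, HasDerivAt (fun t => p t x) (r' t x + f t x) t
  hasDerivAt_r' : ∀ t x, HasDerivAt (r t) (r' t x) x
  hasDerivAt_p' : ∀ t x, HasDerivAt (p t) (p' t x) x
  continuous_q : ∀ t, Continuous (q t)
  continuous_r' : ∀ t, Continuous (r' t)
  continuous_p' : ∀ t, Continuous (p' t)
  continuous_f : ∀ t ∈ Icc 0 τ, Continuous (f t)
  bound : ∀ t ∈ Icc 0 τ, ∀ x ∈ Icc α β,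
    |q t x| ≤ M ∧ |r t x| ≤ M ∧ |p t x| ≤ M ∧ |r' t x| ≤ M ∧ |p' t x| ≤ M ∧ |f t x| ≤ M

/-- A weight that decreases along every timelike direction and vanishes at the ends of the
interval. -/
structure IsCausalWeight (τ α β M : ℝ) (φ φt φx : ℝ → ℝ → ℝ) : Prop where
  hasDerivAt_t : ∀ t x, HasDerivAt (fun t => φ t x) (φt t x) t
  hasDerivAt_x : ∀ t x, HasDerivAt (φ t) (φx t x) x
  continuous_t : ∀ t, Continuous (φt t)
  continuous_x : ∀ t, Continuous (φx t)
  nonneg : ∀ t x, 0 ≤ φ t x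
  causal : ∀ t x, |φx t x| ≤ -φt t x
  bound : ∀ t ∈ Icc 0 τ, ∀ x ∈ Icc α β, |φ t x| ≤ M ∧ |φt t x| ≤ M
  left : ∀ t ∈ Icc 0 τ, φ t α = 0
  right : ∀ t ∈ Icc 0 τ, φ t β = 0

variable {U : ℝ → ℝ} {τ α β M Mφ : ℝ} {q r p r' p' f φ φt φx : ℝ → ℝ → ℝ}

lemma IsRegularWave.continuous_r (h : IsRegularWave τ α β M q r p r' p' f) (t : ℝ) :
    Continuous (r t) :=
  continuous_iff_continuousAt.2 fun x => (h.hasDerivAt_r' t x).continuousAt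

lemma IsRegularWave.continuous_p (h : IsRegularWave τ α β M q r p r' p' f) (t : ℝ) :
    Continuous (p t) :=
  continuous_iff_continuousAt.2 fun x => (h.hasDerivAt_p' t x).continuousAt

lemma IsCausalWeight.continuous (h : IsCausalWeight τ α β Mφ φ φt φx) (t : ℝ) :
    Continuous (φ t) :=
  continuous_iff_continuousAt.2 fun x => (h.hasDerivAt_x t x).continuousAt

/-- The time derivative of the weighted energy density. -/
lemma hasDerivAt_energyDensity (hU : ContDiff ℝ ∞ U) (h : IsRegularWave τ α β M q r p r' p' f)
    (hφ : IsCausalWeight τ α β Mφ φ φt φx) (t x : ℝ) :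
    HasDerivAt (fun t => φ t x * energyDensity U (q t x) (r t x) (p t x))
      (φt t x * energyDensity U (q t x) (r t x) (p t x) + φ t x * (p t x * (r' t x + f t x) +
        r t x * p' t x + deriv U (q t x) * p t x)) t := by
  have hUd : HasDerivAt U (deriv U (q t x)) (q t x) :=
    (hU.differentiable (by simp) _).hasDerivAt
  have h1 := (((h.hasDerivAt_p t x).pow 2).div_const 2).add
    (((h.hasDerivAt_r t x).pow 2).div_const 2)
  have h2 := h1.add (hUd.comp t (h.hasDerivAt_q t x))
  refine ((hφ.hasDerivAt_t t x).mul h2).congr_deriv ?_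
  simp only [energyDensity, Pi.add_apply, Pi.pow_apply, Function.comp]
  push_cast
  ring

/-- Supplies the constant dominating function for continuity and differentiation under the integral
sign. -/
lemma exists_bound_energyDensity (hU : ContDiff ℝ ∞ U)
    (h : IsRegularWave τ α β M q r p r' p' f) (hφ : IsCausalWeight τ α β Mφ φ φt φx) :
    ∃ D, ∀ t ∈ Icc 0 τ, ∀ x ∈ Icc α β,
      |φ t x * energyDensity U (q t x) (r t x) (p t x)| ≤ D ∧
      |φt t x * energyDensity U (q t x) (r t x) (p t x) + φ t x * (p t x * (r' t x + f t x) +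
        r t x * p' t x + deriv U (q t x) * p t x)| ≤ D := by
  obtain ⟨B₁, hB₁⟩ := (isCompact_Icc (a := -M) (b := M)).exists_bound_of_continuousOn
    hU.continuous.continuousOn
  obtain ⟨B₂, hB₂⟩ := (isCompact_Icc (a := -M) (b := M)).exists_bound_of_continuousOn
    (contDiff_deriv hU).continuous.continuousOn
  refine ⟨max (Mφ * (M ^ 2 / 2 + M ^ 2 / 2 + B₁)) (Mφ * (M ^ 2 / 2 + M ^ 2 / 2 + B₁) +
    Mφ * (M * (M + M) + M * M + B₂ * M)), fun t ht x hx => ?_⟩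
  obtain ⟨h1, h2, h3, h4, h5, h6⟩ := h.bound t ht x hx
  obtain ⟨h7, h8⟩ := hφ.bound t ht x hx
  have hM : 0 ≤ M := (abs_nonneg _).trans h1
  have hMφ : 0 ≤ Mφ := (abs_nonneg _).trans h7
  have h9 : |U (q t x)| ≤ B₁ := hB₁ _ (abs_le.1 h1)
  have h10 : |deriv U (q t x)| ≤ B₂ := hB₂ _ (abs_le.1 h1)
  have hB₂ : 0 ≤ B₂ := (abs_nonneg _).trans h10
  have he : |energyDensity U (q t x) (r t x) (p t x)| ≤ M ^ 2 / 2 + M ^ 2 / 2 + B₁ := by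
    unfold energyDensity
    refine (abs_add_le _ _).trans (add_le_add ((abs_add_le _ _).trans ?_) h9)
    rw [abs_div, abs_div, abs_pow, abs_pow, abs_two]
    gcongr
  constructor
  · refine le_max_of_le_left ?_
    rw [abs_mul]
    gcongr
  · refine le_max_of_le_right ((abs_add_le _ _).trans ?_)
    rw [abs_mul, abs_mul]
    gcongr
    refine (abs_add_le _ _).trans (add_le_add ((abs_add_le _ _).trans ?_) ?_)
    · rw [abs_mul, abs_mul]
      gcongr
      exact (abs_add_le _ _).trans (add_le_add h4 h6)
    · rw [abs_mul]
      gcongr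

lemma continuous_energyDensity (hU : ContDiff ℝ ∞ U) (h : IsRegularWave τ α β M q r p r' p' f)
    (t : ℝ) : Continuous fun x => energyDensity U (q t x) (r t x) (p t x) := by
  unfold energyDensity
  have := h.continuous_q t
  have := h.continuous_r t
  have := h.continuous_p t
  have := hU.continuous
  fun_prop

lemma continuous_deriv_energyDensity (hU : ContDiff ℝ ∞ U)
    (h : IsRegularWave τ α β M q r p r' p' f) (hφ : IsCausalWeight τ α β Mφ φ φt φx)
    {t : ℝ} (ht : t ∈ Icc 0 τ) :
    Continuous fun x => φt t x * energyDensity U (q t x) (r t x) (p t x) +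
      φ t x * (p t x * (r' t x + f t x) + r t x * p' t x + deriv U (q t x) * p t x) := by
  have := continuous_energyDensity hU h t
  have := h.continuous_q t
  have := h.continuous_r t
  have := h.continuous_p t
  have := h.continuous_r' t
  have := h.continuous_p' t
  have := h.continuous_f t ht
  have := hφ.continuous_t t
  have := hφ.continuous t
  have := (contDiff_deriv hU).continuous
  fun_prop

/-- The derivative of the weighted energy is bounded by the work of the residual force. -/
lemma integral_deriv_energyDensity_le {κ M₁ : ℝ} (hU : ContDiff ℝ ∞ U) (hαβ : α ≤ β)
    (h : IsRegularWave τ α β M q r p r' p' f) (hφ : IsCausalWeight τ α β Mφ φ φt φx)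
    {t : ℝ} (ht : t ∈ Icc 0 τ) (hUq : ∀ x ∈ Icc α β, 0 ≤ U (q t x))
    (hκ : ∀ x ∈ Icc α β, |f t x + deriv U (q t x)| ≤ κ)
    (hM₁ : ∫ x in α..β, |p t x| ≤ M₁) :
    ∫ x in α..β, (φt t x * energyDensity U (q t x) (r t x) (p t x) +
      φ t x * (p t x * (r' t x + f t x) + r t x * p' t x + deriv U (q t x) * p t x)) ≤
      Mφ * κ * M₁ := by
  have hflux : ∀ x, HasDerivAt (fun x => φ t x * (p t x * r t x))
      (φx t x * (p t x * r t x) + φ t x * (p' t x * r t x + p t x * r' t x)) x := fun x =>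
    (hφ.hasDerivAt_x t x).mul ((h.hasDerivAt_p' t x).mul (h.hasDerivAt_r' t x))
  have hcr := h.continuous_r t
  have hcp := h.continuous_p t
  have hcr' := h.continuous_r' t
  have hcp' := h.continuous_p' t
  have hcφ := hφ.continuous t
  have hcφx := hφ.continuous_x t
  have hfc : Continuous fun x => φx t x * (p t x * r t x) +
    φ t x * (p' t x * r t x + p t x * r' t x) := by fun_prop
  -- The term `φ (p r' + p' r)` is `(φ p r)_x - φ_x p r`; the total derivative integrates to zero
  -- because `φ` vanishes at both ends.
  have hzero : ∫ x in α..β, (φx t x * (p t x * r t x) +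
      φ t x * (p' t x * r t x + p t x * r' t x)) = 0 := by
    rw [intervalIntegral.integral_eq_sub_of_hasDerivAt (fun x _ => hflux x)
      (hfc.intervalIntegrable _ _), hφ.left t ht, hφ.right t ht]
    simp
  have hκ0 : 0 ≤ κ := (abs_nonneg _).trans (hκ α (left_mem_Icc.2 hαβ))
  have hM0 : 0 ≤ Mφ := (abs_nonneg _).trans (hφ.bound t ht α (left_mem_Icc.2 hαβ)).1
  calc _ ≤ ∫ x in α..β, ((φx t x * (p t x * r t x) +
      φ t x * (p' t x * r t x + p t x * r' t x)) + Mφ * κ * |p t x|) := by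
        refine intervalIntegral.integral_mono_on hαβ
          ((continuous_deriv_energyDensity hU h hφ ht).intervalIntegrable _ _)
          (Continuous.intervalIntegrable (by fun_prop) _ _) fun x hx => ?_
        have h1 : φ t x * (p t x * (f t x + deriv U (q t x))) ≤ Mφ * κ * |p t x| := by
          refine (le_abs_self _).trans ?_
          rw [abs_mul, abs_mul]
          calc _ ≤ Mφ * (|p t x| * κ) := by
                gcongr
                · exact (hφ.bound t ht x hx).1
                · exact hκ x hx
            _ = _ := by ring
        have h2 := hφ.causal t x
        have h3 := hUq x hx
        have h4 : |p t x * r t x| ≤ p t x ^ 2 / 2 + r t x ^ 2 / 2 := by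
          rw [abs_le]; constructor <;> nlinarith [sq_nonneg (p t x + r t x),
            sq_nonneg (p t x - r t x)]
        -- Causality enters here: the flux term is absorbed by the kinetic and gradient parts of
        -- `-φ_t e`. The sign of `U` disposes of the rest of `φ_t e`.
        have h5 : -(φx t x * (p t x * r t x)) ≤
            -φt t x * (p t x ^ 2 / 2 + r t x ^ 2 / 2) := by
          refine (neg_le_abs _).trans ?_
          rw [abs_mul]
          exact mul_le_mul h2 h4 (abs_nonneg _) ((abs_nonneg _).trans h2)
        have h6 : φt t x * U (q t x) ≤ 0 :=
          mul_nonpos_of_nonpos_of_nonneg (by linarith [abs_nonneg (φx t x)]) h3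
        unfold energyDensity
        linarith
    _ = Mφ * κ * ∫ x in α..β, |p t x| := by
        rw [intervalIntegral.integral_add (hfc.intervalIntegrable _ _)
          (Continuous.intervalIntegrable (by fun_prop) _ _), hzero,
          intervalIntegral.integral_const_mul, zero_add]
    _ ≤ _ := by gcongr

/-- The energy inequality with a causal weight. -/
theorem weighted_energy_le {κ M₁ : ℝ} (hU : ContDiff ℝ ∞ U) (hαβ : α ≤ β) (hτ : 0 ≤ τ)
    (h : IsRegularWave τ α β M q r p r' p' f) (hφ : IsCausalWeight τ α β Mφ φ φt φx)
    (hUq : ∀ t ∈ Icc 0 τ, ∀ x ∈ Icc α β, 0 ≤ U (q t x))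
    (hκ : ∀ t ∈ Icc 0 τ, ∀ x ∈ Icc α β, |f t x + deriv U (q t x)| ≤ κ)
    (hM₁ : ∀ t ∈ Icc 0 τ, ∫ x in α..β, |p t x| ≤ M₁) :
    ∫ x in α..β, φ τ x * energyDensity U (q τ x) (r τ x) (p τ x) ≤
      (∫ x in α..β, φ 0 x * energyDensity U (q 0 x) (r 0 x) (p 0 x)) + τ * (Mφ * κ * M₁) := by
  obtain ⟨D, hD⟩ := exists_bound_energyDensity hU h hφ
  have hsub : uIoc α β ⊆ Icc α β := by
    rw [uIoc_of_le hαβ]; exact Ioc_subset_Icc_self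
  have hcont : ∀ t, Continuous fun x => φ t x * energyDensity U (q t x) (r t x) (p t x) :=
    fun t => (hφ.continuous t).mul (continuous_energyDensity hU h t)
  have hderiv : ∀ t ∈ Ioo 0 τ, HasDerivAt
      (fun t => ∫ x in α..β, φ t x * energyDensity U (q t x) (r t x) (p t x))
      (∫ x in α..β, (φt t x * energyDensity U (q t x) (r t x) (p t x) +
      φ t x * (p t x * (r' t x + f t x) + r t x * p' t x + deriv U (q t x) * p t x))) t := by
    intro t ht
    refine (intervalIntegral.hasDerivAt_integral_of_dominated_loc_of_deriv_le
      (bound := fun _ => D) (Ioo_mem_nhds ht.1 ht.2)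
      (Eventually.of_forall fun t => (hcont t).aestronglyMeasurable)
      ((hcont t).intervalIntegrable _ _)
      (continuous_deriv_energyDensity hU h hφ
        (Ioo_subset_Icc_self ht)).aestronglyMeasurable
      (Eventually.of_forall fun x hx t' ht' => ?_) intervalIntegrable_const
      (Eventually.of_forall fun x hx t' ht' => hasDerivAt_energyDensity hU h hφ t' x)).2
    exact (hD t' (Ioo_subset_Icc_self ht') x (hsub hx)).2
  have hanti : AntitoneOn (fun t => (∫ x in α..β, φ t x *
      energyDensity U (q t x) (r t x) (p t x)) - t * (Mφ * κ * M₁)) (Icc 0 τ) := by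
    refine antitoneOn_of_deriv_nonpos (convex_Icc _ _) ?_ ?_ ?_
    · refine ContinuousOn.sub (fun t ht => ?_) (by fun_prop)
      refine intervalIntegral.continuousWithinAt_of_dominated_interval (bound := fun _ => D)
        (Eventually.of_forall fun t => (hcont t).aestronglyMeasurable) ?_
        intervalIntegrable_const (Eventually.of_forall fun x hx =>
          (hasDerivAt_energyDensity hU h hφ t x).continuousAt.continuousWithinAt)
      filter_upwards [self_mem_nhdsWithin] with t' ht'
      exact Eventually.of_forall fun x hx => (hD t' ht' x (hsub hx)).1
    · intro t ht
      rw [interior_Icc] at ht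
      exact ((hderiv t ht).sub
        ((hasDerivAt_id t).mul_const _)).differentiableAt.differentiableWithinAt
    · intro t ht
      rw [interior_Icc] at ht
      have ht' := Ioo_subset_Icc_self ht
      have h1 := ((hderiv t ht).sub ((hasDerivAt_id t).mul_const (Mφ * κ * M₁))).deriv
      have h2 := integral_deriv_energyDensity_le hU hαβ h hφ ht' (hUq t ht') (hκ t ht')
        (hM₁ t ht')
      refine (le_of_eq h1).trans ?_
      linarith
  have := hanti (left_mem_Icc.2 hτ) (right_mem_Icc.2 hτ) hτ
  simp only [zero_mul, sub_zero] at this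
  linarith

end EnergyInequality

/-! ### The light cone weight -/

section Weight

/-- A smooth substitute for the distance to `b₀`. -/
def radius (b₀ x : ℝ) : ℝ := √(1 + (x - b₀) ^ 2)

/-- A smooth increasing function that grows like `z ^ σ` at infinity. -/
def growth (σ z : ℝ) : ℝ := 1 + Real.exp (σ * Real.arsinh z)

/-- A decreasing function that vanishes on `[N, ∞)`. -/
def cutoff (N z : ℝ) : ℝ := max (1 - z / N) 0 ^ 2

lemma one_le_radius (b₀ x : ℝ) : 1 ≤ radius b₀ x :=
  Real.one_le_sqrt.2 (by linarith [sq_nonneg (x - b₀)])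

lemma abs_sub_le_radius (b₀ x : ℝ) : |x - b₀| ≤ radius b₀ x := by
  rw [← Real.sqrt_sq_eq_abs]
  exact Real.sqrt_le_sqrt (by linarith)

lemma radius_le (b₀ x : ℝ) : radius b₀ x ≤ 1 + |x - b₀| := by
  refine Real.sqrt_le_iff.2 ⟨by positivity, ?_⟩
  nlinarith [sq_abs (x - b₀), abs_nonneg (x - b₀)]

lemma hasDerivAt_radius (b₀ x : ℝ) :
    HasDerivAt (radius b₀) ((x - b₀) / radius b₀ x) x := by
  have h := ((((hasDerivAt_id x).sub_const b₀).pow 2).const_add 1).sqrt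
    (by simp only [Pi.pow_apply, id]; positivity)
  refine h.congr_deriv ?_
  simp only [radius, id, Pi.pow_apply]
  push_cast
  rw [mul_one, pow_one, mul_div_mul_left _ _ two_ne_zero]

lemma continuous_radius (b₀ : ℝ) : Continuous (radius b₀) :=
  continuous_iff_continuousAt.2 fun x => (hasDerivAt_radius b₀ x).continuousAt

lemma abs_deriv_radius_le (b₀ x : ℝ) : |(x - b₀) / radius b₀ x| ≤ 1 := by
  have h := one_le_radius b₀ x
  rw [abs_div, abs_of_pos (a := radius b₀ x) (by linarith)]
  exact div_le_one_of_le₀ (abs_sub_le_radius b₀ x) (by linarith)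

lemma hasDerivAt_growth (σ z : ℝ) : HasDerivAt (growth σ)
    (σ * Real.exp (σ * Real.arsinh z) / √(1 + z ^ 2)) z := by
  have h := (((Real.hasDerivAt_arsinh z).const_mul σ).exp).const_add 1
  refine h.congr_deriv ?_
  ring

lemma one_le_growth (σ z : ℝ) : 1 ≤ growth σ z :=
  le_add_of_nonneg_right (Real.exp_pos _).le

lemma continuous_growth (σ : ℝ) : Continuous (growth σ) :=
  continuous_iff_continuousAt.2 fun x => (hasDerivAt_growth σ x).continuousAt

lemma growth_eq (σ z : ℝ) : growth σ z = 1 + (z + √(1 + z ^ 2)) ^ σ := by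
  rw [growth, mul_comm, Real.exp_mul, Real.exp_arsinh]

lemma le_growth {σ z : ℝ} (hσ : 0 ≤ σ) : 1 + max z 0 ^ σ ≤ growth σ z := by
  rw [growth_eq]
  have h1 : |z| ≤ √(1 + z ^ 2) := by
    rw [← Real.sqrt_sq_eq_abs]
    exact Real.sqrt_le_sqrt (by linarith)
  gcongr
  refine max_le (by linarith [abs_nonneg z]) (by linarith [neg_abs_le z])

/-- Needed at time `0`, to compare the cone weight with the weight in the norm of the initial
perturbation. -/
lemma growth_radius_le {σ : ℝ} (hσ : 0 ≤ σ) (b₀ x : ℝ) :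
    growth σ (radius b₀ x) ≤ (1 + 4 ^ σ) * (1 + |x - b₀|) ^ σ := by
  rw [growth_eq, add_mul, ← Real.mul_rpow (by norm_num) (by positivity)]
  have h0 := one_le_radius b₀ x
  have h1 := radius_le b₀ x
  have h2 : √(1 + radius b₀ x ^ 2) ≤ 1 + radius b₀ x :=
    Real.sqrt_le_iff.2 ⟨by linarith, by nlinarith⟩
  have h3 := abs_nonneg (x - b₀)
  gcongr
  · rw [one_mul]
    exact Real.one_le_rpow (by linarith) hσ
  · linarith

/-- The square in `cutoff` removes the corner, making the cutoff continuously differentiable. -/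
lemma hasDerivAt_max_sq (z : ℝ) : HasDerivAt (fun z : ℝ => max z 0 ^ 2) (2 * max z 0) z := by
  rcases lt_trichotomy z 0 with h | h | h
  · rw [max_eq_right h.le]
    refine ((hasDerivAt_const z (0 : ℝ)).congr_deriv (by simp)).congr_of_eventuallyEq ?_
    filter_upwards [gt_mem_nhds h] with y hy
    simp [max_eq_right (le_of_lt hy)]
  · subst h
    rw [hasDerivAt_iff_isLittleO_nhds_zero]
    simp only [zero_add, max_self, mul_zero, smul_zero, sub_zero]
    have h1 : (fun h : ℝ => max h 0 ^ 2 - 0 ^ 2) =O[𝓝 0] fun h : ℝ => h ^ 2 := by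
      refine IsBigO.of_bound 1 (Eventually.of_forall fun h => ?_)
      rw [one_mul, Real.norm_of_nonneg (sq_nonneg h), zero_pow two_ne_zero, sub_zero,
        Real.norm_of_nonneg (sq_nonneg _)]
      rcases le_total h 0 with h0 | h0
      · rw [max_eq_right h0]; nlinarith
      · rw [max_eq_left h0]
    exact h1.trans_isLittleO (isLittleO_pow_id one_lt_two)
  · rw [max_eq_left h.le]
    refine ((hasDerivAt_pow 2 z).congr_deriv (by simp)).congr_of_eventuallyEq ?_
    filter_upwards [lt_mem_nhds h] with y hy
    simp [max_eq_left (le_of_lt hy)]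

lemma hasDerivAt_cutoff (N z : ℝ) :
    HasDerivAt (cutoff N) (-(2 * max (1 - z / N) 0 / N)) z := by
  have h := (hasDerivAt_max_sq (1 - z / N)).comp z (((hasDerivAt_id z).div_const N).const_sub 1)
  refine h.congr_deriv ?_
  ring

lemma cutoff_nonneg (N z : ℝ) : 0 ≤ cutoff N z := sq_nonneg _

lemma continuous_cutoff (N : ℝ) : Continuous (cutoff N) :=
  continuous_iff_continuousAt.2 fun x => (hasDerivAt_cutoff N x).continuousAt

lemma cutoff_le_one {N z : ℝ} (hN : 0 < N) (hz : 0 ≤ z) : cutoff N z ≤ 1 := by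
  have h : 0 ≤ z / N := by positivity
  exact pow_le_one₀ (le_max_right _ _) (max_le (by linarith) zero_le_one)

lemma cutoff_eq_zero {N z : ℝ} (hN : 0 < N) (hz : N ≤ z) : cutoff N z = 0 := by
  have : 1 ≤ z / N := (one_le_div hN).2 hz
  rw [cutoff, max_eq_right (by linarith), zero_pow two_ne_zero]

lemma tendsto_cutoff (z : ℝ) : Tendsto (fun n : ℕ => cutoff (n + 1) z) atTop (𝓝 1) := by
  have h1 : Tendsto (fun n : ℕ => z / ((n : ℝ) + 1)) atTop (𝓝 0) :=
    tendsto_const_nhds.div_atTop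
      (tendsto_atTop_add_const_right _ _ tendsto_natCast_atTop_atTop)
  have h2 := ((tendsto_const_nhds (x := (1 : ℝ))).sub h1).max
    (tendsto_const_nhds (x := (0 : ℝ)))
  simpa [cutoff] using h2.pow 2

/-- The weight of the energy estimate, adapted to the light cones over `b₀`. -/
def coneWeight (σ N b₀ t x : ℝ) : ℝ :=
  growth σ (radius b₀ x - t) * cutoff N (radius b₀ x + t)

lemma coneWeight_nonneg (σ N b₀ t x : ℝ) : 0 ≤ coneWeight σ N b₀ t x :=
  mul_nonneg (zero_le_one.trans (one_le_growth _ _)) (cutoff_nonneg _ _)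

lemma coneWeight_le {σ N b₀ t x : ℝ} (hN : 0 < N) (ht : 0 ≤ t) :
    coneWeight σ N b₀ t x ≤ growth σ (radius b₀ x - t) :=
  mul_le_of_le_one_right (zero_le_one.trans (one_le_growth _ _))
    (cutoff_le_one hN (by linarith [one_le_radius b₀ x]))

lemma coneWeight_eq_zero {σ N b₀ t x : ℝ} (hN : 0 < N) (ht : 0 ≤ t) (hx : N ≤ |x - b₀|) :
    coneWeight σ N b₀ t x = 0 := by
  rw [coneWeight, cutoff_eq_zero hN (by linarith [abs_sub_le_radius b₀ x]), mul_zero]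

/-- Let `P ≥ 0` be the term with the derivative of `growth` and `Q ≤ 0` the one with the derivative
of `cutoff`. Then `φ_t = -P + Q` and `φ_x = (P + Q) radius'`, and causality follows from `|radius'|
≤ 1` and `|P + Q| ≤ P - Q`. The bound `M` depends on `N`, but it will only multiply a vanishing
error. -/
lemma exists_isCausalWeight {σ N : ℝ} (hσ : 0 ≤ σ) (hN : 0 < N) (b₀ τ : ℝ) :
    ∃ M φt φx, IsCausalWeight τ (b₀ - N) (b₀ + N) M (coneWeight σ N b₀) φt φx := by
  set dA : ℝ → ℝ := fun z => σ * Real.exp (σ * Real.arsinh z) / √(1 + z ^ 2) with hdA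
  set dB : ℝ → ℝ := fun z => -(2 * max (1 - z / N) 0 / N) with hdB
  have hAc : Continuous dA := by
    have h1 := Real.continuous_arsinh
    refine Continuous.div (by fun_prop) (by fun_prop) fun z => ?_
    positivity
  have hBc : Continuous dB := by fun_prop
  have hA0 : ∀ z, 0 ≤ dA z := fun z => by positivity
  have hB0 : ∀ z, dB z ≤ 0 := fun z => neg_nonpos.2 (by positivity)
  have hJ := continuous_radius b₀
  have hg := continuous_growth σ
  have hc := continuous_cutoff N
  set φt : ℝ → ℝ → ℝ := fun t x => -dA (radius b₀ x - t) * cutoff N (radius b₀ x + t) +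
    growth σ (radius b₀ x - t) * dB (radius b₀ x + t) with hφt
  set φx : ℝ → ℝ → ℝ := fun t x => (dA (radius b₀ x - t) * cutoff N (radius b₀ x + t) +
    growth σ (radius b₀ x - t) * dB (radius b₀ x + t)) * ((x - b₀) / radius b₀ x) with hφx
  have hk : IsCompact (Icc 0 τ ×ˢ Icc (b₀ - N) (b₀ + N)) := isCompact_Icc.prod isCompact_Icc
  obtain ⟨M₁, h₁⟩ := hk.exists_bound_of_continuousOn
    (f := fun z : ℝ × ℝ => coneWeight σ N b₀ z.1 z.2)
    (by unfold coneWeight; fun_prop)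
  obtain ⟨M₂, h₂⟩ := hk.exists_bound_of_continuousOn
    (f := fun z : ℝ × ℝ => φt z.1 z.2) (by simp only [hφt]; fun_prop)
  refine ⟨max M₁ M₂, φt, φx, fun t x => ?_, fun t x => ?_, fun t => ?_, fun t => ?_,
    fun t x => coneWeight_nonneg _ _ _ _ _, fun t x => ?_, fun t ht x hx => ⟨?_, ?_⟩,
    fun t ht => coneWeight_eq_zero hN ht.1 ?_, fun t ht => coneWeight_eq_zero hN ht.1 ?_⟩
  · have e1 := (hasDerivAt_growth σ (radius b₀ x - t)).comp t
      ((hasDerivAt_id t).const_sub (radius b₀ x))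
    have e2 := (hasDerivAt_cutoff N (radius b₀ x + t)).comp t
      ((hasDerivAt_id t).const_add (radius b₀ x))
    refine (e1.mul e2).congr_deriv ?_
    simp only [hφt, hdA, hdB, Function.comp]
    ring
  · have e1 := (hasDerivAt_growth σ (radius b₀ x - t)).comp x
      ((hasDerivAt_radius b₀ x).sub_const t)
    have e2 := (hasDerivAt_cutoff N (radius b₀ x + t)).comp x
      ((hasDerivAt_radius b₀ x).add_const t)
    refine (e1.mul e2).congr_deriv ?_
    simp only [hφx, hdA, hdB, Function.comp]
    ring
  · simp only [hφt]; fun_prop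
  · simp only [hφx]
    refine Continuous.mul (by fun_prop) (Continuous.div (by fun_prop) hJ fun x => ?_)
    linarith [one_le_radius b₀ x]
  · simp only [hφx, hφt]
    rw [abs_mul]
    have e1 : 0 ≤ dA (radius b₀ x - t) * cutoff N (radius b₀ x + t) :=
      mul_nonneg (hA0 _) (cutoff_nonneg _ _)
    have e2 : growth σ (radius b₀ x - t) * dB (radius b₀ x + t) ≤ 0 :=
      mul_nonpos_of_nonneg_of_nonpos (zero_le_one.trans (one_le_growth _ _)) (hB0 _)
    refine (mul_le_of_le_one_right (abs_nonneg _) (abs_deriv_radius_le b₀ x)).trans ?_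
    rw [abs_le]
    constructor <;> linarith
  · exact le_max_of_le_left (h₁ (t, x) ⟨ht, hx⟩)
  · exact le_max_of_le_right (h₂ (t, x) ⟨ht, hx⟩)
  · rw [abs_sub_comm]; simp [abs_of_pos hN]
  · simp [abs_of_pos hN]

end Weight

/-! ### Local square integrability -/

section LTwo

variable {f g : ℝ → ℝ} {μ : Measure ℝ}

lemma eLpNorm_two_sq (f : ℝ → ℝ) (μ : Measure ℝ) :
    eLpNorm f 2 μ ^ 2 = ∫⁻ x, ENNReal.ofReal (f x ^ 2) ∂μ := by
  rw [eLpNorm_eq_lintegral_rpow_enorm_toReal (by norm_num) (by norm_num)]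
  simp only [ENNReal.toReal_ofNat]
  rw [← ENNReal.rpow_natCast, ← ENNReal.rpow_mul]
  norm_num
  refine lintegral_congr fun x => ?_
  rw [← ofReal_norm, ← ENNReal.ofReal_pow (norm_nonneg _)]
  simp

lemma eLpNorm_two_le_of_lintegral_sq_le {M : ℝ≥0∞}
    (h : ∫⁻ x, ENNReal.ofReal (f x ^ 2) ∂μ ≤ M ^ 2) : eLpNorm f 2 μ ≤ M := by
  rw [← eLpNorm_two_sq] at h
  exact (ENNReal.pow_le_pow_left_iff two_ne_zero).1 h

/-- Cauchy–Schwarz against the constant `1` on the interval. -/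
lemma setIntegral_abs_le {A B M : ℝ} (hAB : A ≤ B) (hM : 0 ≤ M)
    (hf : IntegrableOn f (Icc A B) volume)
    (h : eLpNorm f 2 (volume.restrict (Icc A B)) ≤ ENNReal.ofReal M) :
    ∫ x in Icc A B, |f x| ≤ M * √(B - A) := by
  have h1 := eLpNorm_le_eLpNorm_mul_rpow_measure_univ (p := 1) (q := 2) (by norm_num)
    hf.aestronglyMeasurable
  rw [Measure.restrict_apply_univ, Real.volume_Icc, eLpNorm_one_eq_lintegral_enorm] at h1
  have h2 : ENNReal.ofReal (∫ x in Icc A B, |f x|) = ∫⁻ x in Icc A B, ‖f x‖ₑ := by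
    rw [ofReal_integral_eq_lintegral_ofReal hf.abs (Eventually.of_forall fun _ => abs_nonneg _)]
    refine lintegral_congr fun x => ?_
    rw [← Real.norm_eq_abs, ofReal_norm]
  have h3 : ENNReal.ofReal (B - A) ^ (1 / (1 : ℝ≥0∞).toReal - 1 / (2 : ℝ≥0∞).toReal) =
      ENNReal.ofReal √(B - A) := by
    rw [Real.sqrt_eq_rpow, ← ENNReal.ofReal_rpow_of_nonneg (by linarith) (by norm_num)]
    norm_num
  rw [h3] at h1
  rw [← ENNReal.ofReal_le_ofReal_iff (by positivity), h2, ENNReal.ofReal_mul hM]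
  exact h1.trans (by gcongr)

lemma HasWeakDeriv.of_hasDerivAt (h : ∀ x, HasDerivAt f (g x) x) (hg : Continuous g) :
    HasWeakDeriv f g := by
  have hf : Continuous f := continuous_iff_continuousAt.2 fun x => (h x).continuousAt
  refine ⟨hf.locallyIntegrable, hg.locallyIntegrable, fun φ hφ hc => ?_⟩
  refine integral_mul_deriv_eq_deriv_mul_of_integrable (fun x _ => h x)
    (fun x _ => (hφ.differentiable (by simp) x).hasDerivAt) ?_ ?_ ?_
  · exact integrable_mul_test hf.locallyIntegrable (contDiff_deriv hφ).continuous hc.deriv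
  · exact integrable_mul_test hg.locallyIntegrable hφ.continuous hc
  · exact integrable_mul_test hf.locallyIntegrable hφ.continuous hc

/-- A function whose weak derivative is square integrable near an interval is Hölder continuous
there, for a suitable representative. -/
lemma abs_primitive_sub_le {A B M : ℝ} (hM : 0 ≤ M) (hg : LocallyIntegrable g volume)
    (h : eLpNorm g 2 (volume.restrict (Icc A B)) ≤ ENNReal.ofReal M) {x y : ℝ}
    (hx : x ∈ Icc A B) (hy : y ∈ Icc A B) :
    |(∫ z in (0 : ℝ)..x, g z) - ∫ z in (0 : ℝ)..y, g z| ≤ M * √|x - y| := by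
  have hi : ∀ a b, IntervalIntegrable g volume a b := fun a b =>
    (hg.integrableOn_isCompact isCompact_uIcc).intervalIntegrable
  wlog hxy : y ≤ x generalizing x y
  · rw [abs_sub_comm, abs_sub_comm x y]
    exact this hy hx (by linarith)
  rw [intervalIntegral.integral_interval_sub_left (hi _ _) (hi _ _),
    intervalIntegral.integral_of_le hxy, ← integral_Icc_eq_integral_Ioc,
    abs_of_nonneg (sub_nonneg.2 hxy)]
  have hsub : Icc y x ⊆ Icc A B := Icc_subset_Icc hy.1 hx.2
  refine (abs_integral_le_integral_abs).trans (setIntegral_abs_le hxy hM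
    (hg.integrableOn_isCompact isCompact_Icc) (le_trans ?_ h))
  exact eLpNorm_mono_measure _ (Measure.restrict_mono hsub le_rfl)

lemma weighted_zero (f : ℝ → ℝ) : weighted 0 f = f := by
  ext x
  simp [weighted]

lemma memLp_two_Icc_of_continuous (hf : Continuous f) (A B : ℝ) :
    MemLp f 2 (volume.restrict (Icc A B)) := by
  obtain ⟨C, hC⟩ := (isCompact_Icc (a := A) (b := B)).exists_bound_of_continuousOn hf.continuousOn
  refine MemLp.of_bound hf.aestronglyMeasurable C ?_
  filter_upwards [ae_restrict_mem measurableSet_Icc] with x hx using hC x hx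

lemma memL2_zero_iff : MemL2 0 f ↔ MemLp f 2 volume := by
  rw [MemL2, weighted_zero]

lemma normL2_zero (f : ℝ → ℝ) : normL2 0 f = eLpNorm f 2 volume := by
  rw [normL2, weighted_zero]

end LTwo

/-! ### Local regularity of solutions -/

section Solution

variable {U s : ℝ → ℝ} {a m : ℝ}

lemma hasDerivAt_psiV (hs : IsKink U a s) (v x : ℝ) :
    HasDerivAt (psiV s v) (lorentz v * deriv s (lorentz v * x)) x := by
  have h := (hs.hasDerivAt (lorentz v * x)).comp x ((hasDerivAt_id x).const_mul (lorentz v))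
  refine h.congr_deriv ?_
  ring

lemma deriv_psiV (hs : IsKink U a s) (v : ℝ) :
    deriv (psiV s v) = fun x => lorentz v * deriv s (lorentz v * x) :=
  funext fun x => (hasDerivAt_psiV hs v x).deriv

lemma continuous_deriv_psiV (hs : IsKink U a s) (v : ℝ) : Continuous (deriv (psiV s v)) := by
  rw [deriv_psiV hs]
  have := hs.continuous_deriv
  fun_prop

lemma hasWeakDeriv_psiV (hs : IsKink U a s) (v : ℝ) :
    HasWeakDeriv (psiV s v) (deriv (psiV s v)) :=
  HasWeakDeriv.of_hasDerivAt (fun x => (hasDerivAt_psiV hs v x).differentiableAt.hasDerivAt)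
    (continuous_deriv_psiV hs v)

lemma continuous_piV (hs : IsKink U a s) (v : ℝ) : Continuous (piV s v) :=
  continuous_const.mul (continuous_deriv_psiV hs v)

/-- The soliton has smooth enough components, so a state inherits a weak derivative from its `E_0`
part; local square integrability is all that the later arguments need. -/
lemma MemPhase.exists_hasWeakDeriv (hs : IsKink U a s) {Y : State} (h : MemPhase s Y) :
    ∃ g, HasWeakDeriv Y.1 g ∧
      ∀ A B, eLpNorm g 2 (volume.restrict (Icc A B)) < ⊤ := by
  obtain ⟨b, v, -, ⟨-, g, hg, hg2⟩, -⟩ := h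
  have h1 : HasWeakDeriv (fun x => psiV s v (x + -b)) (fun x => deriv (psiV s v) (x + -b)) :=
    (hasWeakDeriv_psiV hs v).comp_add (-b)
  have h2 := hg.add h1
  refine ⟨_, by convert h2 using 1; ext x; simp [soliton, sub_eq_add_neg], fun A B => ?_⟩
  have hc : Continuous fun x => deriv (psiV s v) (x + -b) := by
    have := continuous_deriv_psiV hs v
    fun_prop
  have h3 : MemLp (fun x => deriv (psiV s v) (x + -b)) 2 (volume.restrict (Icc A B)) :=
    memLp_two_Icc_of_continuous hc A B
  exact (((memL2_zero_iff.1 hg2).restrict _).add h3).eLpNorm_lt_top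

lemma MemPhase.snd (hs : IsKink U a s) {Y : State} (h : MemPhase s Y) :
    LocallyIntegrable Y.2 volume ∧
      ∀ A B, eLpNorm Y.2 2 (volume.restrict (Icc A B)) < ⊤ := by
  obtain ⟨b, v, -, -, h⟩ := h
  have hc : Continuous (soliton s b v).2 := by
    have := continuous_piV hs v
    unfold soliton
    fun_prop
  have e : Y.2 = (Y - soliton s b v).2 + (soliton s b v).2 := by
    ext x; simp
  have h' := memL2_zero_iff.1 h
  refine ⟨?_, fun A B => ?_⟩
  · rw [e]
    exact (h'.locallyIntegrable (by norm_num)).add hc.locallyIntegrable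
  · rw [e]
    exact ((h'.restrict _).add (memLp_two_Icc_of_continuous hc A B)).eLpNorm_lt_top

lemma HasWeakDeriv.exists_continuous_ae_eq {f g : ℝ → ℝ} (h : HasWeakDeriv f g) :
    ∃ f', Continuous f' ∧ f =ᵐ[volume] f' := by
  obtain ⟨c, hc⟩ := h.exists_ae_eq_primitive
  exact ⟨_, continuous_const.add (intervalIntegral.continuous_primitive
    (fun a b => (h.2.1.integrableOn_isCompact isCompact_uIcc).intervalIntegrable) 0), hc⟩

lemma HasWeakDeriv.locallyIntegrable_comp {f g : ℝ → ℝ} (h : HasWeakDeriv f g) {G : ℝ → ℝ}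
    (hG : Continuous G) : LocallyIntegrable (fun x => G (f x)) volume := by
  obtain ⟨f', hf', hae⟩ := h.exists_continuous_ae_eq
  have h1 : LocallyIntegrable (fun x => G (f' x)) volume := (hG.comp hf').locallyIntegrable
  refine h1.congr ?_
  filter_upwards [hae] with x hx
  rw [hx]

variable {Y : ℝ → State}

/-- Local bounds for a solution, uniform on compact time intervals. -/
lemma IsSolution.exists_local_bound (hs : IsKink U a s) (hY : IsSolution U s Y) (τ A B : ℝ) :
    ∃ M : ℝ, 0 ≤ M ∧ ∀ t ∈ Icc 0 τ,
      (∃ g, HasWeakDeriv (Y t).1 g ∧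
        eLpNorm g 2 (volume.restrict (Icc A B)) ≤ ENNReal.ofReal M) ∧
      eLpNorm (Y t).2 2 (volume.restrict (Icc A B)) ≤ ENNReal.ofReal M := by
  have hbase : ∀ t₀ : ℝ, ∃ M : ℝ, 0 ≤ M ∧ ∀ᶠ t in 𝓝 t₀,
      (∃ g, HasWeakDeriv (Y t).1 g ∧
        eLpNorm g 2 (volume.restrict (Icc A B)) ≤ ENNReal.ofReal M) ∧
      eLpNorm (Y t).2 2 (volume.restrict (Icc A B)) ≤ ENNReal.ofReal M := by
    intro t₀
    obtain ⟨g₀, hg₀, hfin⟩ := (hY.mem t₀).exists_hasWeakDeriv hs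
    obtain ⟨-, hfin'⟩ := (hY.mem t₀).snd hs
    have hM : ∀ z : ℝ≥0∞, z < ⊤ → z ≤ ENNReal.ofReal z.toReal := fun z hz =>
      (ENNReal.ofReal_toReal hz.ne).ge
    refine ⟨(eLpNorm g₀ 2 (volume.restrict (Icc A B))).toReal +
      (eLpNorm (Y t₀).2 2 (volume.restrict (Icc A B))).toReal + 1, by positivity, ?_⟩
    filter_upwards [(hY.continuous t₀).eventually (gt_mem_nhds one_pos)] with t ht
    -- Strict smallness of the infimum produces an actual weak derivative of the difference, with
    -- norm below `1`; this is the `+ 1` in the bound.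
    have h1 : (⨅ (g : ℝ → ℝ) (_ : HasWeakDeriv (Y t - Y t₀).1 g), normL2 0 g) < 1 :=
      ((le_add_self).trans le_self_add).trans_lt ht
    have h2 : normL2 0 (Y t - Y t₀).2 < 1 := le_add_self.trans_lt ht
    simp only [iInf_lt_iff] at h1
    obtain ⟨g, hg, hg1⟩ := h1
    rw [normL2_zero] at hg1 h2
    constructor
    · refine ⟨_, by convert hg.add hg₀ using 1; ext x; simp, ?_⟩
      refine (eLpNorm_add_le (hg.2.1.aestronglyMeasurable.restrict)
        (hg₀.2.1.aestronglyMeasurable.restrict) (by norm_num)).trans ?_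
      rw [ENNReal.ofReal_add (by positivity) (by norm_num), ENNReal.ofReal_one,
        ENNReal.ofReal_add (by positivity) (by positivity), add_comm]
      gcongr
      · exact le_add_right (hM _ (hfin A B))
      · exact (eLpNorm_restrict_le _ _ _ _).trans hg1.le
    · have e : (Y t).2 = (Y t - Y t₀).2 + (Y t₀).2 := by ext x; simp
      have m1 := ((hY.mem t).snd hs).1
      have m0 := ((hY.mem t₀).snd hs).1
      rw [e]
      refine (eLpNorm_add_le ((m1.aestronglyMeasurable.sub m0.aestronglyMeasurable).restrict)
        m0.aestronglyMeasurable.restrict (by norm_num)).trans ?_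
      rw [ENNReal.ofReal_add (by positivity) (by norm_num), ENNReal.ofReal_one,
        ENNReal.ofReal_add (by positivity) (by positivity), add_comm]
      gcongr
      · exact le_add_left (hM _ (hfin' A B))
      · exact (eLpNorm_restrict_le _ _ _ _).trans h2.le
  have hmono : ∀ (S : Set ℝ) (M M' : ℝ), M ≤ M' → (∀ t ∈ S,
      (∃ g, HasWeakDeriv (Y t).1 g ∧
        eLpNorm g 2 (volume.restrict (Icc A B)) ≤ ENNReal.ofReal M) ∧
      eLpNorm (Y t).2 2 (volume.restrict (Icc A B)) ≤ ENNReal.ofReal M) → ∀ t ∈ S,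
      (∃ g, HasWeakDeriv (Y t).1 g ∧
        eLpNorm g 2 (volume.restrict (Icc A B)) ≤ ENNReal.ofReal M') ∧
      eLpNorm (Y t).2 2 (volume.restrict (Icc A B)) ≤ ENNReal.ofReal M' := by
    intro S M M' hMM h t ht
    obtain ⟨⟨g, h1, h2⟩, h3⟩ := h t ht
    have := ENNReal.ofReal_le_ofReal hMM
    exact ⟨⟨g, h1, h2.trans this⟩, h3.trans this⟩
  -- The bounds near single times are patched together by compactness of `[0, τ]`.
  refine isCompact_Icc.induction_on (p := fun S => ∃ M : ℝ, 0 ≤ M ∧ ∀ t ∈ S,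
      (∃ g, HasWeakDeriv (Y t).1 g ∧
        eLpNorm g 2 (volume.restrict (Icc A B)) ≤ ENNReal.ofReal M) ∧
      eLpNorm (Y t).2 2 (volume.restrict (Icc A B)) ≤ ENNReal.ofReal M)
    ⟨0, le_rfl, by simp⟩ ?_ ?_ ?_
  · rintro S S' hSS ⟨M, hM, h⟩
    exact ⟨M, hM, fun t ht => h t (hSS ht)⟩
  · rintro S S' ⟨M, hM, h⟩ ⟨M', hM', h'⟩
    refine ⟨max M M', le_max_of_le_left hM, fun t ht => ?_⟩
    rcases ht with ht | ht
    · exact hmono S _ _ (le_max_left _ _) h t ht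
    · exact hmono S' _ _ (le_max_right _ _) h' t ht
  · intro t₀ _
    obtain ⟨M, hM, h⟩ := hbase t₀
    exact ⟨_, mem_nhdsWithin_of_mem_nhds h, M, hM, fun t ht => ht⟩

end Solution

/-! ### Mollified solutions and the commutator with the nonlinearity -/

section Regularization

variable {U s : ℝ → ℝ} {a m : ℝ} {Y : ℝ → State} {δ lo hi τ : ℝ} {ρ η f g : ℝ → ℝ}

lemma deriv_eq_zero_of_one_lt (h : ∀ x, 1 < |x| → η x = 0) (x : ℝ) (hx : 1 < |x|) :
    deriv η x = 0 := by
  have : η =ᶠ[𝓝 x] fun _ => 0 := by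
    filter_upwards [continuous_abs.continuousAt.eventually (lt_mem_nhds hx)] with y hy
    exact h y hy
  rw [this.deriv_eq, deriv_const]

lemma IsMollifier.mollify_mem (h : IsMollifier δ ρ) (hf : LocallyIntegrable f volume)
    (hae : ∀ᵐ x, f x ∈ Icc lo hi) (x : ℝ) : mollify ρ f x ∈ Icc lo hi := by
  have := abs_le.1 (h.abs_mollify_sub_le hf (x := x) (c := (lo + hi) / 2) (M := (hi - lo) / 2)
    (by
      filter_upwards [hae] with y hy _
      rw [abs_le]
      constructor <;> linarith [hy.1, hy.2]))
  constructor <;> linarith [this.1, this.2]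

lemma IsSolution.hasDerivAt_mollify_fst (hY : IsSolution U s Y) (hη : ContDiff ℝ ∞ η)
    (hc : HasCompactSupport η) (t x : ℝ) :
    HasDerivAt (fun t => mollify η (Y t).1 x) (mollify η (Y t).2 x) t :=
  hY.eq_fst (fun y => η (x - y)) (hη.comp (contDiff_const.sub contDiff_id))
    (hasCompactSupport_comp_sub hc x) t

/-- The equation is tested with `y ↦ η (x - y)`; the two signs from differentiating in `y` twice
cancel. -/
lemma IsSolution.hasDerivAt_mollify_snd (hU : ContDiff ℝ ∞ U) (hs : IsKink U a s)
    (hY : IsSolution U s Y) (hη : ContDiff ℝ ∞ η)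
    (hc : HasCompactSupport η) (t x : ℝ) :
    HasDerivAt (fun t => mollify η (Y t).2 x) (mollify (deriv (deriv η)) (Y t).1 x +
      mollify η (fun y => -deriv U ((Y t).1 y)) x) t := by
  have h := hY.eq_snd (fun y => η (x - y)) (hη.comp (contDiff_const.sub contDiff_id))
    (hasCompactSupport_comp_sub hc x) t
  obtain ⟨g, hg, -⟩ := (hY.mem t).exists_hasWeakDeriv hs
  have hU' : Continuous fun z => -deriv U z := (contDiff_deriv hU).continuous.neg
  have hd : deriv (deriv fun y => η (x - y)) = fun y => deriv (deriv η) (x - y) := by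
    rw [deriv_comp_sub_left]
    ext y
    rw [deriv.fun_neg, congrFun (deriv_comp_sub_left (deriv η) x) y, neg_neg]
  rw [hd, integral_add] at h
  · exact h
  · exact integrable_mul_comp_sub hg.1 (contDiff_deriv (contDiff_deriv hη)).continuous
      hc.deriv.deriv x
  · exact integrable_mul_comp_sub (hg.locallyIntegrable_comp hU') hη.continuous hc x

/-- A mollified solution is a smooth solution of a forced wave equation. -/
lemma IsSolution.exists_isRegularWave (hU : ContDiff ℝ ∞ U) (hs : IsKink U a s)
    (hY : IsSolution U s Y) (hρ : IsMollifier δ ρ) (hδ : δ ≤ 1) {α β : ℝ} (hαβ : α ≤ β)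
    (hconf : ∀ t ∈ Icc 0 τ, ∀ᵐ x, (Y t).1 x ∈ Icc lo hi) :
    ∃ M, IsRegularWave τ α β M (fun t => mollify ρ (Y t).1)
      (fun t => mollify (deriv ρ) (Y t).1) (fun t => mollify ρ (Y t).2)
      (fun t => mollify (deriv (deriv ρ)) (Y t).1) (fun t => mollify (deriv ρ) (Y t).2)
      (fun t => mollify ρ (fun y => -deriv U ((Y t).1 y))) := by
  have hs0 : ∀ x, 1 < |x| → ρ x = 0 := fun x hx => hρ.eq_zero x (hδ.trans_lt hx)
  have hs1 := deriv_eq_zero_of_one_lt hs0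
  have hs2 := deriv_eq_zero_of_one_lt hs1
  have hd1 := contDiff_deriv hρ.smooth
  have hd2 := contDiff_deriv hd1
  -- All pointwise bounds are the supremum of a kernel derivative times a local `L¹` norm. They may
  -- blow up with `δ → 0`, as they only justify differentiation under the integral.
  obtain ⟨C₀, hC₀⟩ := hρ.compact.exists_bound_of_continuous hρ.smooth.continuous
  obtain ⟨C₁, hC₁⟩ := hρ.compact.deriv.exists_bound_of_continuous hd1.continuous
  obtain ⟨C₂, hC₂⟩ := hρ.compact.deriv.deriv.exists_bound_of_continuous hd2.continuous
  have hU' : Continuous fun z => -deriv U z := (contDiff_deriv hU).continuous.neg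
  obtain ⟨B, hB⟩ := (isCompact_Icc (a := lo) (b := hi)).exists_bound_of_continuousOn
    hU'.continuousOn
  obtain ⟨M, hM, hbd⟩ := hY.exists_local_bound hs τ (α - 1) (β + 1)
  have hloc1 : ∀ t, LocallyIntegrable (Y t).1 volume := fun t => by
    obtain ⟨g, hg, -⟩ := (hY.mem t).exists_hasWeakDeriv hs
    exact hg.1
  have hloc2 : ∀ t, LocallyIntegrable (Y t).2 volume := fun t => ((hY.mem t).snd hs).1
  have hlocF : ∀ t, LocallyIntegrable (fun y => -deriv U ((Y t).1 y)) volume := fun t => by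
    obtain ⟨g, hg, -⟩ := (hY.mem t).exists_hasWeakDeriv hs
    exact hg.locallyIntegrable_comp hU'
  set I := Icc (α - 1) (β + 1) with hI
  have hvol : volume.real I = β - α + 2 := by
    rw [hI, Real.volume_real_Icc_of_le (by linarith)]; ring
  set D₁ := max |lo| |hi| * (β - α + 2)
  set D₂ := M * √(β - α + 2)
  set D₃ := B * (β - α + 2)
  have hconst : ∀ (h : ℝ → ℝ) (c : ℝ), LocallyIntegrable h volume → (∀ᵐ x, |h x| ≤ c) →
      ∫ x in I, |h x| ≤ c * (β - α + 2) := by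
    intro h c hh hc
    have : ∫ x in I, |h x| ≤ ∫ x in I, c := by
      refine integral_mono_ae (hh.integrableOn_isCompact isCompact_Icc).abs
        (integrableOn_const (by simp [hI])) ?_
      exact ae_restrict_of_ae hc
    rw [setIntegral_const, hvol, smul_eq_mul, mul_comm] at this
    exact this
  have b1 : ∀ t ∈ Icc 0 τ, ∫ x in I, |(Y t).1 x| ≤ D₁ := fun t ht => by
    refine hconst _ _ (hloc1 t) ?_
    filter_upwards [hconf t ht] with x hx
    exact abs_le_max_abs_abs hx.1 hx.2
  have b3 : ∀ t ∈ Icc 0 τ, ∫ x in I, |-deriv U ((Y t).1 x)| ≤ D₃ := fun t ht => by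
    refine hconst _ _ (hlocF t) ?_
    filter_upwards [hconf t ht] with x hx using hB _ hx
  have b2 : ∀ t ∈ Icc 0 τ, ∫ x in I, |(Y t).2 x| ≤ D₂ := fun t ht => by
    have := setIntegral_abs_le (by linarith) hM
      ((hloc2 t).integrableOn_isCompact isCompact_Icc) (hbd t ht).2
    refine this.trans (le_of_eq ?_)
    simp only [D₂]
    congr 2
    ring
  set C := max C₀ (max C₁ C₂)
  set D := max D₁ (max D₂ D₃)
  have hC0 : 0 ≤ C := le_max_of_le_left ((norm_nonneg _).trans (hC₀ 0))
  have l0 : ∀ x, |ρ x| ≤ C := fun x => (hC₀ x).trans (le_max_left _ _)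
  have l1 : ∀ x, |deriv ρ x| ≤ C := fun x =>
    (hC₁ x).trans ((le_max_left _ _).trans (le_max_right _ _))
  have l2 : ∀ x, |deriv (deriv ρ) x| ≤ C := fun x =>
    (hC₂ x).trans ((le_max_right _ _).trans (le_max_right _ _))
  have key : ∀ (h η : ℝ → ℝ) (E : ℝ), LocallyIntegrable h volume → (∀ x, |η x| ≤ C) →
      (∀ x, 1 < |x| → η x = 0) → ∫ x in I, |h x| ≤ E → E ≤ D →
      ∀ x ∈ Icc α β, |mollify η h x| ≤ C * D := by
    intro h η E h1 h2 h3 h4 h5 x hx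
    refine (abs_mollify_le h1 h2 h3 hx).trans ?_
    exact mul_le_mul_of_nonneg_left (h4.trans h5) hC0
  have e1 : D₁ ≤ D := le_max_left _ _
  have e2 : D₂ ≤ D := (le_max_left _ _).trans (le_max_right _ _)
  have e3 : D₃ ≤ D := (le_max_right _ _).trans (le_max_right _ _)
  refine ⟨C * D, ⟨fun t x => hY.hasDerivAt_mollify_fst hρ.smooth hρ.compact t x,
    fun t x => hY.hasDerivAt_mollify_fst hd1 hρ.compact.deriv t x,
    fun t x => hY.hasDerivAt_mollify_snd hU hs hρ.smooth hρ.compact t x,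
    fun t x => hasDerivAt_mollify (hloc1 t) hd1 hρ.compact.deriv x,
    fun t x => hasDerivAt_mollify (hloc2 t) hρ.smooth hρ.compact x,
    fun t => continuous_mollify (hloc1 t) hρ.smooth hρ.compact,
    fun t => continuous_mollify (hloc1 t) hd2 hρ.compact.deriv.deriv,
    fun t => continuous_mollify (hloc2 t) hd1 hρ.compact.deriv,
    fun t _ => continuous_mollify (hlocF t) hρ.smooth hρ.compact,
    fun t ht x hx => ⟨?_, ?_, ?_, ?_, ?_, ?_⟩⟩⟩
  · exact key _ _ _ (hloc1 t) l0 hs0 (b1 t ht) e1 x hx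
  · exact key _ _ _ (hloc1 t) l1 hs1 (b1 t ht) e1 x hx
  · exact key _ _ _ (hloc2 t) l0 hs0 (b2 t ht) e2 x hx
  · exact key _ _ _ (hloc1 t) l2 hs2 (b1 t ht) e1 x hx
  · exact key _ _ _ (hloc2 t) l1 hs1 (b2 t ht) e2 x hx
  · exact key _ _ _ (hlocF t) l0 hs0 (b3 t ht) e3 x hx

lemma exists_lipschitz_deriv (hU : ContDiff ℝ ∞ U) (lo hi : ℝ) :
    ∃ K, 0 ≤ K ∧ ∀ x ∈ Icc lo hi, ∀ y ∈ Icc lo hi,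
      |deriv U x - deriv U y| ≤ K * |x - y| := by
  have hd := contDiff_deriv hU
  obtain ⟨K, hK⟩ := (isCompact_Icc (a := lo) (b := hi)).exists_bound_of_continuousOn
    (contDiff_deriv hd).continuous.continuousOn
  refine ⟨|K|, abs_nonneg _, fun x hx y hy => ?_⟩
  exact (convex_Icc lo hi).norm_image_sub_le_of_norm_deriv_le
    (fun z _ => hd.differentiable (by simp) z) (fun z hz => (hK z hz).trans (le_abs_self _)) hy hx

/-- The commutator of a nonlinearity with mollification is small in the supremum norm. -/
lemma IsMollifier.abs_commutator_le (hU : ContDiff ℝ ∞ U) (hρ : IsMollifier δ ρ) (hδ : δ ≤ 1)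
    (hfg : HasWeakDeriv f g) (hae : ∀ᵐ x, f x ∈ Icc lo hi) {α β M K : ℝ} (hM : 0 ≤ M)
    (hg : eLpNorm g 2 (volume.restrict (Icc (α - 1) (β + 1))) ≤ ENNReal.ofReal M) (hK : 0 ≤ K)
    (hlip : ∀ x ∈ Icc lo hi, ∀ y ∈ Icc lo hi, |deriv U x - deriv U y| ≤ K * |x - y|)
    {x : ℝ} (hx : x ∈ Icc α β) :
    |mollify ρ (fun y => -deriv U (f y)) x + deriv U (mollify ρ f x)| ≤
      K * (2 * (M * √δ)) := by
  have hU' : Continuous fun z => -deriv U z := (contDiff_deriv hU).continuous.neg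
  obtain ⟨c, hc⟩ := hfg.exists_ae_eq_primitive
  set G := fun x => c + ∫ y in (0 : ℝ)..x, g y
  -- Hölder continuity of the representative `G`: on the support of the kernel `f` stays within `M
  -- √δ` of `G x`, and hence so does its average.
  have hhol : ∀ᵐ y, |x - y| ≤ δ → |f y - G x| ≤ M * √δ := by
    filter_upwards [hc] with y hy hxy
    have h1 := abs_le.1 hxy
    have h2 := abs_primitive_sub_le hM hfg.2.1 hg (x := y) (y := x)
      ⟨by linarith [hx.1], by linarith [hx.2]⟩ ⟨by linarith [hx.1], by linarith [hx.2]⟩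
    have h3 : f y - G x = (∫ z in (0 : ℝ)..y, g z) - ∫ z in (0 : ℝ)..x, g z := by
      rw [hy]; simp only [G]; ring
    rw [h3]
    refine h2.trans ?_
    rw [abs_sub_comm]
    gcongr
  have hq := hρ.abs_mollify_sub_le hfg.1 hhol
  have hqm := hρ.mollify_mem hfg.1 hae x
  -- Near `x` both `f y` and the average are close to `G x`, so `U'` varies by at most `K · 2M √δ`
  -- between them; averaging keeps this bound.
  have := hρ.abs_mollify_sub_le (hfg.locallyIntegrable_comp hU') (x := x)
    (c := -deriv U (mollify ρ f x)) (M := K * (2 * (M * √δ))) (by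
      filter_upwards [hhol, hae] with y hy hym hxy
      have h1 := hlip _ hqm _ hym
      have h2 : |mollify ρ f x - f y| ≤ 2 * (M * √δ) := by
        have e : mollify ρ f x - f y = (mollify ρ f x - G x) - (f y - G x) := by ring
        rw [e]
        refine (abs_sub _ _).trans ?_
        linarith [hy hxy]
      have e : -deriv U (f y) - -deriv U (mollify ρ f x) =
        deriv U (mollify ρ f x) - deriv U (f y) := by ring
      rw [e]
      exact h1.trans (by gcongr))
  rwa [sub_neg_eq_add] at this

/-- The bound does not depend on the mollifier, in contrast to the pointwise bounds of
`IsSolution.exists_isRegularWave`. This is what makes the work of the residual force vanish in the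
limit. -/
lemma IsMollifier.integral_abs_mollify_le (hρ : IsMollifier δ ρ) (hδ : δ ≤ 1)
    (hf : LocallyIntegrable f volume) {α β M : ℝ} (hαβ : α ≤ β) (hM : 0 ≤ M)
    (h : eLpNorm f 2 (volume.restrict (Icc (α - 1) (β + 1))) ≤ ENNReal.ofReal M) :
    ∫ x in α..β, |mollify ρ f x| ≤ M * √(β - α) := by
  rw [intervalIntegral.integral_of_le hαβ, ← integral_Icc_eq_integral_Ioc]
  refine setIntegral_abs_le hαβ hM ((continuous_mollify hf hρ.smooth
    hρ.compact).locallyIntegrable.integrableOn_isCompact isCompact_Icc)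
    (eLpNorm_two_le_of_lintegral_sq_le ?_)
  have h1 := hρ.lintegral_sq_mollify_le hf.aestronglyMeasurable
    (W := (Icc α β).indicator 1) (W' := (Icc (α - 1) (β + 1)).indicator 1)
    (measurable_one.indicator measurableSet_Icc) (fun x y hxy => by
      by_cases hx : x ∈ Icc α β
      · have h2 := abs_le.1 (hxy.trans hδ)
        have hy : y ∈ Icc (α - 1) (β + 1) := ⟨by linarith [hx.1], by linarith [hx.2]⟩
        simp [hx, hy]
      · rw [indicator_of_notMem hx]; exact zero_le)
  have h2 : ∀ (S : Set ℝ) (u : ℝ → ℝ≥0∞), MeasurableSet S →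
      ∫⁻ x, S.indicator 1 x * u x = ∫⁻ x in S, u x := by
    intro S u hS
    rw [← lintegral_indicator hS]
    refine lintegral_congr fun x => ?_
    by_cases hx : x ∈ S <;> simp [hx]
  rw [h2 _ _ measurableSet_Icc, h2 _ _ measurableSet_Icc, ← eLpNorm_two_sq f] at h1
  exact h1.trans (by gcongr)

end Regularization

/-! ### Weighted energy estimate for distributional solutions -/

section Limit

variable {U s : ℝ → ℝ} {a m : ℝ} {Y : ℝ → State} {lo hi τ σ b₀ : ℝ} {C₀ : ℝ≥0∞}

/-- The energy density of the mollification of a state. -/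
def mollifiedEnergy (U : ℝ → ℝ) (n : ℕ) (X : State) (x : ℝ) : ℝ :=
  energyDensity U (mollify (kernel n) X.1 x) (mollify (deriv (kernel n)) X.1 x)
    (mollify (kernel n) X.2 x)

/-- Fatou's lemma, with upper bounds that converge. -/
lemma lintegral_le_of_ae_tendsto {F : ℕ → ℝ → ℝ≥0∞} {f : ℝ → ℝ≥0∞} {c : ℕ → ℝ≥0∞}
    {C : ℝ≥0∞} (hF : ∀ n, AEMeasurable (F n) volume)
    (h : ∀ᵐ x, Tendsto (fun n => F n x) atTop (𝓝 (f x))) (hc : Tendsto c atTop (𝓝 C))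
    (hle : ∀ n, ∫⁻ x, F n x ≤ c n) : ∫⁻ x, f x ≤ C := by
  calc ∫⁻ x, f x = ∫⁻ x, liminf (fun n => F n x) atTop := by
        refine lintegral_congr_ae ?_
        filter_upwards [h] with x hx using hx.liminf_eq.symm
    _ ≤ liminf (fun n => ∫⁻ x, F n x) atTop := lintegral_liminf_le' hF
    _ ≤ liminf c atTop := liminf_le_liminf (Eventually.of_forall hle)
    _ = C := hc.liminf_eq

/-- The energy inequality with residual force of order `√δ`, where `δ = 1 / (n + 1)`. The constant
`D` may depend on the cutoff radius and on the solution, but not on `n`. -/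
lemma IsSolution.cone_energy_mollified_le (hU : ContDiff ℝ ∞ U) (hs : IsKink U a s)
    (hY : IsSolution U s Y) (hτ : 0 ≤ τ) (hσ : 0 ≤ σ)
    (hconf : ∀ t ∈ Icc 0 τ, ∀ᵐ x, (Y t).1 x ∈ Icc lo hi)
    (hUpos : ∀ z ∈ Icc lo hi, 0 ≤ U z)
    (hinit : ∀ n, ∫⁻ x, ENNReal.ofReal (growth σ (radius b₀ x) *
      mollifiedEnergy U n (Y 0) x) ≤ C₀) {N : ℝ} (hN : 0 < N) :
    ∃ D : ℝ, ∀ n : ℕ, ∫⁻ x, ENNReal.ofReal (coneWeight σ N b₀ τ x *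
      mollifiedEnergy U n (Y τ) x) ≤ C₀ + ENNReal.ofReal (D * √(1 / ((n : ℝ) + 1))) := by
  obtain ⟨Mφ, φt, φx, hφ⟩ := exists_isCausalWeight hσ hN b₀ τ
  have hαβ : b₀ - N ≤ b₀ + N := by linarith
  obtain ⟨M, hM, hbd⟩ := hY.exists_local_bound hs τ (b₀ - N - 1) (b₀ + N + 1)
  obtain ⟨K, hK, hlip⟩ := exists_lipschitz_deriv hU lo hi
  refine ⟨τ * (Mφ * (K * (2 * M)) * (M * √(b₀ + N - (b₀ - N)))), fun n => ?_⟩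
  have hk := isMollifier_kernel n
  have hδ : 1 / ((n : ℝ) + 1) ≤ 1 := by
    rw [div_le_one (by positivity)]; linarith [Nat.cast_nonneg (α := ℝ) n]
  obtain ⟨M', hw⟩ := hY.exists_isRegularWave hU hs hk hδ hαβ hconf
  have hloc1 : ∀ t, LocallyIntegrable (Y t).1 volume := fun t => by
    obtain ⟨g, hg, -⟩ := (hY.mem t).exists_hasWeakDeriv hs
    exact hg.1
  have hmem : ∀ t ∈ Icc 0 τ, ∀ x, mollify (kernel n) (Y t).1 x ∈ Icc lo hi := fun t ht x =>
    hk.mollify_mem (hloc1 t) (hconf t ht) x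
  have main := weighted_energy_le hU hαβ hτ hw hφ
    (fun t ht x _ => hUpos _ (hmem t ht x))
    (fun t ht x hx => by
      obtain ⟨⟨g, hg, hgM⟩, -⟩ := hbd t ht
      exact hk.abs_commutator_le hU hδ hg (hconf t ht) hM hgM hK hlip hx)
    (fun t ht => hk.integral_abs_mollify_le hδ ((hY.mem t).snd hs).1 hαβ hM (hbd t ht).2)
  have hcont : ∀ t, Continuous fun x => coneWeight σ N b₀ t x * mollifiedEnergy U n (Y t) x :=
    fun t => (hφ.continuous t).mul (continuous_energyDensity hU hw t)
  have hpos : ∀ t ∈ Icc 0 τ, ∀ x, 0 ≤ mollifiedEnergy U n (Y t) x := fun t ht x => by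
    have := hUpos _ (hmem t ht x)
    unfold mollifiedEnergy energyDensity
    positivity
  have hconv : ∀ t ∈ Icc 0 τ, ENNReal.ofReal (∫ x in (b₀ - N)..(b₀ + N),
      coneWeight σ N b₀ t x * mollifiedEnergy U n (Y t) x) =
      ∫⁻ x, ENNReal.ofReal (coneWeight σ N b₀ t x * mollifiedEnergy U n (Y t) x) := by
    intro t ht
    rw [intervalIntegral.integral_of_le hαβ, ofReal_integral_eq_lintegral_ofReal
      ((hcont t).intervalIntegrable _ _).1
      (Eventually.of_forall fun x => mul_nonneg (coneWeight_nonneg _ _ _ _ _) (hpos t ht x)),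
      ← lintegral_indicator measurableSet_Ioc]
    refine lintegral_congr fun x => ?_
    by_cases hx : x ∈ Ioc (b₀ - N) (b₀ + N)
    · rw [indicator_of_mem hx]
    · have hx' : N ≤ |x - b₀| := by
        by_contra hc
        push Not at hc
        have := abs_lt.1 hc
        exact hx ⟨by linarith, by linarith⟩
      rw [indicator_of_notMem hx, coneWeight_eq_zero hN ht.1 hx', zero_mul, ENNReal.ofReal_zero]
  have h0 : (0 : ℝ) ∈ Icc 0 τ := left_mem_Icc.2 hτ
  have hstart : ∫⁻ x, ENNReal.ofReal (coneWeight σ N b₀ 0 x * mollifiedEnergy U n (Y 0) x) ≤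
      C₀ := by
    refine (lintegral_mono fun x => ?_).trans (hinit n)
    refine ENNReal.ofReal_le_ofReal (mul_le_mul_of_nonneg_right ?_ (hpos 0 h0 x))
    simpa using coneWeight_le (σ := σ) (b₀ := b₀) (x := x) hN le_rfl
  rw [← hconv τ (right_mem_Icc.2 hτ)]
  refine (ENNReal.ofReal_le_ofReal main).trans (ENNReal.ofReal_add_le.trans ?_)
  refine add_le_add ((hconv 0 h0).le.trans hstart) (ENNReal.ofReal_le_ofReal (le_of_eq ?_))
  ring

/-- The weighted energy estimate: at time `τ` the energy, weighted with the distance to the light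
cone over `b₀`, is bounded by the weighted energy at time `0`. -/
theorem IsSolution.cone_energy_le (hU : ContDiff ℝ ∞ U) (hs : IsKink U a s)
    (hY : IsSolution U s Y) (hτ : 0 ≤ τ) (hσ : 0 ≤ σ)
    (hconf : ∀ t ∈ Icc 0 τ, ∀ᵐ x, (Y t).1 x ∈ Icc lo hi)
    (hUpos : ∀ z ∈ Icc lo hi, 0 ≤ U z)
    (hinit : ∀ n, ∫⁻ x, ENNReal.ofReal (growth σ (radius b₀ x) *
      mollifiedEnergy U n (Y 0) x) ≤ C₀) {g : ℝ → ℝ} (hg : HasWeakDeriv (Y τ).1 g) :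
    ∫⁻ x, ENNReal.ofReal (growth σ (radius b₀ x - τ) *
      energyDensity U ((Y τ).1 x) (g x) ((Y τ).2 x)) ≤ C₀ := by
  have h2 := ((hY.mem τ).snd hs).1
  have hUc := hU.continuous
  have hm1 := hg.1.aestronglyMeasurable.aemeasurable
  have hmg := hg.2.1.aestronglyMeasurable.aemeasurable
  have hm2 := h2.aestronglyMeasurable.aemeasurable
  have hr := continuous_radius b₀
  have hgr := continuous_growth σ
  have hcw : ∀ N, Continuous (coneWeight σ N b₀ τ) := fun N => by
    have := continuous_cutoff N
    unfold coneWeight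
    fun_prop
  -- The mollification limit is taken at a fixed cutoff, because `D` depends on the cutoff; the
  -- resulting bound `C₀` no longer does, so the cutoff can then be removed.
  have hfix : ∀ k : ℕ, ∫⁻ x, ENNReal.ofReal (coneWeight σ (k + 1) b₀ τ x *
      energyDensity U ((Y τ).1 x) (g x) ((Y τ).2 x)) ≤ C₀ := by
    intro k
    obtain ⟨D, hD⟩ := hY.cone_energy_mollified_le hU hs hτ hσ hconf hUpos hinit
      (N := k + 1) (by positivity)
    refine lintegral_le_of_ae_tendsto (fun n => ?_) ?_ ?_ hD
    · have hk := isMollifier_kernel n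
      have c1 := continuous_mollify hg.1 hk.smooth hk.compact
      have c2 := continuous_mollify hg.1 (contDiff_deriv hk.smooth) hk.compact.deriv
      have c3 := continuous_mollify h2 hk.smooth hk.compact
      have := hcw (k + 1)
      refine (ENNReal.continuous_ofReal.comp ?_).measurable.aemeasurable
      unfold mollifiedEnergy energyDensity
      fun_prop
    · filter_upwards [ae_tendsto_mollify hg.1, ae_tendsto_mollify hg.2.1,
        ae_tendsto_mollify h2] with x t1 t2 t3
      refine (ENNReal.continuous_ofReal.tendsto _).comp (Tendsto.const_mul _ ?_)
      have t2' : Tendsto (fun n => mollify (deriv (kernel n)) (Y τ).1 x) atTop (𝓝 (g x)) := by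
        refine t2.congr fun n => ?_
        exact (hg.mollify_deriv (isMollifier_kernel n).smooth (isMollifier_kernel n).compact
          x).symm
      exact (((t3.pow 2).div_const 2).add ((t2'.pow 2).div_const 2)).add
        ((hUc.tendsto _).comp t1)
    · have e1 : Tendsto (fun n : ℕ => D * √(1 / ((n : ℝ) + 1))) atTop (𝓝 (D * √0)) :=
        ((Real.continuous_sqrt.tendsto 0).comp tendsto_one_div_add_atTop_nhds_zero_nat).const_mul D
      have e2 := (ENNReal.continuous_ofReal.tendsto _).comp e1
      simpa using (tendsto_const_nhds (x := C₀)).add e2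
  refine lintegral_le_of_ae_tendsto (fun k => ?_) (Eventually.of_forall fun x => ?_)
    (tendsto_const_nhds) hfix
  · have := hcw (k + 1)
    unfold energyDensity
    have := hUc.measurable
    fun_prop
  · refine (ENNReal.continuous_ofReal.tendsto _).comp (Tendsto.mul_const _ ?_)
    simpa [coneWeight] using
      (tendsto_cutoff (radius b₀ x + τ)).const_mul (growth σ (radius b₀ x - τ))

end Limit

/-! ### Weighted energy of the initial state -/

section InitialEnergy

variable {U s : ℝ → ℝ} {a m : ℝ} {δ : ℝ} {ρ f g : ℝ → ℝ}

/-- The power `σ` of `1 + u ≤ (1 + 1/k) exp (k u)` with `k = c / σ`. -/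
lemma rpow_le_exp {σ c : ℝ} (hσ : 0 < σ) (hc : 0 < c) :
    ∃ K, 0 ≤ K ∧ ∀ u, 0 ≤ u → (1 + u) ^ σ ≤ K * Real.exp (c * u) := by
  set k := c / σ
  have hk : 0 < k := div_pos hc hσ
  refine ⟨(1 + 1 / k) ^ σ, by positivity, fun u hu => ?_⟩
  have h1 : 1 + u ≤ (1 + 1 / k) * Real.exp (k * u) := by
    have h2 := Real.add_one_le_exp (k * u)
    calc 1 + u ≤ (1 + 1 / k) * (k * u + 1) := by
          have : (1 + 1 / k) * (k * u + 1) = 1 + u + k * u + 1 / k := by field_simp; ring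
          have : 0 < 1 / k := by positivity
          nlinarith [mul_nonneg hk.le hu]
      _ ≤ _ := by gcongr
  calc (1 + u) ^ σ ≤ ((1 + 1 / k) * Real.exp (k * u)) ^ σ := by gcongr
    _ = (1 + 1 / k) ^ σ * Real.exp (c * u) := by
        rw [Real.mul_rpow (by positivity) (Real.exp_pos _).le, ← Real.exp_mul]
        congr 2
        simp only [k]
        field_simp

lemma integrable_exp_neg_mul_abs {c : ℝ} (hc : 0 < c) :
    Integrable fun x : ℝ => Real.exp (-(c * |x|)) := by
  have h1 : IntegrableOn (fun x : ℝ => Real.exp (-(c * |x|))) (Ioi 0) := by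
    refine (exp_neg_integrableOn_Ioi 0 hc).congr_fun (fun x hx => ?_) measurableSet_Ioi
    simp only [abs_of_pos (mem_Ioi.1 hx), neg_mul]
  have h2 : IntegrableOn (fun x : ℝ => Real.exp (-(c * |x|))) (Iic 0) := by
    rw [← neg_zero] at h1
    simpa using (integrableOn_Iic_iff_integrableOn_Iio (by finiteness)).2 h1.comp_neg_Iio
  rw [← integrableOn_univ, ← Iic_union_Ioi (a := (0 : ℝ))]
  exact h2.union h1

/-- The weight of the energy estimate is integrable against an exponential. -/
lemma lintegral_rpow_mul_exp_lt_top {σ c : ℝ} (hσ : 0 < σ) (hc : 0 < c) :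
    ∫⁻ x : ℝ, ENNReal.ofReal ((1 + |x|) ^ σ * Real.exp (-(2 * c * |x|))) < ⊤ := by
  obtain ⟨K, hK, h⟩ := rpow_le_exp hσ hc
  refine lt_of_le_of_lt (lintegral_mono fun x => ENNReal.ofReal_le_ofReal
    (q := K * Real.exp (-(c * |x|))) ?_) ?_
  · calc (1 + |x|) ^ σ * Real.exp (-(2 * c * |x|)) ≤
        K * Real.exp (c * |x|) * Real.exp (-(2 * c * |x|)) := by
          gcongr
          exact h _ (abs_nonneg x)
      _ = _ := by
          rw [mul_assoc, ← Real.exp_add]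
          congr 2
          ring
  · exact ((integrable_exp_neg_mul_abs hc).const_mul K).lintegral_lt_top

lemma lorentz_le {v w : ℝ} (hv : |v| ≤ w) (hw : w < 1) : lorentz v ≤ lorentz w := by
  have h0 : 0 ≤ w := (abs_nonneg v).trans hv
  have h1 : v ^ 2 ≤ w ^ 2 := by rw [← sq_abs v]; gcongr
  have h2 : 0 < 1 - w ^ 2 := by nlinarith
  unfold lorentz
  gcongr

lemma one_le_lorentz {v : ℝ} (hv : |v| < 1) : 1 ≤ lorentz v := by
  have h1 : v ^ 2 < 1 := by
    rw [← sq_abs v]; nlinarith [abs_nonneg v]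
  refine (one_le_div (Real.sqrt_pos.2 (by linarith))).2 (Real.sqrt_le_one.2 ?_)
  nlinarith [sq_nonneg v]

lemma mollify_add {f' : ℝ → ℝ} (h : IsMollifier δ ρ) (hf : LocallyIntegrable f volume)
    (hf' : LocallyIntegrable f' volume) (x : ℝ) :
    mollify ρ (fun x => f x + f' x) x = mollify ρ f x + mollify ρ f' x := by
  unfold mollify
  simp_rw [add_mul]
  exact integral_add (integrable_mul_comp_sub hf h.smooth.continuous h.compact x)
    (integrable_mul_comp_sub hf' h.smooth.continuous h.compact x)

/-- Square of the weighted norm as an integral. -/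
lemma normL2_sq (α : ℝ) (f : ℝ → ℝ) :
    normL2 α f ^ 2 = ∫⁻ x, ENNReal.ofReal ((1 + |x|) ^ (2 * α) * f x ^ 2) := by
  rw [normL2, eLpNorm_two_sq]
  refine lintegral_congr fun x => ?_
  rw [weighted, mul_pow, ← Real.rpow_natCast ((1 + |x|) ^ α), ← Real.rpow_mul (by positivity)]
  congr 3
  push_cast
  ring

/-- Mollification is bounded in the weighted spaces with a translated weight. -/
lemma IsMollifier.lintegral_weighted_sq_le (h : IsMollifier δ ρ) (hδ : δ ≤ 1)
    (hf : LocallyIntegrable f volume) {α : ℝ} (hα : 0 ≤ α) (b₀ : ℝ) :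
    ∫⁻ x, ENNReal.ofReal ((1 + |x - b₀|) ^ (2 * α) *
      mollify ρ (fun x => f (x + -b₀)) x ^ 2) ≤
      ENNReal.ofReal (2 ^ (2 * α)) * normL2 α f ^ 2 := by
  have h1 := h.lintegral_sq_mollify_le (locallyIntegrable_comp_add hf (-b₀)).aestronglyMeasurable
    (W := fun x => ENNReal.ofReal ((1 + |x - b₀|) ^ (2 * α)))
    (W' := fun x => ENNReal.ofReal (2 ^ (2 * α)) * ENNReal.ofReal ((1 + |x - b₀|) ^ (2 * α)))
    (by fun_prop) (fun x y hxy => by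
      rw [← ENNReal.ofReal_mul (by positivity), ← Real.mul_rpow (by norm_num) (by positivity)]
      refine ENNReal.ofReal_le_ofReal ?_
      have : |x - b₀| ≤ |x - y| + |y - b₀| := abs_sub_le _ _ _
      have := abs_nonneg (y - b₀)
      gcongr
      linarith)
  rw [normL2_sq]
  rw [← lintegral_sub_right_eq_self (fun x => ENNReal.ofReal ((1 + |x|) ^ (2 * α) * f x ^ 2)) b₀,
    ← lintegral_const_mul' _ _ ENNReal.ofReal_ne_top]
  refine (le_of_eq ?_).trans (h1.trans (le_of_eq ?_))
  · refine lintegral_congr fun x => ?_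
    rw [ENNReal.ofReal_mul (by positivity)]
  · refine lintegral_congr fun x => ?_
    rw [mul_assoc, ← ENNReal.ofReal_mul (by positivity), sub_eq_add_neg]

/-- Bounds for the moving kinks, uniform in the velocity. -/
lemma IsKink.exists_psiV_decay (hU : ConditionU1 U a m) (hs : IsKink U a s) :
    ∃ C > 0, ∃ c > 0, ∀ v, |v| < 1 →
      (∀ z, |psiV s v z - a| ≤ C * Real.exp (-(c * z))) ∧
      (∀ z, |psiV s v z + a| ≤ C * Real.exp (c * z)) ∧
      ∀ z, |deriv (psiV s v) z| ≤ lorentz v * (C * Real.exp (-(c * |z|))) := by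
  obtain ⟨C, hC, c, hc, hCa, hr, hl, hd⟩ := hs.exists_decay hU
  refine ⟨C, hC, c, hc, fun v hv => ?_⟩
  -- Since `γ ≥ 1`, contraction only brings the kink closer to the wells, so its distance to them is
  -- controlled uniformly for all `|v| < 1`. Only the derivative costs a factor `γ`, and it is
  -- needed at time `0` alone.
  have hγ := one_le_lorentz hv
  have hlt : ∀ z, -a < psiV s v z ∧ psiV s v z < a := fun z =>
    ⟨hs.lt_left hU _, hs.lt_right hU _⟩
  refine ⟨fun z => ?_, fun z => ?_, fun z => ?_⟩
  · rcases le_total 0 z with h | h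
    · refine (hr _).trans ?_
      gcongr
      exact le_mul_of_one_le_left h hγ
    · have h2 : 1 ≤ Real.exp (-(c * z)) :=
        Real.one_le_exp (neg_nonneg.2 (mul_nonpos_of_nonneg_of_nonpos hc.le h))
      refine le_trans ?_ (le_mul_of_one_le_right hC.le h2)
      rw [abs_le]
      constructor <;> linarith [(hlt z).1, (hlt z).2]
  · rcases le_total z 0 with h | h
    · refine (hl _).trans ?_
      have : lorentz v * z ≤ z := by nlinarith
      gcongr
    · have h2 : 1 ≤ Real.exp (c * z) := Real.one_le_exp (by positivity)
      refine le_trans ?_ (le_mul_of_one_le_right hC.le h2)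
      rw [abs_le]
      constructor <;> linarith [(hlt z).1, (hlt z).2]
  · rw [deriv_psiV hs, abs_mul, abs_of_pos (by linarith)]
    refine mul_le_mul_of_nonneg_left ((hd _).trans ?_) (by linarith)
    have h2 : |z| ≤ |lorentz v * z| := by
      rw [abs_mul, abs_of_pos (by linarith : 0 < lorentz v)]
      exact le_mul_of_one_le_left (abs_nonneg _) hγ
    gcongr

/-- Moving by at most `1`, the largest mollification radius, costs a factor `exp c`. -/
lemma mul_exp_le_of_sub_le {C c u w : ℝ} (hC : 0 ≤ C) (hc : 0 ≤ c) (h : u - 1 ≤ w) :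
    C * Real.exp (-(c * w)) ≤ C * Real.exp c * Real.exp (-(c * u)) := by
  rw [mul_assoc, ← Real.exp_add]
  gcongr
  nlinarith

lemma sq_le_of_abs_le_mul {x y γ : ℝ} (h : |x| ≤ γ * y) : x ^ 2 ≤ γ ^ 2 * y ^ 2 := by
  rw [← sq_abs, ← mul_pow]
  gcongr

/-- Bounds for the mollified moving kinks, uniform in the velocity. -/
lemma IsKink.exists_mollify_psiV_decay (hU : ConditionU1 U a m) (hs : IsKink U a s) :
    ∃ C > 0, ∃ c > 0, ∀ v b₀, |v| < 1 → ∀ δ ρ, IsMollifier δ ρ → δ ≤ 1 → ∀ x,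
      (b₀ ≤ x → |mollify ρ (fun x => psiV s v (x + -b₀)) x - a| ≤
        C * Real.exp (-(c * |x - b₀|))) ∧
      (x ≤ b₀ → |mollify ρ (fun x => psiV s v (x + -b₀)) x + a| ≤
        C * Real.exp (-(c * |x - b₀|))) ∧
      |mollify ρ (fun x => deriv (psiV s v) (x + -b₀)) x| ≤
        lorentz v * (C * Real.exp (-(c * |x - b₀|))) ∧
      |mollify ρ (fun x => piV s v (x + -b₀)) x| ≤
        lorentz v * (C * Real.exp (-(c * |x - b₀|))) := by
  obtain ⟨C, hC, c, hc, H⟩ := hs.exists_psiV_decay hU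
  refine ⟨C * Real.exp c, by positivity, c, hc, fun v b₀ hv δ ρ hk hδ x => ?_⟩
  obtain ⟨hr, hl, hd⟩ := H v hv
  have hγ := one_le_lorentz hv
  have w0 : HasWeakDeriv (fun x => psiV s v (x + -b₀)) (fun x => deriv (psiV s v) (x + -b₀)) :=
    (hasWeakDeriv_psiV hs v).comp_add (-b₀)
  have lp : LocallyIntegrable (fun x => piV s v (x + -b₀)) volume :=
    locallyIntegrable_comp_add (continuous_piV hs v).locallyIntegrable _
  have hder : ∀ z, |x - z| ≤ δ → |deriv (psiV s v) (z + -b₀)| ≤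
      lorentz v * (C * Real.exp c * Real.exp (-(c * |x - b₀|))) := by
    intro z hz
    refine (hd _).trans (mul_le_mul_of_nonneg_left (mul_exp_le_of_sub_le hC.le hc.le ?_)
      (by linarith))
    rw [← sub_eq_add_neg]
    linarith [abs_sub_le x z b₀]
  refine ⟨fun hx => ?_, fun hx => ?_, ?_, ?_⟩
  · refine hk.abs_mollify_sub_le w0.1 (Eventually.of_forall fun z hz => ?_)
    have hz' := abs_le.1 (hz.trans hδ)
    refine (hr _).trans (mul_exp_le_of_sub_le hC.le hc.le ?_)
    rw [abs_of_nonneg (by linarith)]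
    linarith
  · rw [← sub_neg_eq_add]
    refine hk.abs_mollify_sub_le w0.1 (Eventually.of_forall fun z hz => ?_)
    have hz' := abs_le.1 (hz.trans hδ)
    have h1 := hl (z + -b₀)
    rw [← neg_neg (c * (z + -b₀)), ← mul_neg] at h1
    rw [sub_neg_eq_add]
    refine h1.trans (mul_exp_le_of_sub_le hC.le hc.le ?_)
    rw [abs_of_nonpos (by linarith)]
    linarith
  · have := hk.abs_mollify_sub_le w0.2.1 (x := x) (c := 0)
      (Eventually.of_forall fun z hz => by rw [sub_zero]; exact hder z hz)
    rwa [sub_zero] at this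
  · have := hk.abs_mollify_sub_le lp (x := x) (c := 0)
      (Eventually.of_forall fun z hz => by
        rw [sub_zero, piV, abs_mul, abs_neg]
        exact (mul_le_of_le_one_left (abs_nonneg _) hv.le).trans (hder z hz))
    rwa [sub_zero] at this

/-- Pointwise bound of the mollified energy density of a perturbed soliton. -/
lemma exists_mollifiedEnergy_le (hU : ConditionU1 U a m) (hs : IsKink U a s) {vbar : ℝ}
    (hvbar : vbar < 1) :
    ∃ c > 0, ∃ K, 0 ≤ K ∧ ∀ (Y : State) (b₀ v₀ : ℝ) (g : ℝ → ℝ), |v₀| ≤ vbar →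
      (∀ᵐ x, Y.1 x ∈ Icc (-(a + 1)) (a + 1)) → LocallyIntegrable Y.2 volume →
      HasWeakDeriv (perturbation s b₀ v₀ Y).1 g → ∀ n x,
      mollifiedEnergy U n Y x ≤ K * (Real.exp (-(2 * c * |x - b₀|)) +
        (mollify (kernel n) (fun x => (perturbation s b₀ v₀ Y).1 (x + -b₀)) x ^ 2 +
        mollify (kernel n) (fun x => g (x + -b₀)) x ^ 2 +
        mollify (kernel n) (fun x => (perturbation s b₀ v₀ Y).2 (x + -b₀)) x ^ 2)) := by
  obtain ⟨E, hE, c, hc, H⟩ := hs.exists_mollify_psiV_decay hU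
  obtain ⟨K, hK, hKU⟩ := hU.exists_upper (a + 1)
  have ha := hU.a_pos
  set γ := lorentz vbar with hγ
  refine ⟨c, hc, (2 * K + 2 * γ ^ 2) * E ^ 2 + (2 * K + 1), by positivity,
    fun Y b₀ v₀ g hv hY hY2 hg n x => ?_⟩
  have hk := isMollifier_kernel n
  have hδ : 1 / ((n : ℝ) + 1) ≤ 1 := by
    rw [div_le_one (by positivity)]; linarith [Nat.cast_nonneg (α := ℝ) n]
  have hv1 : |v₀| < 1 := hv.trans_lt hvbar
  have hγ2 := lorentz_le hv hvbar
  obtain ⟨hA₁, hA₂, hB, hD⟩ := H v₀ b₀ hv1 _ _ hk hδ x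
  have w0 : HasWeakDeriv (fun x => psiV s v₀ (x + -b₀)) (fun x => deriv (psiV s v₀) (x + -b₀)) :=
    (hasWeakDeriv_psiV hs v₀).comp_add (-b₀)
  have w1 := hg.comp_add (-b₀)
  have hw : HasWeakDeriv Y.1 (fun x => deriv (psiV s v₀) (x + -b₀) + g (x + -b₀)) := by
    have := w0.add w1
    convert this using 1
    ext x
    simp [perturbation]
  have lp : LocallyIntegrable (fun x => piV s v₀ (x + -b₀)) volume :=
    locallyIntegrable_comp_add (continuous_piV hs v₀).locallyIntegrable _
  have lΘ : LocallyIntegrable (fun x => (perturbation s b₀ v₀ Y).2 (x + -b₀)) volume := by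
    have := hY2.sub lp
    convert this using 1
    ext x
    simp [perturbation]
  have e1 : mollify (kernel n) Y.1 x = mollify (kernel n) (fun x => psiV s v₀ (x + -b₀)) x +
      mollify (kernel n) (fun x => (perturbation s b₀ v₀ Y).1 (x + -b₀)) x := by
    rw [← mollify_add hk w0.1 w1.1]
    congr 1
    ext x
    simp [perturbation]
  have e2 : mollify (deriv (kernel n)) Y.1 x =
      mollify (kernel n) (fun x => deriv (psiV s v₀) (x + -b₀)) x +
      mollify (kernel n) (fun x => g (x + -b₀)) x := by
    rw [hw.mollify_deriv hk.smooth hk.compact, mollify_add hk w0.2.1 w1.2.1]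
  have e3 : mollify (kernel n) Y.2 x = mollify (kernel n) (fun x => piV s v₀ (x + -b₀)) x +
      mollify (kernel n) (fun x => (perturbation s b₀ v₀ Y).2 (x + -b₀)) x := by
    rw [← mollify_add hk lp lΘ]
    congr 1
    ext x
    simp [perturbation]
  have hq : |mollify (kernel n) Y.1 x| ≤ a + 1 := abs_le.2 (hk.mollify_mem hw.1 hY x)
  have hUq := hKU _ hq
  unfold mollifiedEnergy energyDensity
  rw [e1] at hUq ⊢
  rw [e2, e3]
  have hX2 : Real.exp (-(2 * c * |x - b₀|)) = Real.exp (-(c * |x - b₀|)) ^ 2 := by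
    rw [sq, ← Real.exp_add]; congr 1; ring
  rw [hX2]
  have hX := Real.exp_pos (-(c * |x - b₀|))
  generalize Real.exp (-(c * |x - b₀|)) = X at *
  generalize mollify (kernel n) (fun x => (perturbation s b₀ v₀ Y).1 (x + -b₀)) x = P at *
  generalize mollify (kernel n) (fun x => g (x + -b₀)) x = G at *
  generalize mollify (kernel n) (fun x => (perturbation s b₀ v₀ Y).2 (x + -b₀)) x = Q at *
  generalize mollify (kernel n) (fun x => psiV s v₀ (x + -b₀)) x = A at *
  generalize mollify (kernel n) (fun x => deriv (psiV s v₀) (x + -b₀)) x = B at *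
  generalize mollify (kernel n) (fun x => piV s v₀ (x + -b₀)) x = D at *
  have hB' : B ^ 2 ≤ γ ^ 2 * (E * X) ^ 2 := sq_le_of_abs_le_mul (hB.trans (by gcongr))
  have hD' : D ^ 2 ≤ γ ^ 2 * (E * X) ^ 2 := sq_le_of_abs_le_mul (hD.trans (by gcongr))
  -- Here `θ` is the well which the kink approaches on the side of `b₀` where `x` lies; the
  -- potential is bounded by the squared distance to either well.
  have key : ∀ θ : ℝ, U (A + P) ≤ K * (A + P - θ) ^ 2 → |A - θ| ≤ E * X →
      U (A + P) ≤ 2 * K * (E * X) ^ 2 + 2 * K * P ^ 2 := by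
    intro θ h1 h2
    have h3 : (A - θ) ^ 2 ≤ (E * X) ^ 2 := by rw [← sq_abs (A - θ)]; gcongr
    have h4 : (A + P - θ) ^ 2 ≤ 2 * (E * X) ^ 2 + 2 * P ^ 2 := by
      nlinarith [sq_nonneg (A - θ - P)]
    calc U (A + P) ≤ K * (A + P - θ) ^ 2 := h1
      _ ≤ K * (2 * (E * X) ^ 2 + 2 * P ^ 2) := by gcongr
      _ = _ := by ring
  have hUq' : U (A + P) ≤ 2 * K * (E * X) ^ 2 + 2 * K * P ^ 2 := by
    rcases le_total b₀ x with hx | hx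
    · exact key a hUq.1 (hA₁ hx)
    · exact key (-a) (by rw [sub_neg_eq_add]; exact hUq.2) (by rw [sub_neg_eq_add]; exact hA₂ hx)
  have f1 : (D + Q) ^ 2 / 2 ≤ D ^ 2 + Q ^ 2 := by linarith [sq_nonneg (D - Q)]
  have f2 : (B + G) ^ 2 / 2 ≤ B ^ 2 + G ^ 2 := by linarith [sq_nonneg (B - G)]
  have f3 : 0 ≤ (2 * K + 2 * γ ^ 2) * E ^ 2 * (P ^ 2 + G ^ 2 + Q ^ 2) := by positivity
  have f4 : 0 ≤ (2 * K + 1) * X ^ 2 + 2 * K * (G ^ 2 + Q ^ 2) + P ^ 2 := by positivity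
  linarith

/-- The weighted mollified energies of a perturbed soliton are bounded. -/
lemma exists_initial_energy_bound (hU : ConditionU1 U a m) (hs : IsKink U a s) {vbar : ℝ}
    (hvbar : vbar < 1) {α : ℝ} (hα : 0 < α) {d₀ : ℝ} (hd₀ : 0 ≤ d₀) :
    ∃ E : ℝ, 0 ≤ E ∧ ∀ (Y : State) (b₀ v₀ : ℝ), |v₀| ≤ vbar →
      (∀ᵐ x, Y.1 x ∈ Icc (-(a + 1)) (a + 1)) →
      LocallyIntegrable Y.2 volume →
      normE α (perturbation s b₀ v₀ Y) ≤ ENNReal.ofReal d₀ →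
      ∀ n, ∫⁻ x, ENNReal.ofReal (growth (2 * α) (radius b₀ x) * mollifiedEnergy U n Y x) ≤
        ENNReal.ofReal E := by
  obtain ⟨c, hc, K, hK, hKe⟩ := exists_mollifiedEnergy_le hU hs hvbar
  have hI := lintegral_rpow_mul_exp_lt_top (σ := 2 * α) (by linarith) hc
  set I := ∫⁻ x : ℝ, ENNReal.ofReal ((1 + |x|) ^ (2 * α) * Real.exp (-(2 * c * |x|))) with hIdef
  set L : ℝ := (1 + 4 ^ (2 * α)) * K with hL
  have hL0 : 0 ≤ L := by positivity
  -- The norm of `E_α` contains an infimum over weak derivatives; with `d₀ + 1` in place of `d₀` an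
  -- explicit one can be chosen. The factor `2 ^ (2 * α)` is the change of the weight over a
  -- mollification radius.
  set S : ℝ := 2 ^ (2 * α) * (d₀ + 1) ^ 2 with hS
  have hS0 : 0 ≤ S := by positivity
  refine ⟨L * (I.toReal + (S + S + S)), by positivity,
    fun Y b₀ v₀ hv hY hY2 hX n => ?_⟩
  have hlt : (⨅ (g : ℝ → ℝ) (_ : HasWeakDeriv (perturbation s b₀ v₀ Y).1 g), normL2 α g) <
      ENNReal.ofReal (d₀ + 1) := by
    refine lt_of_le_of_lt (le_trans ?_ hX)
      ((ENNReal.ofReal_lt_ofReal_iff (by linarith)).2 (lt_add_one d₀))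
    exact le_add_self.trans le_self_add
  simp only [iInf_lt_iff] at hlt
  obtain ⟨g, hg, hgd⟩ := hlt
  have hΨd : normL2 α (perturbation s b₀ v₀ Y).1 ≤ ENNReal.ofReal (d₀ + 1) :=
    (le_self_add.trans le_self_add).trans (hX.trans (ENNReal.ofReal_le_ofReal (by linarith)))
  have hΘd : normL2 α (perturbation s b₀ v₀ Y).2 ≤ ENNReal.ofReal (d₀ + 1) :=
    le_add_self.trans (hX.trans (ENNReal.ofReal_le_ofReal (by linarith)))
  have lΘ : LocallyIntegrable (perturbation s b₀ v₀ Y).2 volume :=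
    (locallyIntegrable_comp_add hY2 b₀).sub (continuous_piV hs v₀).locallyIntegrable
  have hk := isMollifier_kernel n
  have hδ : 1 / ((n : ℝ) + 1) ≤ 1 := by
    rw [div_le_one (by positivity)]; linarith [Nat.cast_nonneg (α := ℝ) n]
  have bd : ∀ h : ℝ → ℝ, LocallyIntegrable h volume → normL2 α h ≤ ENNReal.ofReal (d₀ + 1) →
      ∫⁻ x, ENNReal.ofReal ((1 + |x - b₀|) ^ (2 * α) *
        mollify (kernel n) (fun x => h (x + -b₀)) x ^ 2) ≤ ENNReal.ofReal S := by
    intro h hh hd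
    refine (hk.lintegral_weighted_sq_le hδ hh hα.le b₀).trans ?_
    rw [hS, ENNReal.ofReal_mul (by positivity), ENNReal.ofReal_pow (by linarith)]
    gcongr
  have meas : ∀ h : ℝ → ℝ, LocallyIntegrable h volume →
      Measurable fun x => ENNReal.ofReal ((1 + |x - b₀|) ^ (2 * α) *
        mollify (kernel n) (fun x => h (x + -b₀)) x ^ 2) := by
    intro h hh
    have := (continuous_mollify (locallyIntegrable_comp_add hh (-b₀)) hk.smooth
      hk.compact).measurable
    fun_prop
  have b1 := bd _ hg.1 hΨd
  have b2 := bd _ hg.2.1 hgd.le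
  have b3 := bd _ lΘ hΘd
  have b0 : ∫⁻ x, ENNReal.ofReal ((1 + |x - b₀|) ^ (2 * α) *
      Real.exp (-(2 * c * |x - b₀|))) = I :=
    lintegral_sub_right_eq_self (fun x => ENNReal.ofReal ((1 + |x|) ^ (2 * α) *
      Real.exp (-(2 * c * |x|)))) b₀
  have m1 := meas _ hg.1
  have m2 := meas _ hg.2.1
  set P := mollify (kernel n) (fun x => (perturbation s b₀ v₀ Y).1 (x + -b₀))
  set G := mollify (kernel n) (fun x => g (x + -b₀))
  set Q := mollify (kernel n) (fun x => (perturbation s b₀ v₀ Y).2 (x + -b₀))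
  set w : ℝ → ℝ := fun x => (1 + |x - b₀|) ^ (2 * α)
  have hw : ∀ x, 0 ≤ w x := fun x => by positivity
  calc ∫⁻ x, ENNReal.ofReal (growth (2 * α) (radius b₀ x) * mollifiedEnergy U n Y x)
      ≤ ∫⁻ x, ENNReal.ofReal L * (ENNReal.ofReal (w x * Real.exp (-(2 * c * |x - b₀|))) +
        (ENNReal.ofReal (w x * P x ^ 2) + ENNReal.ofReal (w x * G x ^ 2) +
        ENNReal.ofReal (w x * Q x ^ 2))) := by
        refine lintegral_mono fun x => ?_
        have h0 := hw x
        rw [← ENNReal.ofReal_add (by positivity) (by positivity),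
          ← ENNReal.ofReal_add (by positivity) (by positivity),
          ← ENNReal.ofReal_add (by positivity) (by positivity), ← ENNReal.ofReal_mul hL0]
        refine ENNReal.ofReal_le_ofReal ?_
        have h1 := hKe Y b₀ v₀ g hv hY hY2 hg n x
        have h2 := growth_radius_le (σ := 2 * α) (by linarith) b₀ x
        have h3 : 0 ≤ growth (2 * α) (radius b₀ x) := zero_le_one.trans (one_le_growth _ _)
        refine (mul_le_mul_of_nonneg_left h1 h3).trans ?_
        refine (mul_le_mul_of_nonneg_right h2 (by positivity)).trans (le_of_eq ?_)
        simp only [hL, w, P, G, Q]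
        ring
    _ = ENNReal.ofReal L * (I + (∫⁻ x, ENNReal.ofReal (w x * P x ^ 2)) +
        (∫⁻ x, ENNReal.ofReal (w x * G x ^ 2)) + ∫⁻ x, ENNReal.ofReal (w x * Q x ^ 2)) := by
        rw [lintegral_const_mul' _ _ ENNReal.ofReal_ne_top, lintegral_add_left (by fun_prop),
          lintegral_add_left (f := fun x => ENNReal.ofReal (w x * P x ^ 2) +
            ENNReal.ofReal (w x * G x ^ 2)) (m1.add m2), lintegral_add_left m1, b0]
        ring
    _ ≤ ENNReal.ofReal L * (I + ENNReal.ofReal S + ENNReal.ofReal S + ENNReal.ofReal S) := by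
        gcongr
    _ = _ := by
        rw [ENNReal.ofReal_mul hL0, ENNReal.ofReal_add ENNReal.toReal_nonneg (by positivity),
          ENNReal.ofReal_add (by positivity) hS0, ENNReal.ofReal_add hS0 hS0,
          ENNReal.ofReal_toReal hI.ne]
        ring

end InitialEnergy

/-! ### The kink centre stays near the light cone -/

section Centre

variable {U s : ℝ → ℝ} {a m : ℝ} {f g : ℝ → ℝ}

/-- The trace inequality on an interval of unit length. -/
lemma sq_sub_le_lintegral {G : ℝ → ℝ} {c : ℝ} (hf : LocallyIntegrable f volume)
    (hg : LocallyIntegrable g volume) (hG : G = fun x => c + ∫ y in (0 : ℝ)..x, g y)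
    (hfG : f =ᵐ[volume] G) (θ : ℝ) {p x₀ : ℝ} (hx₀ : x₀ ∈ Icc p (p + 1)) :
    ENNReal.ofReal ((G x₀ - θ) ^ 2) ≤
      2 * ∫⁻ x in Icc p (p + 1), ENNReal.ofReal ((f x - θ) ^ 2 + g x ^ 2) := by
  have hmf := hf.aestronglyMeasurable.aemeasurable.restrict (s := Icc p (p + 1))
  have hmg := hg.aestronglyMeasurable.aemeasurable.restrict (s := Icc p (p + 1))
  have hsplit : ∫⁻ x in Icc p (p + 1), ENNReal.ofReal ((f x - θ) ^ 2 + g x ^ 2) =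
      (∫⁻ x in Icc p (p + 1), ENNReal.ofReal ((f x - θ) ^ 2)) +
      eLpNorm g 2 (volume.restrict (Icc p (p + 1))) ^ 2 := by
    rw [eLpNorm_two_sq, ← lintegral_add_left' (by fun_prop)]
    refine lintegral_congr fun x => ?_
    rw [ENNReal.ofReal_add (by positivity) (by positivity)]
  rcases eq_or_ne (eLpNorm g 2 (volume.restrict (Icc p (p + 1)))) ⊤ with h | h
  · rw [hsplit, h]
    simp
  set N := (eLpNorm g 2 (volume.restrict (Icc p (p + 1)))).toReal with hN
  have hN0 : 0 ≤ N := ENNReal.toReal_nonneg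
  have hNe : eLpNorm g 2 (volume.restrict (Icc p (p + 1))) = ENNReal.ofReal N :=
    (ENNReal.ofReal_toReal h).symm
  have hvol : volume (Icc p (p + 1)) = 1 := by rw [Real.volume_Icc]; simp
  calc ENNReal.ofReal ((G x₀ - θ) ^ 2)
      = ∫⁻ x in Icc p (p + 1), ENNReal.ofReal ((G x₀ - θ) ^ 2) := by
        rw [setLIntegral_const, hvol, mul_one]
    _ ≤ ∫⁻ x in Icc p (p + 1), 2 * (ENNReal.ofReal ((f x - θ) ^ 2) + ENNReal.ofReal (N ^ 2)) := by
        refine lintegral_mono_ae ?_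
        filter_upwards [ae_restrict_of_ae hfG, ae_restrict_mem measurableSet_Icc] with x hx hxI
        rw [← ENNReal.ofReal_add (by positivity) (by positivity),
          ← ENNReal.ofReal_ofNat 2, ← ENNReal.ofReal_mul (by norm_num)]
        refine ENNReal.ofReal_le_ofReal ?_
        have h1 := abs_primitive_sub_le hN0 hg hNe.le hx₀ hxI
        have h2 : √|x₀ - x| ≤ 1 := by
          refine Real.sqrt_le_one.2 (abs_le.2 ⟨?_, ?_⟩) <;> linarith [hx₀.1, hx₀.2, hxI.1, hxI.2]
        have h3 : |G x₀ - G x| ≤ N := by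
          have e : G x₀ - G x = (∫ z in (0 : ℝ)..x₀, g z) - ∫ z in (0 : ℝ)..x, g z := by
            rw [hG]; ring
          rw [e]
          exact h1.trans (mul_le_of_le_one_right hN0 h2)
        have h4 : (G x₀ - G x) ^ 2 ≤ N ^ 2 := by
          rw [← sq_abs]; gcongr
        rw [hx]
        -- `(G x₀ - θ)² ≤ 2 (G x - θ)² + 2 N²`, which is integrated in `x` over the unit interval.
        nlinarith [sq_nonneg ((G x₀ - G x) - (G x - θ))]
    _ = 2 * ∫⁻ x in Icc p (p + 1), ENNReal.ofReal ((f x - θ) ^ 2 + g x ^ 2) := by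
        rw [lintegral_const_mul' _ _ (by norm_num), hsplit, hNe, lintegral_add_right _ (by fun_prop),
          setLIntegral_const, hvol, mul_one, ENNReal.ofReal_pow hN0]

lemma ae_le_of_continuous {h : ℝ → ℝ} {C : ℝ} (hh : Continuous h) (hae : ∀ᵐ x, h x ≤ C)
    (x : ℝ) : h x ≤ C := by
  by_contra hx
  push Not at hx
  have ho : IsOpen {x | C < h x} := isOpen_lt continuous_const hh
  have h0 : volume {x | C < h x} = 0 := by
    have : {x | C < h x} = {x | ¬ h x ≤ C} := by ext; simp
    rw [this]
    exact hae
  have h1 := (ho.measure_eq_zero_iff volume).1 h0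
  exact (h1 ▸ (show x ∈ {x | C < h x} from hx) : x ∈ (∅ : Set ℝ))

/-- The kink centre moves at most with the speed of light, up to a constant: if it were outside the
light cone, too much energy would have been carried outside. -/
lemma abs_sub_centre_le {σ R E c₁ η t b b₀ v ε : ℝ} {Y : State} (hU : ConditionU1 U a m)
    (hs : IsKink U a s) (hσ : 0 < σ) (hR : 0 ≤ R) (hE₀ : 0 ≤ E) (hη : 0 < η) (hηs : |s 0| + 2 * η ≤ a)
    (hεη : ε ≤ η) (hv : |v| < 1) (hc₁ : 0 < c₁)
    (hlow₁ : ∀ ψ ∈ Icc (-a + η) (a + ε), c₁ * (ψ - a) ^ 2 ≤ U ψ)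
    (hlow₂ : ∀ ψ ∈ Icc (-a - ε) (a - η), c₁ * (ψ + a) ^ 2 ≤ U ψ)
    (hYm : LocallyIntegrable Y.1 volume)
    (hpert : ∀ᵐ x, |Y.1 x - psiV s v (x - b)| ≤ ε)
    (hg : HasWeakDeriv Y.1 g)
    (hE : ∫⁻ x, ENNReal.ofReal (growth σ (radius b₀ x - t) *
      energyDensity U (Y.1 x) (g x) (Y.2 x)) ≤ ENNReal.ofReal E)
    (hRE : 2 * E < R ^ σ * (min c₁ (1 / 2) * η ^ 2)) : |b - b₀| ≤ R + t := by
  obtain ⟨c, hc⟩ := hg.exists_ae_eq_primitive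
  set G := fun x => c + ∫ y in (0 : ℝ)..x, g y with hG
  have hGc : Continuous G := continuous_const.add (intervalIntegral.continuous_primitive
    (fun a b => (hg.2.1.integrableOn_isCompact isCompact_uIcc).intervalIntegrable) 0)
  have hψc : Continuous (psiV s v) :=
    continuous_iff_continuousAt.2 fun x => (hasDerivAt_psiV hs v x).continuousAt
  have hGb : |G b - s 0| ≤ ε := by
    -- The continuous representative makes the value at the single point `b` meaningful: it is
    -- within `ε` of `ψ_v(0) = s 0`, hence at least `2η - ε ≥ η` away from each well.
    have h1 := ae_le_of_continuous (h := fun x => |G x - psiV s v (x - b)|) (C := ε)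
      (by fun_prop) (by filter_upwards [hpert, hc] with x h1 h2; rwa [← h2]) b
    simpa [psiV] using h1
  have hmono := (hs.strictMono hU).monotone
  have hγ := one_le_lorentz hv
  set c₂ := min c₁ (1 / 2) with hc₂
  have hc₂0 : 0 < c₂ := by positivity
  have hs0 := abs_le.1 (show |s 0| ≤ a - 2 * η by linarith)
  have hE0 : 0 ≤ R ^ σ * c₂ := by positivity
  -- On a unit interval containing `b` the trace inequality forces energy at least `c₂ η² / 2`. If
  -- the interval lies at distance `R` outside the cone, the weight there is at least `R ^ σ`, and
  -- the choice of `R` is contradicted.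
  have key : ∀ p θ : ℝ, b ∈ Icc p (p + 1) → η ^ 2 ≤ (G b - θ) ^ 2 →
      (∀ᵐ x, x ∈ Icc p (p + 1) → c₁ * (Y.1 x - θ) ^ 2 ≤ U (Y.1 x)) →
      (∀ x ∈ Icc p (p + 1), R ≤ |x - b₀| - t) → False := by
    intro p θ hb hηG hUc hfar
    have h1 := sq_sub_le_lintegral hYm hg.2.1 hG hc θ hb
    have h2 : ENNReal.ofReal (R ^ σ * c₂) *
        ∫⁻ x in Icc p (p + 1), ENNReal.ofReal ((Y.1 x - θ) ^ 2 + g x ^ 2) ≤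
        ENNReal.ofReal E := by
      rw [← lintegral_const_mul' _ _ ENNReal.ofReal_ne_top]
      refine le_trans ?_ ((setLIntegral_le_lintegral (Icc p (p + 1)) _).trans hE)
      refine lintegral_mono_ae ?_
      filter_upwards [ae_restrict_of_ae hUc, ae_restrict_mem measurableSet_Icc] with x hx hxI
      rw [← ENNReal.ofReal_mul hE0]
      refine ENNReal.ofReal_le_ofReal ?_
      have e1 : R ^ σ ≤ growth σ (radius b₀ x - t) := by
        have h3 := hfar x hxI
        have h4 := abs_sub_le_radius b₀ x
        have h5 : R ≤ max (radius b₀ x - t) 0 := le_max_of_le_left (by linarith)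
        have h6 : R ^ σ ≤ max (radius b₀ x - t) 0 ^ σ := by gcongr
        linarith [le_growth (z := radius b₀ x - t) hσ.le]
      have e2 : c₂ * ((Y.1 x - θ) ^ 2 + g x ^ 2) ≤ energyDensity U (Y.1 x) (g x) (Y.2 x) := by
        have h3 : c₂ * (Y.1 x - θ) ^ 2 ≤ c₁ * (Y.1 x - θ) ^ 2 := by
          gcongr; exact min_le_left _ _
        have h4 : c₂ * g x ^ 2 ≤ 1 / 2 * g x ^ 2 := by
          gcongr; exact min_le_right _ _
        have h5 := hx hxI
        unfold energyDensity
        linarith [sq_nonneg (Y.2 x)]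
      rw [mul_assoc]
      exact mul_le_mul e1 e2 (by positivity) (zero_le_one.trans (one_le_growth _ _))
    have h3 : ENNReal.ofReal (R ^ σ * c₂ * η ^ 2) ≤ ENNReal.ofReal (2 * E) := by
      rw [ENNReal.ofReal_mul hE0, ENNReal.ofReal_mul (by norm_num : (0 : ℝ) ≤ 2),
        ENNReal.ofReal_ofNat]
      calc _ ≤ ENNReal.ofReal (R ^ σ * c₂) * (2 * ∫⁻ x in Icc p (p + 1),
            ENNReal.ofReal ((Y.1 x - θ) ^ 2 + g x ^ 2)) := by
            gcongr
            exact (ENNReal.ofReal_le_ofReal hηG).trans h1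
        _ = 2 * (ENNReal.ofReal (R ^ σ * c₂) * ∫⁻ x in Icc p (p + 1),
            ENNReal.ofReal ((Y.1 x - θ) ^ 2 + g x ^ 2)) := by ring
        _ ≤ _ := by gcongr
    have h5 := (ENNReal.ofReal_le_ofReal_iff (by positivity)).1 h3
    linarith
  by_contra hcon
  push Not at hcon
  have hGb' := abs_le.1 hGb
  -- The interval is taken on the side of `b` away from `b₀`: it is then entirely outside the cone,
  -- and the kink lies on one side of `s 0`, so `U` controls the distance to one well.
  rcases lt_abs.1 hcon with h | h
  · refine key b a ⟨le_rfl, by linarith⟩ ?_ ?_ ?_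
    · have : η ≤ a - G b := by linarith
      nlinarith
    · filter_upwards [hpert] with x hx hxI
      have hx' := abs_le.1 hx
      have h1 : s 0 ≤ psiV s v (x - b) := hmono (mul_nonneg (by linarith) (by linarith [hxI.1]))
      have h2 : psiV s v (x - b) < a := hs.lt_right hU _
      exact hlow₁ _ ⟨by linarith, by linarith⟩
    · intro x hx
      linarith [le_abs_self (x - b₀), hx.1]
  · refine key (b - 1) (-a) ⟨by linarith, by linarith⟩ ?_ ?_ ?_
    · have : η ≤ G b - -a := by linarith
      nlinarith
    · filter_upwards [hpert] with x hx hxI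
      have hx' := abs_le.1 hx
      have h1 : psiV s v (x - b) ≤ s 0 :=
        hmono (mul_nonpos_of_nonneg_of_nonpos (by linarith) (by linarith [hxI.2]))
      have h2 : -a < psiV s v (x - b) := hs.lt_left hU _
      rw [sub_neg_eq_add]
      exact hlow₂ _ ⟨by linarith, by linarith⟩
    · intro x hx
      linarith [neg_le_abs (x - b₀), hx.2]

end Centre

/-! ### From the weighted energy to the perturbation -/

section Final

variable {U s : ℝ → ℝ} {a m : ℝ}

/-- The second majorant controls the perturbation almost everywhere. -/
lemma ae_abs_le_of_majorant₂ {ε t : ℝ} (hε : 0 ≤ ε) {b v : ℝ → ℝ} {Y : ℝ → State}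
    (h : majorant₂ (fun t => perturbation s (b t) (v t) (Y t)) t < ENNReal.ofReal ε)
    {r : ℝ} (hr : r ∈ Icc 0 t) :
    ∀ᵐ x, |(Y r).1 x - psiV s (v r) (x - b r)| ≤ ε := by
  set Ψ := (perturbation s (b r) (v r) (Y r)).1 with hΨ
  have h1 : ENNReal.ofReal ((1 + r) ^ (1 / 2 : ℝ)) * eLpNorm Ψ ⊤ volume ≤ ENNReal.ofReal ε :=
    (le_iSup₂ (f := fun r (_ : r ∈ Icc 0 t) => ENNReal.ofReal ((1 + r) ^ (1 / 2 : ℝ)) *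
      eLpNorm (perturbation s (b r) (v r) (Y r)).1 ⊤ volume) r hr).trans h.le
  -- The time weight in the majorant is at least one, so it can be dropped.
  have h2 : 1 ≤ ENNReal.ofReal ((1 + r) ^ (1 / 2 : ℝ)) := by
    rw [ENNReal.one_le_ofReal]
    exact Real.one_le_rpow (by linarith [hr.1]) (by norm_num)
  have h3 : eLpNormEssSup Ψ volume ≤ ENNReal.ofReal ε := by
    rw [← eLpNorm_exponent_top]
    exact (le_mul_of_one_le_left zero_le h2).trans h1
  have h4 : ∀ᵐ y, |Ψ y| ≤ ε := by
    filter_upwards [ae_le_eLpNormEssSup (f := Ψ) (μ := volume)] with y hy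
    have := hy.trans h3
    rw [← ofReal_norm, ENNReal.ofReal_le_ofReal_iff hε] at this
    exact this
  filter_upwards [(measurePreserving_sub_right volume (b r)).quasiMeasurePreserving.ae h4]
    with x hx
  simpa [hΨ, perturbation] using hx

/-- With `z` the positive part of `radius - t`, the distance from `x` to `b` is at most `R + 2t +
z`: one `t` comes from the motion of the centre and one from the cone. This is the only source of
growth in time. -/
lemma weight_le_growth {σ b b₀ R t x : ℝ} (hσ : 0 ≤ σ) (hR : 0 ≤ R) (ht : 0 ≤ t)
    (hb : |b - b₀| ≤ R + t) :
    (1 + |x - b|) ^ σ ≤ 2 ^ σ * (1 + R + 2 * t) ^ σ * growth σ (radius b₀ x - t) := by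
  set z := max (radius b₀ x - t) 0 with hz
  have hz0 : 0 ≤ z := le_max_right _ _
  have h1 : |x - b| ≤ |x - b₀| + |b - b₀| := by
    rw [abs_sub_comm b b₀]; exact abs_sub_le _ _ _
  have h2 : radius b₀ x ≤ t + z := by linarith [le_max_left (radius b₀ x - t) 0]
  have h3 := abs_sub_le_radius b₀ x
  have h4 : 1 + |x - b| ≤ (1 + R + 2 * t) * (1 + z) := by
    nlinarith [mul_nonneg hR hz0, mul_nonneg ht hz0]
  have h5 : (1 + z) ^ σ ≤ 2 ^ σ * (1 + z ^ σ) := by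
    rcases le_total z 1 with h | h
    · calc (1 + z) ^ σ ≤ 2 ^ σ := by gcongr; linarith
        _ ≤ _ := le_mul_of_one_le_right (by positivity) (le_add_of_nonneg_right (by positivity))
    · calc (1 + z) ^ σ ≤ (2 * z) ^ σ := by gcongr; linarith
        _ = 2 ^ σ * z ^ σ := Real.mul_rpow (by norm_num) hz0
        _ ≤ _ := by gcongr; linarith
  calc (1 + |x - b|) ^ σ ≤ ((1 + R + 2 * t) * (1 + z)) ^ σ := by gcongr
    _ = (1 + R + 2 * t) ^ σ * (1 + z) ^ σ := Real.mul_rpow (by positivity) (by positivity)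
    _ ≤ (1 + R + 2 * t) ^ σ * (2 ^ σ * growth σ (radius b₀ x - t)) := by
        gcongr
        refine h5.trans ?_
        gcongr
        exact le_growth hσ
    _ = _ := by ring

/-- The weighted norm of the perturbation in terms of the weighted energy. -/
lemma normL2_perturbation_sq_le {α c C E c₁ η ε R t b b₀ v : ℝ} {Y : State} {g : ℝ → ℝ}
    (hU : ConditionU1 U a m) (hs : IsKink U a s) (hα : 0 < α)
    (hR : 0 ≤ R) (ht : 0 ≤ t) (hE₀ : 0 ≤ E)
    (hηs : |s 0| + 2 * η ≤ a) (hεη : ε ≤ η) (hv : |v| < 1) (hc₁ : 0 < c₁)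
    (hlow₁ : ∀ ψ ∈ Icc (-a + η) (a + ε), c₁ * (ψ - a) ^ 2 ≤ U ψ)
    (hlow₂ : ∀ ψ ∈ Icc (-a - ε) (a - η), c₁ * (ψ + a) ^ 2 ≤ U ψ)
    (hr : ∀ z, |psiV s v z - a| ≤ C * Real.exp (-(c * z)))
    (hl : ∀ z, |psiV s v z + a| ≤ C * Real.exp (c * z))
    (hpert : ∀ᵐ x, |Y.1 x - psiV s v (x - b)| ≤ ε)
    (hE : ∫⁻ x, ENNReal.ofReal (growth (2 * α) (radius b₀ x - t) *
      energyDensity U (Y.1 x) (g x) (Y.2 x)) ≤ ENNReal.ofReal E)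
    (hb : |b - b₀| ≤ R + t) {I : ℝ} (hI₀ : 0 ≤ I)
    (hI : ∫⁻ x : ℝ, ENNReal.ofReal ((1 + |x|) ^ (2 * α) * Real.exp (-(2 * c * |x|))) ≤
      ENNReal.ofReal I) :
    normL2 α (perturbation s b v Y).1 ^ 2 ≤ ENNReal.ofReal
      (2 * C ^ 2 * I + 2 / c₁ * (2 ^ (2 * α) * (1 + R + 2 * t) ^ (2 * α)) * E) := by
  rw [normL2_sq, ← lintegral_sub_right_eq_self (fun y => ENNReal.ofReal
    ((1 + |y|) ^ (2 * α) * (perturbation s b v Y).1 y ^ 2)) b]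
  set B := 2 / c₁ * (2 ^ (2 * α) * (1 + R + 2 * t) ^ (2 * α)) with hB
  have hB0 : 0 ≤ B := by positivity
  have hmono := (hs.strictMono hU).monotone
  have hγ := one_le_lorentz hv
  have hs0 := abs_le.1 (show |s 0| ≤ a - 2 * η by linarith)
  calc _ ≤ ∫⁻ x, (ENNReal.ofReal (2 * C ^ 2) * ENNReal.ofReal ((1 + |x - b|) ^ (2 * α) *
        Real.exp (-(2 * c * |x - b|))) + ENNReal.ofReal B * ENNReal.ofReal
        (growth (2 * α) (radius b₀ x - t) * energyDensity U (Y.1 x) (g x) (Y.2 x))) := by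
        refine lintegral_mono_ae ?_
        filter_upwards [hpert] with x hx
        have hx' := abs_le.1 hx
        have hψ₁ : -a < psiV s v (x - b) := hs.lt_left hU _
        have hψ₂ : psiV s v (x - b) < a := hs.lt_right hU _
        have e1 : (perturbation s b v Y).1 (x - b) = Y.1 x - psiV s v (x - b) := by
          simp [perturbation]
        rw [e1]
        set X := Real.exp (-(c * |x - b|)) with hX
        have hX2 : Real.exp (-(2 * c * |x - b|)) = X ^ 2 := by
          rw [hX, sq, ← Real.exp_add]; congr 1; ring
        -- Field and kink are both compared with the well `θ` on the side of `b` where `x` lies: the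
        -- distance of the field is paid by `U`, that of the kink by its decay.
        have key : ∀ θ, |psiV s v (x - b) - θ| ≤ C * X → c₁ * (Y.1 x - θ) ^ 2 ≤ U (Y.1 x) →
            (Y.1 x - psiV s v (x - b)) ^ 2 ≤ 2 * C ^ 2 * X ^ 2 + 2 / c₁ * U (Y.1 x) := by
          intro θ h1 h2
          have h3 : (psiV s v (x - b) - θ) ^ 2 ≤ C ^ 2 * X ^ 2 := sq_le_of_abs_le_mul h1
          have h4 : (Y.1 x - θ) ^ 2 ≤ U (Y.1 x) / c₁ := by
            rw [le_div_iff₀ hc₁]; linarith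
          have h5 : 2 / c₁ * U (Y.1 x) = 2 * (U (Y.1 x) / c₁) := by ring
          rw [h5]
          nlinarith [sq_nonneg ((Y.1 x - θ) + (psiV s v (x - b) - θ))]
        have hmain : 0 ≤ U (Y.1 x) ∧ (Y.1 x - psiV s v (x - b)) ^ 2 ≤
            2 * C ^ 2 * X ^ 2 + 2 / c₁ * U (Y.1 x) := by
          rcases le_total b x with h | h
          · have h1 : s 0 ≤ psiV s v (x - b) :=
              hmono (mul_nonneg (by linarith) (by linarith))
            have h2 := hlow₁ (Y.1 x) ⟨by linarith, by linarith⟩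
            refine ⟨le_trans (by positivity) h2, key a ?_ h2⟩
            rw [hX, abs_of_nonneg (sub_nonneg.2 h)]
            exact hr _
          · have h1 : psiV s v (x - b) ≤ s 0 :=
              hmono (mul_nonpos_of_nonneg_of_nonpos (by linarith) (by linarith))
            have h2 := hlow₂ (Y.1 x) ⟨by linarith, by linarith⟩
            refine ⟨le_trans (by positivity) h2, key (-a) ?_ (by rwa [sub_neg_eq_add])⟩
            rw [hX, abs_of_nonpos (sub_nonpos.2 h), sub_neg_eq_add, mul_neg, neg_neg]
            exact hl _
        obtain ⟨hU0, hm⟩ := hmain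
        have hg0 : 0 ≤ growth (2 * α) (radius b₀ x - t) := zero_le_one.trans (one_le_growth _ _)
        have he : U (Y.1 x) ≤ energyDensity U (Y.1 x) (g x) (Y.2 x) := by
          unfold energyDensity
          linarith [sq_nonneg (g x), sq_nonneg (Y.2 x)]
        have he0 := hU0.trans he
        rw [← ENNReal.ofReal_mul (by positivity), ← ENNReal.ofReal_mul hB0,
          ← ENNReal.ofReal_add (by positivity) (by positivity), hX2]
        refine ENNReal.ofReal_le_ofReal ?_
        have hw := weight_le_growth (x := x) (σ := 2 * α) (by linarith) hR ht hb
        set w := (1 + |x - b|) ^ (2 * α) with hwdef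
        have hw0 : 0 ≤ w := by positivity
        calc w * (Y.1 x - psiV s v (x - b)) ^ 2
            ≤ w * (2 * C ^ 2 * X ^ 2 + 2 / c₁ * U (Y.1 x)) := by gcongr
          _ = 2 * C ^ 2 * (w * X ^ 2) + 2 / c₁ * (w * U (Y.1 x)) := by ring
          _ ≤ 2 * C ^ 2 * (w * X ^ 2) + 2 / c₁ * ((2 ^ (2 * α) * (1 + R + 2 * t) ^ (2 * α) *
              growth (2 * α) (radius b₀ x - t)) * energyDensity U (Y.1 x) (g x) (Y.2 x)) := by
              gcongr
          _ = _ := by rw [hB]; ring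
    _ = ENNReal.ofReal (2 * C ^ 2) * (∫⁻ x : ℝ, ENNReal.ofReal ((1 + |x|) ^ (2 * α) *
        Real.exp (-(2 * c * |x|)))) + ENNReal.ofReal B * ∫⁻ x, ENNReal.ofReal
        (growth (2 * α) (radius b₀ x - t) * energyDensity U (Y.1 x) (g x) (Y.2 x)) := by
        rw [lintegral_add_left (by fun_prop), lintegral_const_mul' _ _ ENNReal.ofReal_ne_top,
          lintegral_const_mul' _ _ ENNReal.ofReal_ne_top]
        congr 2
        exact lintegral_sub_right_eq_self (fun x => ENNReal.ofReal ((1 + |x|) ^ (2 * α) *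
          Real.exp (-(2 * c * |x|)))) b
    _ ≤ ENNReal.ofReal (2 * C ^ 2) * ENNReal.ofReal I + ENNReal.ofReal B * ENNReal.ofReal E := by
        gcongr
    _ = _ := by
        rw [← ENNReal.ofReal_mul (by positivity), ← ENNReal.ofReal_mul hB0,
          ← ENNReal.ofReal_add (by positivity) (by positivity)]

/-- The weighted norm of the perturbation grows at most like a power of time. -/
lemma normL2_le_of_sq_le {f : ℝ → ℝ} {α κ A B R t : ℝ} (hα : 0 ≤ α) (hκ : α ≤ κ) (hA : 0 ≤ A)
    (hB : 0 ≤ B) (hR : 0 ≤ R) (ht : 0 ≤ t)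
    (h : normL2 α f ^ 2 ≤ ENNReal.ofReal (A + B * (1 + R + 2 * t) ^ (2 * α))) :
    normL2 α f ≤ ENNReal.ofReal ((√(A + B * (2 + R) ^ (2 * α)) + 1) * (1 + t) ^ κ) := by
  -- From `1 + R + 2t ≤ (2 + R)(1 + t)`, which separates the constant from the time dependence.
  have h1 : (1 + R + 2 * t) ^ (2 * α) ≤ (2 + R) ^ (2 * α) * (1 + t) ^ (2 * α) := by
    rw [← Real.mul_rpow (by positivity) (by positivity)]
    have : 1 + R + 2 * t ≤ (2 + R) * (1 + t) := by nlinarith [mul_nonneg hR ht]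
    gcongr
  have h2 : 1 ≤ (1 + t) ^ (2 * α) := Real.one_le_rpow (by linarith) (by linarith)
  have h3 : A + B * (1 + R + 2 * t) ^ (2 * α) ≤
      (√(A + B * (2 + R) ^ (2 * α)) * (1 + t) ^ α) ^ 2 := by
    rw [mul_pow, Real.sq_sqrt (by positivity), ← Real.rpow_natCast ((1 + t) ^ α),
      ← Real.rpow_mul (by linarith)]
    have e : α * ((2 : ℕ) : ℝ) = 2 * α := by push_cast; ring
    rw [e]
    nlinarith [mul_le_mul_of_nonneg_left h1 hB, mul_le_mul_of_nonneg_left h2 hA]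
  have h4 : normL2 α f ≤ ENNReal.ofReal (√(A + B * (2 + R) ^ (2 * α)) * (1 + t) ^ α) := by
    rw [← ENNReal.pow_le_pow_left_iff two_ne_zero, ← ENNReal.ofReal_pow (by positivity)]
    exact h.trans (ENNReal.ofReal_le_ofReal h3)
  refine h4.trans (ENNReal.ofReal_le_ofReal ?_)
  have h5 : (1 + t) ^ α ≤ (1 + t) ^ κ := Real.rpow_le_rpow_of_exponent_le (by linarith) hκ
  gcongr
  linarith

end Final

end KinkVirial

end

/-! ### Choice of the constants and conclusion -/

theorem propositionA1 (U : ℝ → ℝ) (a m : ℝ) (hU : KinkVirial.ConditionU1 U a m)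
    (s : ℝ → ℝ) (hs : KinkVirial.IsKink U a s)
    (β : ℝ) (hβ : 5 / 2 < β) (vbar : ℝ) (hvbar : vbar < 1) :
    ∃ ε : ℝ, 0 < ε ∧ ∀ ν : ℝ, 0 < ν → ∀ d₀ : ℝ, 0 ≤ d₀ → ∃ C : ℝ, 0 < C ∧
      ∀ Y : ℝ → KinkVirial.State, KinkVirial.IsSolution U s Y →
      ∀ (T : ℝ≥0∞) (b v : ℝ → ℝ), KinkVirial.IsSymplecticSplitting s Y T b v →
      ∀ X : ℝ → KinkVirial.State,
        X = (fun t => KinkVirial.perturbation s (b t) (v t) (Y t)) →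
        |v 0| ≤ vbar →
        KinkVirial.MemE (5 / 2 + ν) (X 0) →
        KinkVirial.normE (5 / 2 + ν) (X 0) ≤ ENNReal.ofReal d₀ →
        (∀ t ∈ KinkVirial.timeInterval T,
          KinkVirial.majorant₁ β X t < ENNReal.ofReal ε ∧
          KinkVirial.majorant₂ X t < ENNReal.ofReal ε) →
        ∀ t ∈ KinkVirial.timeInterval T, 0 < t →
          KinkVirial.MemL2 (5 / 2 + ν) (X t).1 ∧
          KinkVirial.normL2 (5 / 2 + ν) (X t).1 ≤
            ENNReal.ofReal (C * (1 + t) ^ (4 + ν)) := by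
  open KinkVirial in
  obtain ⟨ε₀, hε₀, hpos, hlow⟩ := hU.exists_lower
  obtain ⟨Cψ, hCψ, c, hc, hdecay⟩ := hs.exists_psiV_decay hU
  have hs0 : |s 0| < a := abs_lt.2 ⟨hs.lt_left hU 0, hs.lt_right hU 0⟩
  -- Half the distance from `s 0` to the nearer well: an `ε`-perturbation with `ε ≤ η` still leaves
  -- the field at the centre `η` away from both wells.
  set η := (a - |s 0|) / 2 with hη
  have hη0 : 0 < η := by simp only [hη]; linarith
  have hηs : |s 0| + 2 * η ≤ a := by simp only [hη]; linarith
  obtain ⟨c₁, hc₁, hlow₁, hlow₂⟩ := hlow η hη0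
  -- The three entries give `U ≥ 0` along the solution, separation from the wells at the centre, and
  -- the range `[-(a + 1), a + 1]` of the initial energy bound. None involves `ν` or `d₀`.
  set ε := min ε₀ (min η 1) with hε
  have hε0 : 0 < ε := by positivity
  have hεε₀ : ε ≤ ε₀ := min_le_left _ _
  have hεη : ε ≤ η := (min_le_right _ _).trans (min_le_left _ _)
  have hε1 : ε ≤ 1 := (min_le_right _ _).trans (min_le_right _ _)
  refine ⟨ε, hε0, fun ν hν d₀ hd₀ => ?_⟩
  set α := 5 / 2 + ν with hα
  have hα0 : 0 < α := by positivity
  obtain ⟨E, hE0, hE⟩ := exists_initial_energy_bound hU hs hvbar hα0 hd₀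
  have hI := lintegral_rpow_mul_exp_lt_top (σ := 2 * α) (by linarith) hc
  set I := (∫⁻ x : ℝ, ENNReal.ofReal ((1 + |x|) ^ (2 * α) * Real.exp (-(2 * c * |x|)))).toReal
    with hIdef
  have hI' := (ENNReal.ofReal_toReal hI.ne).ge
  set κ := min c₁ (1 / 2) * η ^ 2 with hκ
  have hκ0 : 0 < κ := by positivity
  -- Solves `R ^ (2α) κ = 2E + κ`, just above the threshold of `abs_sub_centre_le`.
  set R := (2 * E / κ + 1) ^ (1 / (2 * α)) with hR
  have hR0 : 0 ≤ R := by positivity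
  have hRE : 2 * E < R ^ (2 * α) * κ := by
    rw [hR, ← Real.rpow_mul (by positivity), one_div, inv_mul_cancel₀ (by positivity),
      Real.rpow_one, add_mul, div_mul_cancel₀ _ hκ0.ne']
    linarith
  set A := 2 * Cψ ^ 2 * I
  set B := 2 / c₁ * 2 ^ (2 * α) * E
  have hA0 : 0 ≤ A := mul_nonneg (by positivity) ENNReal.toReal_nonneg
  have hB0 : 0 ≤ B := by positivity
  refine ⟨√(A + B * (2 + R) ^ (2 * α)) + 1, by positivity, ?_⟩
  rintro Y hY T b v hsplit X rfl hv0 - hX0 hmaj t ht htpos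
  have hsub : ∀ r ∈ Icc 0 t, r ∈ timeInterval T := fun r hr =>
    ⟨hr.1, (ENNReal.ofReal_le_ofReal hr.2).trans_lt ht.2⟩
  have hpert : ∀ r ∈ Icc 0 t, ∀ᵐ x, |(Y r).1 x - psiV s (v r) (x - b r)| ≤ ε := fun r hr =>
    ae_abs_le_of_majorant₂ hε0.le (hmaj t ht).2 hr
  have hconf : ∀ r ∈ Icc 0 t, ∀ᵐ x, (Y r).1 x ∈ Icc (-a - ε) (a + ε) := fun r hr => by
    filter_upwards [hpert r hr] with x hx
    have h1 := abs_le.1 hx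
    have h2 : -a < psiV s (v r) (x - b r) := hs.lt_left hU _
    have h3 : psiV s (v r) (x - b r) < a := hs.lt_right hU _
    constructor <;> linarith
  have h0 : (0 : ℝ) ∈ Icc 0 t := left_mem_Icc.2 htpos.le
  have htt : t ∈ Icc 0 t := right_mem_Icc.2 htpos.le
  have hinit := hE (Y 0) (b 0) (v 0) hv0
    (by
      filter_upwards [hconf 0 h0] with x hx
      exact ⟨by linarith [hx.1], by linarith [hx.2]⟩)
    ((hY.mem 0).snd hs).1 hX0
  obtain ⟨g, hg, -⟩ := (hY.mem t).exists_hasWeakDeriv hs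
  have henergy := hY.cone_energy_le hU.smooth hs htpos.le (by linarith : 0 ≤ 2 * α) hconf
    (fun z hz => hpos z ⟨by linarith [hz.1], by linarith [hz.2]⟩) hinit hg
  have hvt := hsplit.subluminal t ht
  have hl₁ : ∀ ψ ∈ Icc (-a + η) (a + ε), c₁ * (ψ - a) ^ 2 ≤ U ψ := fun ψ hψ =>
    hlow₁ ψ ⟨hψ.1, by linarith [hψ.2]⟩
  have hl₂ : ∀ ψ ∈ Icc (-a - ε) (a - η), c₁ * (ψ + a) ^ 2 ≤ U ψ := fun ψ hψ =>
    hlow₂ ψ ⟨by linarith [hψ.1], hψ.2⟩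
  have hcentre := abs_sub_centre_le hU hs (by linarith) hR0 hE0 hη0 hηs hεη hvt hc₁ hl₁ hl₂
    hg.1 (hpert t htt) hg henergy hRE
  -- Only the distance of the kink to the wells enters at time `t`, and its bound is uniform in the
  -- velocity; so `v t` may come arbitrarily close to the speed of light.
  have hsq := normL2_perturbation_sq_le hU hs hα0 hR0 htpos.le hE0 hηs hεη hvt hc₁ hl₁ hl₂
    (hdecay _ hvt).1 (hdecay _ hvt).2.1 (hpert t htt) henergy hcentre
    ENNReal.toReal_nonneg hI'
  have hfinal := normL2_le_of_sq_le (κ := 4 + ν) hα0.le (by simp only [hα]; linarith) hA0 hB0 hR0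
    htpos.le (hsq.trans (ENNReal.ofReal_le_ofReal (le_of_eq (by simp only [A, B]; ring))))
  refine ⟨⟨?_, hfinal.trans_lt ENNReal.ofReal_lt_top⟩, hfinal⟩
  have hm : AEStronglyMeasurable (perturbation s (b t) (v t) (Y t)).1 volume :=
    (locallyIntegrable_comp_add hg.1 (b t)).aestronglyMeasurable.sub
      (hasWeakDeriv_psiV hs (v t)).1.aestronglyMeasurable
  have hw : Continuous fun x : ℝ => (1 + |x|) ^ α :=
    Continuous.rpow_const (by fun_prop) fun x => Or.inr hα0.le
  exact hw.aestronglyMeasurable.mul hm
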